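/- Let $m\in\mathbb N$ and let $v,w:\mathbb R^3\to\mathbb R$ be even functions such that $w\in C_b^3(\mathbb R^3)$ ($w$ is three times continuously differentiable and bounded together with its derivatives up to order three) and $v(x)=\lambda|x|^{-1}+v_2(x)$ with $\lambda\in\mathbb R$ and $v_2\in L^\infty(\mathbb R^3)$. For $x\in\mathbb R^3$ and $\mathbf X=(X^{(1)},\dots,X^{(m)})\in\mathbb R^{3m}$ put $\underline w(x,\mathbf X)=\sum_{\ell=1}^m w(x-X^{(\ell)})$. For $(\mathbf X_0,\mathbf V_0,\varphi_0)\in\mathbb R^{6m}\times H^1(\mathbb R^3)$ consider the mean-field system $$\ddot{\mathbf X}_t=-\int_{\mathbb R^3}\nabla_{\mathbf X}\underline w(x,\mathbf X_t)\,|\varphi_t(x)|^2\,dx,\qquad i\partial_t\varphi_t=-\Delta\varphi_t+\underline w(\cdot,\mathbf X_t)\varphi_t+(v*|\varphi_t|^2)\varphi_t,$$ with $(\mathbf X_t,\dot{\mathbf X}_t,\varphi_t)|_{t=0}=(\mathbf X_0,\mathbf V_0,\varphi_0)$. Its mild form is, for all $t\in\mathbb R$, $$\mathbf X_t=\mathbf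 X_0+\int_0^t\mathbf V_s\,ds,\qquad \mathbf V_t=\mathbf V_0-\int_0^t\int_{\mathbb R^3}\nabla_{\mathbf X}\underline w(x,\mathbf X_s)|\varphi_s(x)|^2\,dx\,ds,$$ $$\varphi_t=e^{it\Delta}\varphi_0-i\int_0^te^{i(t-s)\Delta}\Big((v*|\varphi_s|^2)\varphi_s+\underline w(\cdot,\mathbf X_s)\varphi_s\Big)ds .$$ The energy is $$E(\mathbf X,\mathbf V,\varphi)=\tfrac12|\mathbf V|^2+\|\varphi\|_{H^1}^2+\tfrac12\iint|\varphi(x)|^2v(x-y)|\varphi(y)|^2\,dx\,dy+\int\underline w(x,\mathbf X)|\varphi(x)|^2\,dx,$$ where $\|\varphi\|_{H^1}^2=\|\varphi\|_{L^2}^2+\|\nabla\varphi\|_{L^2}^2$. Then there is a constant $\mu>0$, depending only on $m$, $v$ and $w$, such that for every $(\mathbf X_0,\mathbf V_0,\varphi_0)\in\mathbb R^{6m}\times H^1(\mathbb R^3)$ the following holds. 1. There is a unique $(\mathbf X,\mathbf V,\varphi)\in C(\mathbb R;\mathbb R^{6m}\times H^1(\mathbb R^3))$ that satisfies the mean-field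 system in mild form. 2. For all $t\in\mathbb R$, $\|\varphi_t\|_{L^2}=\|\varphi_0\|_{L^2}$ and $E(\mathbf X_t,\mathbf V_t,\varphi_t)=E(\mathbf X_0,\mathbf V_0,\varphi_0)$. 3. For all $t\in\mathbb R$, $$|\mathbf V_t|^2+\|\varphi_t\|_{H^1}^2\le 2E(\mathbf X_0,\mathbf V_0,\varphi_0)+\mu\big(\|\varphi_0\|_{L^2}^2+\|\varphi_0\|_{L^2}^6\big).$$ 4. If $\varphi_0\in H^2(\mathbb R^3)$, then $\varphi\in C^1(\mathbb R;L^2(\mathbb R^3))\cap C(\mathbb R;H^2(\mathbb R^3))$ and the mean-field system holds in the strong sense: at every time $t$, $\dot{\mathbf X}_t=\mathbf V_t$, the equation for $\ddot{\mathbf X}_t=\dot{\mathbf V}_t$ holds, and the equation for $\varphi_t$ holds as an identity in $L^2(\mathbb R^3)$. -/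

import Mathlib

open MeasureTheory
open scoped ENNReal FourierTransform LineDeriv SchwartzMap Gradient

namespace MeanField

noncomputable section

/-- Physical space `ℝ³` with its Euclidean norm. -/
abbrev R3 : Type := EuclideanSpace ℝ (Fin 3)

/-- The configuration space `ℝ^{3m}` of `m` tracer particles, with its Euclidean norm; the
coordinate `(l, i)` is the `i`-th coordinate of the `l`-th particle. -/
abbrev Config (m : ℕ) : Type := EuclideanSpace ℝ (Fin m × Fin 3)

/-- The position `X⁽ˡ⁾ ∈ ℝ³` of the `l`-th tracer particle. -/
def Config.particle {m : ℕ} (X : Config m) (l : Fin m) : R3 := WithLp.toLp 2 (fun i => X (l, i))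

/-- The complex Hilbert space `L²(ℝ³)`. -/
abbrev L2 : Type := Lp ℂ 2 (volume : Measure R3)

/-- `g` is the `i`-th distributional partial derivative of `f`. -/
def IsPartial (i : Fin 3) (f g : L2) : Prop :=
  ∂_{(EuclideanSpace.single i (1 : ℝ) : R3)} (f : 𝓢'(R3, ℂ)) = (g : 𝓢'(R3, ℂ))

theorem IsPartial.add {i : Fin 3} {f g f' g' : L2} (h : IsPartial i f g) (h' : IsPartial i f' g') :
    IsPartial i (f + f') (g + g') := by
  unfold IsPartial at *
  simp only [← Lp.toTemperedDistributionCLM_apply, map_add, LineDeriv.lineDerivOp_add] at *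
  rw [h, h']

theorem IsPartial.smul {i : Fin 3} {f g : L2} (c : ℂ) (h : IsPartial i f g) :
    IsPartial i (c • f) (c • g) := by
  unfold IsPartial at *
  simp only [← Lp.toTemperedDistributionCLM_apply, map_smul, LineDeriv.lineDerivOp_smul] at *
  rw [h]

theorem IsPartial.zero (i : Fin 3) : IsPartial i 0 0 := by
  simpa using IsPartial.smul (i := i) (0 : ℂ)
    (show IsPartial i 0 0 by
      unfold IsPartial
      simp only [← Lp.toTemperedDistributionCLM_apply, map_zero, LineDeriv.lineDerivOp_zero])

/-- The tuples `(f, ∂₁f, ∂₂f, ∂₃f)` of square integrable functions, the last three being the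
distributional partial derivatives of the first. -/
def sobolevOne : Submodule ℂ (PiLp 2 (fun _ : Option (Fin 3) => L2)) where
  carrier := {u | ∀ i, IsPartial i (u none) (u (some i))}
  add_mem' hu hu' i := (hu i).add (hu' i)
  zero_mem' i := IsPartial.zero i
  smul_mem' c _ hu i := (hu i).smul c

/-- The Sobolev space `H¹(ℝ³)`: square integrable functions `f` all of whose first distributional
partial derivatives are square integrable, recorded together with these (uniquely determined)
derivatives; the squared norm is `‖f‖² + ∑ᵢ ‖∂ᵢf‖²`. -/
abbrev H1 : Type := sobolevOne

/-- The underlying `L²` function of an `H¹` function. -/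
def H1.fn (u : H1) : L2 := u.1 none

/-- The partial derivatives of an `H¹` function. -/
def H1.partialDeriv (u : H1) (i : Fin 3) : L2 := u.1 (some i)

/-- The tuples `(f, ∂₁f, ∂₂f, ∂₃f)` of `H¹` functions, the last three being the distributional
partial derivatives of the first. -/
def sobolevTwo : Submodule ℂ (PiLp 2 (fun _ : Option (Fin 3) => H1)) where
  carrier := {u | ∀ i, IsPartial i (H1.fn (u none)) (H1.fn (u (some i)))}
  add_mem' hu hu' i := IsPartial.add (hu i) (hu' i)
  zero_mem' i := IsPartial.zero i
  smul_mem' c _ hu i := IsPartial.smul c (hu i)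

/-- The Sobolev space `H²(ℝ³)`: functions `f` in `H¹` all of whose first partial derivatives are
in `H¹`, recorded together with these; the squared norm is `‖f‖²_{H¹} + ∑ᵢ ‖∂ᵢf‖²_{H¹}`. -/
abbrev H2 : Type := sobolevTwo

/-- The inclusion of `H²` in `H¹`. -/
def H2.toH1 (u : H2) : H1 := u.1 none

/-- The Laplacian `Δ : H² → L²`, the sum of the `∂ᵢ∂ᵢ`. -/
def H2.laplacian (u : H2) : L2 := ∑ i, H1.partialDeriv (u.1 (some i)) i

/-- The Fourier symbol of `exp(itΔ)`, for the transform `∫ exp(-2πi x·ξ) f(x) dx`. -/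
def schrodingerSymbol (t : ℝ) (ξ : R3) : ℂ :=
  Complex.exp (-(Complex.I * ((t * (2 * Real.pi * ‖ξ‖) ^ 2 : ℝ) : ℂ)))

theorem memLp_schrodingerSymbol (t : ℝ) : MemLp (schrodingerSymbol t) ∞ (volume : Measure R3) := by
  refine memLp_top_of_bound (C := 1) ?_ (Filter.Eventually.of_forall fun ξ => ?_)
  · exact Continuous.aestronglyMeasurable (by unfold schrodingerSymbol; fun_prop)
  · rw [schrodingerSymbol, Complex.norm_exp, Complex.neg_re, Complex.I_mul_re, Complex.ofReal_im]
    simp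

/-- The free Schrödinger group `exp(itΔ)` on `L²(ℝ³)`. -/
def freeSchrodinger (t : ℝ) (f : L2) : L2 :=
  𝓕⁻ (((memLp_schrodingerSymbol t).toLp (schrodingerSymbol t) • 𝓕 f : L2))

/-- The phase space `ℝ^{3m} × ℝ^{3m} × H¹(ℝ³)` of triples `(X, V, φ)`. -/
abbrev Phase (m : ℕ) : Type := Config m × Config m × H1

/-- The hypotheses on the boson-boson potential `v` and the boson-tracer potential `w`: both are
even, `w ∈ C_b³` and `v = λ/|x| + v₂` with `v₂ ∈ L^∞`. -/
structure PotentialCondition (v w : R3 → ℝ) : Prop where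
  w_even : ∀ x, w (-x) = w x
  v_even : ∀ᵐ x, v (-x) = v x
  w_contDiff : ContDiff ℝ 3 w
  w_bounded : ∀ k : ℕ, k ≤ 3 → ∃ C : ℝ, ∀ x, ‖iteratedFDeriv ℝ k w x‖ ≤ C
  v_decomp : ∃ (lam : ℝ) (v₂ : R3 → ℝ), MemLp v₂ ∞ volume ∧
    ∀ᵐ x, v x = lam * ‖x‖⁻¹ + v₂ x

/-- The total boson-tracer interaction `∑ₗ w(x - X⁽ˡ⁾)`. -/
def totalTracer {m : ℕ} (w : R3 → ℝ) (x : R3) (X : Config m) : ℝ := ∑ l, w (x - X.particle l)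

/-- The acceleration `-∫ ∇_X (∑ₗ w(x - X⁽ˡ⁾)) |φ(x)|² dx` of the tracer particles. -/
def acceleration {m : ℕ} (w : R3 → ℝ) (X : Config m) (φ : L2) : Config m :=
  -∫ x, ‖φ x‖ ^ 2 • ∇ (fun Y : Config m => totalTracer w x Y) X

/-- The Hartree potential `v * |φ|²`. -/
def hartree (v : R3 → ℝ) (φ : L2) (x : R3) : ℝ := ∫ y, v (x - y) * ‖φ y‖ ^ 2

/-- `F` is the `L²` class of `(v * |φ|²) φ + (∑ₗ w(· - X⁽ˡ⁾)) φ`. -/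
def IsInteraction {m : ℕ} (v w : R3 → ℝ) (X : Config m) (φ F : L2) : Prop :=
  ∀ᵐ x, F x = ((hartree v φ x + totalTracer w x X : ℝ) : ℂ) * φ x

/-- `t ↦ (X_t, V_t, φ_t)` satisfies the mean-field equations in integral (Duhamel) form on `ℝ`,
with data `z₀ = (X₀, V₀, φ₀)` at time zero. -/
structure IsMildSolution {m : ℕ} (v w : R3 → ℝ) (z₀ : Phase m) (z : ℝ → Phase m) : Prop where
  position : ∀ t, (z t).1 = z₀.1 + ∫ s in (0 : ℝ)..t, (z s).2.1
  velocity : ∀ t, (z t).2.1 = z₀.2.1 + ∫ s in (0 : ℝ)..t, acceleration w (z s).1 (z s).2.2.fn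
  field : ∃ F : ℝ → L2, (∀ s, IsInteraction v w (z s).1 (z s).2.2.fn (F s)) ∧
    ∀ t, IntervalIntegrable (fun s => freeSchrodinger (t - s) (F s)) volume 0 t ∧
      (z t).2.2.fn = freeSchrodinger t z₀.2.2.fn -
        Complex.I • ∫ s in (0 : ℝ)..t, freeSchrodinger (t - s) (F s)

/-- `t ↦ (X_t, V_t, φ_t)` is a strong solution of the mean-field equations on `ℝ`, with data `z₀`
at time zero: the boson field `φ` is in `C(ℝ; H²) ∩ C¹(ℝ; L²)`, and
`X' = V`, `V' = -∫ ∇_X (∑ₗ w(x - X⁽ˡ⁾)) |φ(x)|² dx`,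
`i φ' = -Δφ + (∑ₗ w(x - X⁽ˡ⁾)) φ + (v * |φ|²) φ` hold at every time, the last one in `L²`. -/
structure IsStrongSolution {m : ℕ} (v w : R3 → ℝ) (z₀ : Phase m) (z : ℝ → Phase m) : Prop where
  initial : z 0 = z₀
  newton_position : ∀ t, HasDerivAt (fun s => (z s).1) (z t).2.1 t
  newton_velocity : ∀ t, HasDerivAt (fun s => (z s).2.1) (acceleration w (z t).1 (z t).2.2.fn) t
  contDiff_field : ContDiff ℝ 1 (fun t => (z t).2.2.fn)
  field : ∃ u : ℝ → H2, Continuous u ∧ (∀ t, (u t).toH1 = (z t).2.2) ∧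
    ∀ t, ∃ F : L2, IsInteraction v w (z t).1 (z t).2.2.fn F ∧
      Complex.I • deriv (fun s => (z s).2.2.fn) t = -(u t).laplacian + F

/-- The energy `V²/2 + ‖φ‖²_{H¹} + ½ ∬ |φ(x)|² v(x-y) |φ(y)|² dx dy + ∫ ∑ₗ w(x-X⁽ˡ⁾) |φ(x)|² dx`. -/
def energy {m : ℕ} (v w : R3 → ℝ) (z : Phase m) : ℝ :=
  ‖z.2.1‖ ^ 2 / 2 + ‖z.2.2‖ ^ 2
    + (∫ x, ∫ y, ‖z.2.2.fn x‖ ^ 2 * v (x - y) * ‖z.2.2.fn y‖ ^ 2) / 2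
    + ∫ x, totalTracer w x z.1 * ‖z.2.2.fn x‖ ^ 2

end

end MeanField

open MeasureTheory Filter Topology
open scoped ENNReal FourierTransform LineDeriv SchwartzMap Gradient ComplexConjugate

namespace MeanField

noncomputable section

/-! ### Square integrable functions -/

/-! The system is solved as an ordinary differential equation. In the interaction picture `ψ_t =
exp(-itΔ)φ_t` the Laplacian disappears, and a continuous mild solution is the same thing as a
differentiable solution of `y' = fieldI t y` on `ℝ^{3m} × ℝ^{3m} × H¹`
(`isMildSolution_of_hasDerivAt`, `hasDerivAt_of_isMildSolution`). The free group is isometric on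
`H¹`, so Picard–Lindelöf and uniqueness need only that the nonlinearity is Lipschitz on balls of the
phase space (`nonlinearity_lipschitzOn`).

That estimate rests on Hardy's inequality. It shows that `v(x - ·)u` lies in `L²` for `u ∈ H¹`,
uniformly in `x`, so the polarized Hartree potential `v * Re(f̄ g)` is bounded as soon as one factor
is in `H¹` and the other in `L²`. A derivative of the convolution can be put on `f` or `g` instead
of `v`, hence for `f, g ∈ H¹` the potential has bounded first derivatives and multiplies `H¹` into
itself. The tracer potential does the same because `w` has bounded derivatives.

Global existence follows from two conservation laws. Mass is conserved because the potential is
real. For the energy, `Δφ` is not in `L²`, so no formal computation is available. Instead, the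
increment of the potential energy is written exactly as the inner product of an `H¹` function,
tending to twice the interaction term, with the increment of `φ` (`potentialEnergy_sub`). The part
of the increment due to the free group has difference quotients that converge only when tested
against `H¹`, which is exactly what is needed (`tendsto_inner_slope_schU_of_tendsto`). Energy and
mass together bound the velocity and the `H¹` norm, because the Hartree energy is at most linear in
`‖φ‖_{H¹}` at fixed mass. The positions then grow at most linearly.

For data in `H²`, each `∂ⱼφ` satisfies the equation differentiated in `xⱼ`, which is affine in
`∂ⱼφ`. This affine equation is globally well posed in `H¹`, and its solutions in `L²` are unique; so
the `H¹` solution starting from `∂ⱼφ₀` is `∂ⱼφ` (`linearized_solution_fn`), and `φ` is a continuous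
curve in `H²`. On `H²` the free group is differentiable in `L²`, which gives the strong equation. -/

theorem integrable_norm_sq (f : L2) : Integrable (fun x => ‖f x‖ ^ 2) :=
  (memLp_two_iff_integrable_sq_norm (Lp.aestronglyMeasurable f)).1 (Lp.memLp f)

theorem L2_inner_eq (f g : L2) : inner ℂ f g = ∫ x, conj (f x) * g x := by
  rw [L2.inner_def]; simp [RCLike.inner_apply, mul_comm]

theorem L2_norm_sq_eq (f : L2) : ‖f‖ ^ 2 = ∫ x, ‖f x‖ ^ 2 := by
  have h : ((‖f‖ ^ 2 : ℝ) : ℂ) = ((∫ x, ‖f x‖ ^ 2 : ℝ) : ℂ) := by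
    have := inner_self_eq_norm_sq_to_K (𝕜 := ℂ) f
    rw [L2_inner_eq] at this
    push_cast
    rw [← integral_complex_ofReal]
    refine Eq.trans this.symm ?_
    congr 1; ext x
    rw [mul_comm, Complex.mul_conj']; simp
  exact_mod_cast h

theorem memLp_of_ae_norm_le {f : L2} {u : R3 → ℂ} (hu : AEStronglyMeasurable u volume) {C : ℝ}
    (h : ∀ᵐ x, ‖u x‖ ≤ C * ‖f x‖) : MemLp u 2 volume :=
  (Lp.memLp f).of_le_mul hu h

theorem integrable_conj_mul (f g : L2) : Integrable (fun x => conj (f x) * g x) := by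
  have := L2.integrable_inner (𝕜 := ℂ) f g
  simpa [RCLike.inner_apply, mul_comm] using this

open scoped Classical in
/-- The product of a function and an `L²` function, if it is square integrable. -/
def mulL2 (a : R3 → ℂ) (f : L2) : L2 :=
  if h : MemLp (fun x => a x * f x) 2 volume then h.toLp _ else 0

theorem mulL2_coe_of_memLp {a : R3 → ℂ} {f : L2} (h : MemLp (fun x => a x * f x) 2 volume) :
    mulL2 a f =ᵐ[volume] fun x => a x * f x := by
  rw [mulL2, dif_pos h]; exact h.coeFn_toLp

/-- Measurable functions bounded by `C`. -/
structure IsBddBy (a : R3 → ℂ) (C : ℝ) : Prop where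
  meas : AEStronglyMeasurable a volume
  bound : ∀ᵐ x, ‖a x‖ ≤ C

theorem IsBddBy.memLp_mul {a : R3 → ℂ} {C : ℝ} (h : IsBddBy a C) (f : L2) :
    MemLp (fun x => a x * f x) 2 volume := by
  refine memLp_of_ae_norm_le (f := f) (h.meas.mul (Lp.aestronglyMeasurable f)) (C := C) ?_
  filter_upwards [h.bound] with x hx
  rw [norm_mul]; gcongr

theorem IsBddBy.mulL2_coe {a : R3 → ℂ} {C : ℝ} (h : IsBddBy a C) (f : L2) :
    mulL2 a f =ᵐ[volume] fun x => a x * f x := mulL2_coe_of_memLp (h.memLp_mul f)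

theorem IsBddBy.norm_mulL2_le {a : R3 → ℂ} {C : ℝ} (h : IsBddBy a C) (f : L2) :
    ‖mulL2 a f‖ ≤ C * ‖f‖ := by
  refine Lp.norm_le_mul_norm_of_ae_le_mul ?_
  filter_upwards [h.mulL2_coe f, h.bound] with x hx hb
  rw [hx, norm_mul]; gcongr

theorem mulL2_add_of_memLp {a : R3 → ℂ} {f g : L2} (hf : MemLp (fun x => a x * f x) 2 volume)
    (hg : MemLp (fun x => a x * g x) 2 volume) : mulL2 a (f + g) = mulL2 a f + mulL2 a g := by
  have h : MemLp (fun x => a x * (f + g : L2) x) 2 volume := by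
    refine (hf.add hg).ae_eq ?_
    filter_upwards [Lp.coeFn_add f g] with x hx
    simp only [Pi.add_apply, hx, mul_add]
  refine Lp.ext ?_
  filter_upwards [mulL2_coe_of_memLp h, mulL2_coe_of_memLp hf, mulL2_coe_of_memLp hg,
    Lp.coeFn_add f g, Lp.coeFn_add (mulL2 a f) (mulL2 a g)] with x h1 h2 h3 h4 h5
  rw [h1, h5, h4]; simp [h2, h3, mul_add]

section Bdd
variable {a b : R3 → ℂ} {A B : ℝ}

theorem IsBddBy.mulL2_add (h : IsBddBy a A) (f g : L2) :
    mulL2 a (f + g) = mulL2 a f + mulL2 a g :=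
  mulL2_add_of_memLp (h.memLp_mul f) (h.memLp_mul g)

theorem IsBddBy.mulL2_sub (h : IsBddBy a A) (f g : L2) :
    mulL2 a (f - g) = mulL2 a f - mulL2 a g := by
  have := h.mulL2_add (f - g) g
  rw [sub_add_cancel] at this
  rw [this, add_sub_cancel_right]

theorem IsBddBy.add (ha : IsBddBy a A) (hb : IsBddBy b B) :
    IsBddBy (fun x => a x + b x) (A + B) where
  meas := ha.meas.add hb.meas
  bound := by
    filter_upwards [ha.bound, hb.bound] with x h1 h2
    exact (norm_add_le _ _).trans (add_le_add h1 h2)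

theorem IsBddBy.add_mulL2 (ha : IsBddBy a A) (hb : IsBddBy b B) (f : L2) :
    mulL2 (fun x => a x + b x) f = mulL2 a f + mulL2 b f := by
  refine Lp.ext ?_
  filter_upwards [(ha.add hb).mulL2_coe f, ha.mulL2_coe f, hb.mulL2_coe f,
    Lp.coeFn_add (mulL2 a f) (mulL2 b f)] with x h1 h2 h3 h4
  rw [h1, h4]; simp [h2, h3, add_mul]

theorem mulL2_congr (h : ∀ x, a x = b x) (f : L2) : mulL2 a f = mulL2 b f := by
  rw [funext h]

end Bdd

/-- Dominated convergence in `L²` for products with a fixed function. -/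
theorem tendsto_L2_of_dominated {ι : Type*} {l : Filter ι} [l.IsCountablyGenerated]
    {u : ι → L2} {u₀ F : L2} {a : ι → R3 → ℂ} {a₀ : R3 → ℂ} {b : R3 → ℝ}
    (hu : ∀ᶠ n in l, u n =ᵐ[volume] fun x => a n x * F x)
    (hu₀ : u₀ =ᵐ[volume] fun x => a₀ x * F x)
    (hb : ∀ᶠ n in l, ∀ᵐ x, ‖a n x - a₀ x‖ ≤ b x)
    (hF : Integrable (fun x => (b x * ‖F x‖) ^ 2))
    (hlim : ∀ᵐ x, Tendsto (fun n => a n x) l (𝓝 (a₀ x))) :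
    Tendsto u l (𝓝 u₀) := by
  rw [tendsto_iff_norm_sub_tendsto_zero]
  -- The scalar dominated convergence theorem is applied to the squared norms, with majorant
  -- `(b‖F‖)²`; the square root is taken at the end.
  have key : Tendsto (fun n => ∫ x, ‖(u n - u₀ : L2) x‖ ^ 2) l (𝓝 0) := by
    have h0 : Tendsto (fun n => ∫ x, ‖(a n x - a₀ x) * F x‖ ^ 2) l (𝓝 (∫ _ : R3, (0 : ℝ))) := by
      refine tendsto_integral_filter_of_dominated_convergence
        (fun x => (b x * ‖F x‖) ^ 2) ?_ ?_ hF ?_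
      · filter_upwards [hu] with n hn
        have : AEStronglyMeasurable (fun x => ‖(u n - u₀ : L2) x‖ ^ 2) volume :=
          (integrable_norm_sq _).1
        refine this.congr ?_
        filter_upwards [hn, hu₀, Lp.coeFn_sub (u n) u₀] with x h1 h2 h3
        rw [h3]; simp [h1, h2, sub_mul]
      · filter_upwards [hb] with n hn
        filter_upwards [hn] with x hx
        rw [norm_mul, Real.norm_eq_abs, abs_of_nonneg (by positivity)]
        gcongr
      · filter_upwards [hlim] with x hx
        have : Tendsto (fun n => ‖(a n x - a₀ x) * F x‖ ^ 2) l
            (𝓝 (‖(a₀ x - a₀ x) * F x‖ ^ 2)) :=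
          (((hx.sub_const _).mul_const _).norm).pow 2
        simpa using this
    simp only [integral_zero] at h0
    refine h0.congr' ?_
    filter_upwards [hu] with n hn
    refine integral_congr_ae ?_
    filter_upwards [hn, hu₀, Lp.coeFn_sub (u n) u₀] with x h1 h2 h3
    rw [h3]; simp [h1, h2, sub_mul]
  simp only [← L2_norm_sq_eq] at key
  have := (Real.continuous_sqrt.tendsto 0).comp key
  simpa [Function.comp_def, Real.sqrt_sq (norm_nonneg _)] using this

theorem mul_sq_integrable {b : R3 → ℝ} {C : ℝ} (hb : ∀ x, b x = C) (F : L2) :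
    Integrable (fun x => (b x * ‖F x‖) ^ 2) := by
  simp only [hb, mul_pow]; exact (integrable_norm_sq F).const_mul _

/-! ### The Sobolev space `H¹` -/

/-- The `H¹` function with given partial derivatives. -/
def H1.mk (f : L2) (g : Fin 3 → L2) (h : ∀ i, IsPartial i f (g i)) : H1 :=
  ⟨WithLp.toLp 2 (fun o => o.elim f g), h⟩

@[simp] theorem H1.mk_fn (f : L2) (g : Fin 3 → L2) (h) : (H1.mk f g h).fn = f := rfl
@[simp] theorem H1.mk_partialDeriv (f : L2) (g : Fin 3 → L2) (h) (i) :
    (H1.mk f g h).partialDeriv i = g i := rfl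

theorem H1.isPartial (u : H1) (i : Fin 3) : IsPartial i u.fn (u.partialDeriv i) := u.2 i

theorem H1.norm_sq (u : H1) : ‖u‖ ^ 2 = ‖u.fn‖ ^ 2 + ∑ i, ‖u.partialDeriv i‖ ^ 2 := by
  rw [Submodule.coe_norm, PiLp.norm_sq_eq_of_L2, Fintype.sum_option]; rfl

theorem H1.inner_eq (u w : H1) :
    inner ℂ u w = inner ℂ u.fn w.fn + ∑ i, inner ℂ (u.partialDeriv i) (w.partialDeriv i) := by
  rw [Submodule.coe_inner, PiLp.inner_apply, Fintype.sum_option]; rfl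

theorem H1.norm_fn_le (u : H1) : ‖u.fn‖ ≤ ‖u‖ := by
  refine le_of_sq_le_sq ?_ (norm_nonneg _) |>.trans le_rfl
  rw [H1.norm_sq]; simp only [le_add_iff_nonneg_right]; positivity

theorem H1.norm_partialDeriv_le (u : H1) (i : Fin 3) : ‖u.partialDeriv i‖ ≤ ‖u‖ := by
  refine le_of_sq_le_sq ?_ (norm_nonneg _)
  rw [H1.norm_sq]
  have : ‖u.partialDeriv i‖ ^ 2 ≤ ∑ i, ‖u.partialDeriv i‖ ^ 2 :=
    Finset.single_le_sum (f := fun i => ‖u.partialDeriv i‖ ^ 2) (fun _ _ => by positivity)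
      (Finset.mem_univ i)
  have := sq_nonneg ‖u.fn‖
  linarith

/-- There are four components, so the squared norm is at most `4C²`. -/
theorem H1.norm_le_of_bound (u : H1) {C : ℝ} (h0 : ‖u.fn‖ ≤ C)
    (h : ∀ i, ‖u.partialDeriv i‖ ≤ C) : ‖u‖ ≤ 2 * C := by
  have hC : 0 ≤ C := (norm_nonneg _).trans h0
  refine le_of_sq_le_sq ?_ (by positivity)
  rw [H1.norm_sq, Fin.sum_univ_three]
  have h0' := pow_le_pow_left₀ (norm_nonneg _) h0 2
  have h1 := fun i => pow_le_pow_left₀ (norm_nonneg _) (h i) 2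
  nlinarith [h1 0, h1 1, h1 2]

/-- The underlying function as a continuous linear map. -/
def fnL : H1 →L[ℂ] L2 :=
  LinearMap.mkContinuous ⟨⟨H1.fn, fun _ _ => rfl⟩, fun _ _ => rfl⟩ 1
    (fun u => by rw [one_mul]; exact u.norm_fn_le)

/-- The partial derivative as a continuous linear map. -/
def partialL (i : Fin 3) : H1 →L[ℂ] L2 :=
  LinearMap.mkContinuous ⟨⟨fun u => H1.partialDeriv u i, fun _ _ => rfl⟩, fun _ _ => rfl⟩ 1
    (fun u => by rw [one_mul]; exact u.norm_partialDeriv_le i)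

@[simp] theorem H1.fn_add (u w : H1) : (u + w).fn = u.fn + w.fn := rfl
@[simp] theorem H1.fn_sub (u w : H1) : (u - w).fn = u.fn - w.fn := rfl
@[simp] theorem H1.fn_smul (c : ℂ) (u : H1) : (c • u).fn = c • u.fn := rfl
@[simp] theorem H1.partialDeriv_smul (c : ℂ) (u : H1) (i) :
    (c • u).partialDeriv i = c • u.partialDeriv i := rfl

/-- `L²` embeds injectively into the tempered distributions. -/
theorem isPartial_unique {i : Fin 3} {f g g' : L2} (h : IsPartial i f g) (h' : IsPartial i f g') :
    g = g' := by
  unfold IsPartial at h h'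
  have h2 : (Lp.toTemperedDistributionCLM ℂ volume 2) (g - g' : L2) = 0 := by
    rw [map_sub, sub_eq_zero]; simp only [Lp.toTemperedDistributionCLM_apply]
    exact h.symm.trans h'
  have h3 : (g - g' : L2) ∈ (Lp.toTemperedDistributionCLM ℂ (volume : Measure R3) 2).ker := h2
  rw [Lp.ker_toTemperedDistributionCLM_eq_bot] at h3
  exact sub_eq_zero.1 ((Submodule.mem_bot ℂ).1 h3)

/-- The derivatives are determined by the function. Identities in `H¹` can therefore be checked in
`L²`, without comparing derivatives. -/
theorem H1.ext {u w : H1} (h : u.fn = w.fn) : u = w := by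
  apply Subtype.ext
  apply PiLp.ext
  rintro (_ | i)
  · exact h
  · have h1 := w.isPartial i
    rw [← h] at h1
    exact isPartial_unique (u.isPartial i) h1

theorem H1.tendsto_iff {ι : Type*} {l : Filter ι} {u : ι → H1} {u₀ : H1}
    (h0 : Tendsto (fun n => (u n).fn) l (𝓝 u₀.fn))
    (h : ∀ i, Tendsto (fun n => (u n).partialDeriv i) l (𝓝 (u₀.partialDeriv i))) :
    Tendsto u l (𝓝 u₀) := by
  rw [tendsto_subtype_rng]
  have : Tendsto (fun n => WithLp.ofLp (u n).1) l (𝓝 (WithLp.ofLp u₀.1)) := by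
    rw [tendsto_pi_nhds]
    rintro (_ | i)
    · exact h0
    · exact h i
  have h2 := ((PiLp.continuous_toLp 2 (fun _ : Option (Fin 3) => L2)).tendsto _).comp this
  exact h2

/-- Distributional differentiation and the embedding of `L²` are continuous into the tempered
distributions, so the graph is closed. Completeness of `H¹`, needed for Picard–Lindelöf, follows. -/
theorem isClosed_isPartial (i : Fin 3) : IsClosed {p : L2 × L2 | IsPartial i p.1 p.2} := by
  unfold IsPartial
  have h1 : Continuous fun p : L2 × L2 =>
      LineDeriv.lineDerivOpCLM ℂ 𝓢'(R3, ℂ) (EuclideanSpace.single i (1 : ℝ) : R3)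
        (Lp.toTemperedDistributionCLM ℂ volume 2 p.1) := by
    fun_prop
  have h2 : Continuous fun p : L2 × L2 => Lp.toTemperedDistributionCLM ℂ (volume : Measure R3) 2 p.2 := by
    fun_prop
  exact isClosed_eq h1 h2

instance : CompleteSpace H1 := by
  have : IsClosed (sobolevOne : Set (PiLp 2 (fun _ : Option (Fin 3) => L2))) := by
    have : (sobolevOne : Set (PiLp 2 (fun _ : Option (Fin 3) => L2))) =
        ⋂ i, (fun u : PiLp 2 (fun _ : Option (Fin 3) => L2) => (u none, u (some i))) ⁻¹'
          {p : L2 × L2 | IsPartial i p.1 p.2} := by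
      ext u; simp only [Set.mem_iInter, Set.mem_preimage, Set.mem_ofPred_eq]; rfl
    rw [this]
    refine isClosed_iInter fun i => (isClosed_isPartial i).preimage ?_
    fun_prop
  exact this.completeSpace_coe

/-- Lift to `H¹` of an isometry of `L²` commuting with the partial derivatives. -/
def H1.lift (T : L2 →ₗᵢ[ℂ] L2) (hT : ∀ i f g, IsPartial i f g → IsPartial i (T f) (T g)) :
    H1 →ₗᵢ[ℂ] H1 where
  toFun u := H1.mk (T u.fn) (fun i => T (u.partialDeriv i)) (fun i => hT i _ _ (u.isPartial i))
  map_add' u w := H1.ext (by simp)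
  map_smul' c u := H1.ext (by simp)
  norm_map' u := by
    have : ∀ w : H1, ‖w‖ = √(‖w‖ ^ 2) := fun w => (Real.sqrt_sq (norm_nonneg _)).symm
    rw [this u, H1.norm_sq]
    refine (this _).trans ?_
    rw [H1.norm_sq]
    simp

/-! ### Fourier multipliers -/

/-- The standard basis vector. -/
def basisVec (i : Fin 3) : R3 := EuclideanSpace.single i (1 : ℝ)

theorem inner_basisVec (ξ : R3) (i : Fin 3) : inner ℝ ξ (basisVec i) = ξ i := by
  simp [basisVec, EuclideanSpace.inner_single_right]

/-- The Fourier symbol of the `i`-th partial derivative. -/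
def partialSymbol (i : Fin 3) (ξ : R3) : ℂ := 2 * Real.pi * Complex.I * (ξ i : ℂ)

theorem continuous_partialSymbol (i : Fin 3) : Continuous (partialSymbol i) := by
  unfold partialSymbol; fun_prop

theorem fourier_partial_apply (i : Fin 3) (f : L2) (u : 𝓢(R3, ℂ)) :
    (𝓕 (∂_{(EuclideanSpace.single i (1 : ℝ) : R3)} (f : 𝓢'(R3, ℂ)))) u =
      ∫ ξ, u ξ * (partialSymbol i ξ * (𝓕 f : L2) ξ) := by
  rw [TemperedDistribution.fourier_lineDerivOp_eq, Lp.fourier_toTemperedDistribution_eq]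
  have h0 : (fun ξ : R3 => ((inner ℝ ξ (EuclideanSpace.single i (1 : ℝ) : R3) : ℝ) : ℂ)).HasTemperateGrowth := by
    fun_prop
  change (2 * Real.pi * Complex.I) • ((Lp.toTemperedDistribution (𝓕 f : L2))
    (SchwartzMap.smulLeftCLM ℂ _ u)) = _
  rw [Lp.toTemperedDistribution_apply, ← integral_smul]
  congr 1; ext ξ
  rw [SchwartzMap.smulLeftCLM_apply_apply h0]
  have := inner_basisVec ξ i
  simp only [basisVec] at this
  simp only [this, smul_eq_mul, partialSymbol]
  ring

/-- The Fourier transform is injective on tempered distributions and turns the derivative into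
multiplication by its symbol. Two locally integrable functions that define the same distribution
agree almost everywhere. -/
theorem isPartial_iff {i : Fin 3} {f g : L2} : IsPartial i f g ↔
    (𝓕 g : L2) =ᵐ[volume] fun ξ => partialSymbol i ξ * (𝓕 f : L2) ξ := by
  have hinj : IsPartial i f g ↔
      𝓕 (∂_{(EuclideanSpace.single i (1 : ℝ) : R3)} (f : 𝓢'(R3, ℂ))) = ((𝓕 g : L2) : 𝓢'(R3, ℂ)) := by
    unfold IsPartial
    rw [← Lp.fourier_toTemperedDistribution_eq]
    constructor
    · intro h; rw [h]
    · intro h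
      have := congrArg (fun T : 𝓢'(R3, ℂ) => 𝓕⁻ T) h
      simpa using this
  rw [hinj]
  constructor
  · intro h
    have hloc : LocallyIntegrable (fun ξ => (𝓕 f : L2) ξ) volume :=
      (Lp.memLp (𝓕 f : L2)).locallyIntegrable (by norm_num)
    -- The symbol is unbounded, so only local integrability of the product is known at this point.
    have hloc' : LocallyIntegrable (fun ξ => partialSymbol i ξ * (𝓕 f : L2) ξ) volume := by
      rw [← locallyIntegrableOn_univ] at hloc ⊢
      exact hloc.continuousOn_mul (continuous_partialSymbol i).continuousOn isClosed_univ.isLocallyClosed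
    refine ae_eq_of_integral_contDiff_smul_eq
      ((Lp.memLp (𝓕 g : L2)).locallyIntegrable (by norm_num)) hloc' ?_
    intro φ hφ hc
    have hg₁ : HasCompactSupport (Complex.ofRealCLM ∘ φ) := hc.comp_left rfl
    have hg₂ : ContDiff ℝ (⊤ : ℕ∞) (Complex.ofRealCLM ∘ φ) := by fun_prop
    have := congrArg (fun T : 𝓢'(R3, ℂ) => T (hg₁.toSchwartzMap hg₂)) h
    simp only [fourier_partial_apply, Lp.toTemperedDistribution_apply] at this
    simpa using this.symm
  · intro h
    ext u
    rw [fourier_partial_apply, Lp.toTemperedDistribution_apply]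
    refine integral_congr_ae ?_
    filter_upwards [h] with ξ hξ
    simp [hξ]

/-- Fourier multipliers commute with partial derivatives. -/
theorem IsPartial.of_multiplier {i : Fin 3} {f g f' g' : L2} {a : R3 → ℂ} (h : IsPartial i f g)
    (hf : (𝓕 f' : L2) =ᵐ[volume] fun ξ => a ξ * (𝓕 f : L2) ξ)
    (hg : (𝓕 g' : L2) =ᵐ[volume] fun ξ => a ξ * (𝓕 g : L2) ξ) : IsPartial i f' g' := by
  rw [isPartial_iff] at *
  filter_upwards [h, hf, hg] with ξ h1 h2 h3
  rw [h3, h1, h2]; ring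

theorem fourier_injective {f g : L2} (h : (𝓕 f : L2) =ᵐ[volume] (𝓕 g : L2)) : f = g := by
  have h1 : (𝓕 f : L2) = 𝓕 g := Lp.ext h
  exact (Lp.fourierTransformₗᵢ R3 ℂ).injective h1

/-! ### The free Schrödinger group -/

theorem fourier_freeSchrodinger (t : ℝ) (f : L2) :
    (𝓕 (freeSchrodinger t f) : L2) =ᵐ[volume] fun ξ => schrodingerSymbol t ξ * (𝓕 f : L2) ξ := by
  rw [freeSchrodinger, FourierTransform.fourier_fourierInv_eq]
  filter_upwards [Lp.coeFn_lpSMul (r := 2) ((memLp_schrodingerSymbol t).toLp (schrodingerSymbol t)) (𝓕 f : L2),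
    (memLp_schrodingerSymbol t).coeFn_toLp] with ξ h1 h2
  rw [h1]; simp [h2]

theorem norm_schrodingerSymbol (t : ℝ) (ξ : R3) : ‖schrodingerSymbol t ξ‖ = 1 := by
  rw [schrodingerSymbol, Complex.norm_exp, Complex.neg_re, Complex.I_mul_re, Complex.ofReal_im]
  simp

theorem schrodingerSymbol_add (s t : ℝ) (ξ : R3) :
    schrodingerSymbol (s + t) ξ = schrodingerSymbol s ξ * schrodingerSymbol t ξ := by
  rw [schrodingerSymbol, schrodingerSymbol, schrodingerSymbol, ← Complex.exp_add]
  congr 1; push_cast; ring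

theorem schrodingerSymbol_zero (ξ : R3) : schrodingerSymbol 0 ξ = 1 := by simp [schrodingerSymbol]

theorem norm_eq_of_ae_norm_eq {f g : L2} (h : ∀ᵐ x, ‖f x‖ = ‖g x‖) : ‖f‖ = ‖g‖ := by
  refine le_antisymm ?_ ?_
  · simpa using Lp.norm_le_mul_norm_of_ae_le_mul (c := 1) (f := f) (g := g)
      (by filter_upwards [h] with x hx; rw [hx]; simp)
  · simpa using Lp.norm_le_mul_norm_of_ae_le_mul (c := 1) (f := g) (g := f)
      (by filter_upwards [h] with x hx; rw [hx]; simp)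

/-- The free Schrödinger group as a linear isometry. -/
def schU (t : ℝ) : L2 →ₗᵢ[ℂ] L2 where
  toFun := freeSchrodinger t
  map_add' f g := by
    refine fourier_injective ?_
    rw [FourierTransform.fourier_add]
    filter_upwards [fourier_freeSchrodinger t (f + g), fourier_freeSchrodinger t f,
      fourier_freeSchrodinger t g, Lp.coeFn_add (𝓕 (freeSchrodinger t f)) (𝓕 (freeSchrodinger t g)),
      Lp.coeFn_add (𝓕 f : L2) (𝓕 g)] with ξ h1 h2 h3 h4 h5
    rw [h1, h4, FourierTransform.fourier_add, h5]; simp [h2, h3, mul_add]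
  map_smul' c f := by
    refine fourier_injective ?_
    simp only [RingHom.id_apply]
    rw [FourierTransform.fourier_smul]
    filter_upwards [fourier_freeSchrodinger t (c • f), fourier_freeSchrodinger t f,
      Lp.coeFn_smul c (𝓕 (freeSchrodinger t f)),
      Lp.coeFn_smul c (𝓕 f : L2)] with ξ h1 h2 h4 h5
    rw [h1, h4, FourierTransform.fourier_smul, h5]; simp [h2]; ring
  norm_map' f := by
    change ‖freeSchrodinger t f‖ = ‖f‖
    rw [← Lp.norm_fourier_eq, ← Lp.norm_fourier_eq f]
    refine norm_eq_of_ae_norm_eq ?_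
    filter_upwards [fourier_freeSchrodinger t f] with ξ h
    rw [h, norm_mul, norm_schrodingerSymbol, one_mul]

theorem schU_apply (t : ℝ) (f : L2) : schU t f = freeSchrodinger t f := rfl

theorem fourier_schU (t : ℝ) (f : L2) :
    (𝓕 (schU t f) : L2) =ᵐ[volume] fun ξ => schrodingerSymbol t ξ * (𝓕 f : L2) ξ :=
  fourier_freeSchrodinger t f

theorem schU_add (s t : ℝ) (f : L2) : schU (s + t) f = schU s (schU t f) := by
  refine fourier_injective ?_
  filter_upwards [fourier_schU (s + t) f, fourier_schU t f, fourier_schU s (schU t f)] with ξ h1 h2 h3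
  rw [h1, h3, h2, schrodingerSymbol_add, mul_assoc]

theorem schU_zero (f : L2) : schU 0 f = f := by
  refine fourier_injective ?_
  filter_upwards [fourier_schU 0 f] with ξ h
  rw [h, schrodingerSymbol_zero, one_mul]

theorem IsPartial.schU {i : Fin 3} {f g : L2} (t : ℝ) (h : IsPartial i f g) :
    IsPartial i (schU t f) (schU t g) :=
  h.of_multiplier (fourier_schU t f) (fourier_schU t g)

theorem tendsto_of_fourier {ι : Type*} {l : Filter ι} {u : ι → L2} {u₀ : L2}
    (h : Tendsto (fun n => (𝓕 (u n) : L2)) l (𝓝 (𝓕 u₀))) : Tendsto u l (𝓝 u₀) := by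
  have h2 := ((Lp.fourierTransformₗᵢ R3 ℂ).symm.continuous.tendsto _).comp h
  have h3 : ∀ f : L2, (Lp.fourierTransformₗᵢ R3 ℂ).symm (𝓕 f : L2) = f :=
    fun f => (Lp.fourierTransformₗᵢ R3 ℂ).symm_apply_apply f
  simpa only [Function.comp_def, h3] using h2

theorem continuous_schrodingerSymbol (ξ : R3) : Continuous fun t => schrodingerSymbol t ξ := by
  unfold schrodingerSymbol; fun_prop

theorem continuous_schU (f : L2) : Continuous fun t => schU t f := by
  rw [continuous_iff_continuousAt]
  intro t
  refine tendsto_of_fourier ?_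
  refine tendsto_L2_of_dominated (F := (𝓕 f : L2)) (a := fun s => schrodingerSymbol s)
    (a₀ := schrodingerSymbol t) (b := fun _ => 2) (Eventually.of_forall fun s => fourier_schU s f)
    (fourier_schU t f) (Eventually.of_forall fun s => Eventually.of_forall fun ξ => ?_)
    (mul_sq_integrable (fun _ => rfl) _) (Eventually.of_forall fun ξ => ?_)
  · refine (norm_sub_le _ _).trans ?_
    rw [norm_schrodingerSymbol, norm_schrodingerSymbol]; norm_num
  · exact (continuous_schrodingerSymbol ξ).tendsto t

/-- The free Schrödinger group on `H¹`. -/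
def schH (t : ℝ) : H1 →ₗᵢ[ℂ] H1 := H1.lift (schU t) (fun _ _ _ h => h.schU t)

@[simp] theorem schH_fn (t : ℝ) (u : H1) : (schH t u).fn = schU t u.fn := rfl

theorem schH_add (s t : ℝ) (u : H1) : schH (s + t) u = schH s (schH t u) :=
  H1.ext (schU_add s t u.fn)

theorem schH_zero (u : H1) : schH 0 u = u := H1.ext (schU_zero u.fn)

theorem continuous_schH (u : H1) : Continuous fun t => schH t u := by
  rw [continuous_iff_continuousAt]
  intro t
  exact H1.tendsto_iff ((continuous_schU u.fn).tendsto t)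
    fun i => (continuous_schU (u.partialDeriv i)).tendsto t

/-! ### Derivatives of one-parameter groups of multipliers -/

theorem norm_exp_I_sub_one_le (s : ℝ) : ‖Complex.exp (s * Complex.I) - 1‖ ≤ |s| := by
  have := Real.norm_exp_I_mul_ofReal_sub_one_le (x := s)
  rw [mul_comm]; simpa using this

theorem hasDerivAt_exp_I (σ : ℝ) :
    HasDerivAt (fun t : ℝ => Complex.exp ((t * σ : ℝ) * Complex.I)) (σ * Complex.I) 0 := by
  have h : HasDerivAt (fun t : ℝ => ((t * σ : ℝ) : ℂ) * Complex.I) (σ * Complex.I) 0 := by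
    have := (((hasDerivAt_id (0 : ℝ)).mul_const σ).ofReal_comp).mul_const Complex.I
    simpa using this
  simpa using h.cexp

/-- The difference quotients of `t ↦ exp(itσ) f`. -/
theorem fourier_slope {σ : R3 → ℝ} {T : ℝ → L2} {f : L2}
    (hT : ∀ t, (𝓕 (T t) : L2) =ᵐ[volume]
      fun ξ => Complex.exp ((t * σ ξ : ℝ) * Complex.I) * (𝓕 f : L2) ξ) (t : ℝ) :
    (𝓕 (slope T 0 t) : L2) =ᵐ[volume]
      fun ξ => (((t⁻¹ : ℝ) : ℂ) * (Complex.exp ((t * σ ξ : ℝ) * Complex.I) - 1)) * (𝓕 f : L2) ξ := by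
  have hT0 : T 0 = f := fourier_injective (by
    filter_upwards [hT 0] with ξ h; rw [h]; simp)
  have : slope T 0 t = ((t⁻¹ : ℝ) : ℂ) • (T t - f) := by
    rw [slope_def_module, hT0, sub_zero]; exact (Complex.coe_smul _ _).symm
  rw [this]
  rw [FourierTransform.fourier_smul, sub_eq_add_neg, FourierTransform.fourier_add,
    FourierTransform.fourier_neg, ← sub_eq_add_neg]
  filter_upwards [hT t, Lp.coeFn_smul ((t⁻¹ : ℝ) : ℂ) (𝓕 (T t) - 𝓕 f : L2),
    Lp.coeFn_sub (𝓕 (T t) : L2) (𝓕 f)] with ξ h1 h2 h3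
  rw [h2]; simp only [Pi.smul_apply, h3, Pi.sub_apply, h1, smul_eq_mul]; ring

theorem tendsto_exp_slope (σ : ℝ) :
    Tendsto (fun t : ℝ => ((t⁻¹ : ℝ) : ℂ) * (Complex.exp ((t * σ : ℝ) * Complex.I) - 1)) (𝓝[≠] 0)
      (𝓝 (σ * Complex.I)) := by
  refine (hasDerivAt_exp_I σ).tendsto_slope.congr fun t => ?_
  rw [slope_def_module]; simp

/-- This is `|exp(is) - 1| ≤ |s|`; at `t = 0` the convention `0⁻¹ = 0` makes the left side vanish.
Being uniform in `t`, it supplies the majorants for the difference quotients of the translations and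
of the Schrödinger group. -/
theorem norm_exp_slope_le (σ t : ℝ) :
    ‖((t⁻¹ : ℝ) : ℂ) * (Complex.exp ((t * σ : ℝ) * Complex.I) - 1)‖ ≤ |σ| := by
  rw [norm_mul]
  refine (mul_le_mul_of_nonneg_left (norm_exp_I_sub_one_le _) (norm_nonneg _)).trans ?_
  rw [Complex.norm_real, Real.norm_eq_abs, abs_mul, ← mul_assoc, ← abs_mul]
  rcases eq_or_ne t 0 with rfl | h
  · simp
  · rw [inv_mul_cancel₀ h]; simp

/-- If `g = iσf`, then `t ↦ exp(itσ) f` is differentiable in `L²` at zero, with derivative `g`. -/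
theorem hasDerivAt_of_multiplier {σ : R3 → ℝ} {T : ℝ → L2} {f g : L2}
    (hT : ∀ t, (𝓕 (T t) : L2) =ᵐ[volume]
      fun ξ => Complex.exp ((t * σ ξ : ℝ) * Complex.I) * (𝓕 f : L2) ξ)
    (hg : (𝓕 g : L2) =ᵐ[volume] fun ξ => (σ ξ * Complex.I) * (𝓕 f : L2) ξ) :
    HasDerivAt T g 0 := by
  rw [hasDerivAt_iff_tendsto_slope]
  refine tendsto_of_fourier ?_
  refine tendsto_L2_of_dominated (F := (𝓕 f : L2)) (b := fun ξ => 2 * |σ ξ|)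
    (Eventually.of_forall (fourier_slope hT)) hg
    (Eventually.of_forall fun t => Eventually.of_forall fun ξ => ?_) ?_
    (Eventually.of_forall fun ξ => tendsto_exp_slope (σ ξ))
  · refine (norm_sub_le _ _).trans ?_
    rw [two_mul]
    exact add_le_add (norm_exp_slope_le _ _) (by simp)
  -- The square of the majorant `2|σ||𝓕 f|` is `4|𝓕 g|²`, integrable because `g` is in `L²`.
  · refine ((integrable_norm_sq (𝓕 g : L2)).const_mul 4).congr ?_
    filter_upwards [hg] with ξ h
    rw [h]; simp only [norm_mul, Complex.norm_real, Complex.norm_I, Real.norm_eq_abs]; ring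

/-- Converse of `hasDerivAt_of_multiplier`. -/
theorem multiplier_of_hasDerivAt {σ : R3 → ℝ} {T : ℝ → L2} {f g : L2}
    (hT : ∀ t, (𝓕 (T t) : L2) =ᵐ[volume]
      fun ξ => Complex.exp ((t * σ ξ : ℝ) * Complex.I) * (𝓕 f : L2) ξ)
    (h : HasDerivAt T g 0) :
    (𝓕 g : L2) =ᵐ[volume] fun ξ => (σ ξ * Complex.I) * (𝓕 f : L2) ξ := by
  -- Convergence of the difference quotients in `L²` gives convergence almost everywhere along a
  -- subsequence, and there the pointwise limit is known.
  obtain ⟨s, hs⟩ := exists_seq_tendsto (𝓝[≠] (0 : ℝ))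
  have h1 : Tendsto (fun n => (𝓕 (slope T 0 (s n)) : L2)) atTop (𝓝 (𝓕 g)) :=
    ((Lp.fourierTransformₗᵢ R3 ℂ).continuous.tendsto _).comp (h.tendsto_slope.comp hs)
  have h2 := tendstoInMeasure_of_tendsto_Lp h1
  obtain ⟨ns, hns, hae⟩ := h2.exists_seq_tendsto_ae
  have h3 : ∀ᵐ ξ, ∀ n, (𝓕 (slope T 0 (s (ns n))) : L2) ξ =
      (((((s (ns n))⁻¹ : ℝ) : ℂ)) * (Complex.exp (((s (ns n)) * σ ξ : ℝ) * Complex.I) - 1))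
        * (𝓕 f : L2) ξ :=
    ae_all_iff.2 fun n => fourier_slope hT _
  filter_upwards [hae, h3] with ξ h4 h5
  refine tendsto_nhds_unique h4 ?_
  have h6 := ((tendsto_exp_slope (σ ξ)).comp (hs.comp hns.tendsto_atTop)).mul_const ((𝓕 f : L2) ξ)
  refine h6.congr fun n => ?_
  rw [h5 n]; rfl

/-! ### Translations -/

/-- Translation `f ↦ f(· + a)` on `L²`. -/
def shift (a : R3) : L2 →ₗᵢ[ℂ] L2 :=
  Lp.compMeasurePreservingₗᵢ ℂ (fun x => x + a) (measurePreserving_add_right volume a)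

theorem shift_coe (a : R3) (f : L2) : shift a f =ᵐ[volume] fun x => f (x + a) :=
  Lp.coeFn_compMeasurePreserving f (measurePreserving_add_right volume a)

/-- Both sides are continuous in `f ∈ L²`, so it suffices to take `f` in the dense Schwartz space,
where the formula is the classical one. -/
theorem fourier_shift (a : R3) (f : L2) : (𝓕 (shift a f) : L2) =ᵐ[volume]
    fun ξ => Complex.exp ((2 * Real.pi * inner ℝ a ξ : ℝ) * Complex.I) * (𝓕 f : L2) ξ := by
  have hb : IsBddBy (fun ξ : R3 => Complex.exp ((2 * Real.pi * inner ℝ a ξ : ℝ) * Complex.I)) 1 :=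
    ⟨Continuous.aestronglyMeasurable (by fun_prop), Eventually.of_forall fun ξ => by
      rw [Complex.norm_exp_ofReal_mul_I]⟩
  suffices h : (𝓕 (shift a f) : L2) =
      mulL2 (fun ξ : R3 => Complex.exp ((2 * Real.pi * inner ℝ a ξ : ℝ) * Complex.I)) (𝓕 f : L2) by
    rw [h]; exact hb.mulL2_coe _
  apply DenseRange.induction_on (p := fun f : L2 => (𝓕 (shift a f) : L2) =
      mulL2 (fun ξ : R3 => Complex.exp ((2 * Real.pi * inner ℝ a ξ : ℝ) * Complex.I)) (𝓕 f : L2))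
    (SchwartzMap.denseRange_toLpCLM (F := ℂ) (E := R3) (p := 2) (μ := volume) ENNReal.ofNat_ne_top) f
  · refine isClosed_eq ?_ ?_
    · exact (Lp.fourierTransformₗᵢ R3 ℂ).continuous.comp (shift a).continuous
    · have h1 : LipschitzWith 1 (mulL2 (fun ξ : R3 => Complex.exp ((2 * Real.pi * inner ℝ a ξ : ℝ) * Complex.I))) := by
        refine LipschitzWith.of_dist_le_mul fun f g => ?_
        rw [dist_eq_norm, dist_eq_norm, ← hb.mulL2_sub]
        exact_mod_cast hb.norm_mulL2_le _
      exact h1.continuous.comp (Lp.fourierTransformₗᵢ R3 ℂ).continuous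
  · intro φ
    have h1 : shift a (φ.toLp 2) = (SchwartzMap.compSubConstCLM ℂ (-a) φ).toLp 2 := by
      refine Lp.ext ?_
      have h2 := (measurePreserving_add_right volume a).quasiMeasurePreserving.ae (φ.coeFn_toLp 2 volume)
      filter_upwards [shift_coe a (φ.toLp 2), (SchwartzMap.compSubConstCLM ℂ (-a) φ).coeFn_toLp 2 volume, h2]
        with x h3 h4 h5
      rw [h3, h4, h5]; simp
    simp only [SchwartzMap.toLpCLM_apply]
    rw [h1, SchwartzMap.toLp_fourier_eq, SchwartzMap.toLp_fourier_eq]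
    refine Lp.ext ?_
    filter_upwards [hb.mulL2_coe ((𝓕 φ).toLp 2), (𝓕 φ).coeFn_toLp 2 volume,
      (𝓕 (SchwartzMap.compSubConstCLM ℂ (-a) φ)).coeFn_toLp 2 volume] with ξ h3 h4 h5
    rw [h3, h4, h5, SchwartzMap.fourier_coe, SchwartzMap.fourier_coe]
    have h6 : (⇑(SchwartzMap.compSubConstCLM ℂ (-a) φ) : R3 → ℂ) = ⇑φ ∘ fun x => x + a := by
      ext x; simp
    rw [h6]
    have h7 := congrFun (VectorFourier.fourierIntegral_comp_add_right Real.fourierChar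
      (volume : Measure R3) (innerₗ R3) (⇑φ) a) ξ
    refine Eq.trans h7 ?_
    rw [Circle.smul_def, Real.fourierChar_apply]
    rfl

/-- Translations along a basis vector form the multiplier group with `σ = 2πξᵢ`, so weak derivatives
are exactly the `L²` limits of difference quotients. The product rule and the differentiation of
convolutions use this form, which asks for no test functions. -/
theorem isPartial_iff_hasDerivAt {i : Fin 3} {f g : L2} :
    IsPartial i f g ↔ HasDerivAt (fun h : ℝ => shift (h • basisVec i) f) g 0 := by
  have hT : ∀ t : ℝ, (𝓕 (shift (t • basisVec i) f) : L2) =ᵐ[volume]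
      fun ξ => Complex.exp ((t * (2 * Real.pi * ξ i) : ℝ) * Complex.I) * (𝓕 f : L2) ξ := by
    intro t
    filter_upwards [fourier_shift (t • basisVec i) f] with ξ h
    rw [h, real_inner_smul_left, real_inner_comm, inner_basisVec]
    congr 4; ring
  have hs : ∀ ξ : R3, partialSymbol i ξ = ((2 * Real.pi * ξ i : ℝ) : ℂ) * Complex.I := by
    intro ξ; unfold partialSymbol; push_cast; ring
  rw [isPartial_iff]
  simp only [hs]
  exact ⟨fun h => hasDerivAt_of_multiplier hT h, fun h => multiplier_of_hasDerivAt hT h⟩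

theorem IsPartial.shift {i : Fin 3} {f g : L2} (a : R3) (h : IsPartial i f g) :
    IsPartial i (shift a f) (shift a g) :=
  h.of_multiplier (fourier_shift a f) (fourier_shift a g)

theorem continuous_shift (f : L2) : Continuous fun a => shift a f := by
  rw [continuous_iff_continuousAt]
  intro a
  refine tendsto_of_fourier ?_
  refine tendsto_L2_of_dominated (F := (𝓕 f : L2)) (b := fun _ => 2)
    (Eventually.of_forall fun s => fourier_shift s f)
    (fourier_shift a f) (Eventually.of_forall fun s => Eventually.of_forall fun ξ => ?_)
    (mul_sq_integrable (fun _ => rfl) _) (Eventually.of_forall fun ξ => ?_)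
  · refine (norm_sub_le _ _).trans ?_
    rw [Complex.norm_exp_ofReal_mul_I, Complex.norm_exp_ofReal_mul_I]; norm_num
  · exact Continuous.tendsto (by fun_prop) a

/-- Translation on `H¹`. -/
def shiftH (a : R3) : H1 →ₗᵢ[ℂ] H1 := H1.lift (shift a) (fun _ _ _ h => h.shift a)

@[simp] theorem shiftH_fn (a : R3) (u : H1) : (shiftH a u).fn = shift a u.fn := rfl

theorem continuous_shiftH (u : H1) : Continuous fun a => shiftH a u := by
  rw [continuous_iff_continuousAt]
  intro t
  exact H1.tendsto_iff ((continuous_shift u.fn).tendsto t)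
    fun i => (continuous_shift (u.partialDeriv i)).tendsto t

/-- Partial derivatives are skew-adjoint. -/
theorem IsPartial.inner_eq {i : Fin 3} {f f' g g' : L2} (hf : IsPartial i f f')
    (hg : IsPartial i g g') : inner ℂ f g' = - inner ℂ f' g := by
  rw [isPartial_iff] at hf hg
  rw [← Lp.inner_fourier_eq, ← Lp.inner_fourier_eq f', L2_inner_eq, L2_inner_eq, ← integral_neg]
  refine integral_congr_ae ?_
  filter_upwards [hf, hg] with ξ h1 h2
  rw [h1, h2]; simp only [partialSymbol, map_mul, Complex.conj_I, Complex.conj_ofReal, map_ofNat]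
  ring

/-! ### Multiplication by real functions and the product rule -/

/-- Multiplication by a real function. -/
def mulR (a : R3 → ℝ) (f : L2) : L2 := mulL2 (fun x => (a x : ℂ)) f

theorem isBddBy_ofReal {a : R3 → ℝ} {C : ℝ} (hm : AEStronglyMeasurable a volume)
    (hb : ∀ x, |a x| ≤ C) : IsBddBy (fun x => (a x : ℂ)) C :=
  ⟨Complex.continuous_ofReal.comp_aestronglyMeasurable hm,
    Eventually.of_forall fun x => by rw [Complex.norm_real]; exact hb x⟩

/-- `a` is bounded by `C`, and so is its partial derivative `a'` in the `i`-th direction. -/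
structure HasBddPartial (i : Fin 3) (a a' : R3 → ℝ) (C : ℝ) : Prop where
  meas : AEStronglyMeasurable a volume
  meas' : AEStronglyMeasurable a' volume
  bound : ∀ x, |a x| ≤ C
  bound' : ∀ x, |a' x| ≤ C
  deriv : ∀ x, HasDerivAt (fun h : ℝ => a (x + h • basisVec i)) (a' x) 0

section HasBddPartial
variable {i : Fin 3} {a a' b b' : R3 → ℝ} {A B C : ℝ}

theorem HasBddPartial.isBddBy (h : HasBddPartial i a a' C) : IsBddBy (fun x => (a x : ℂ)) C :=
  isBddBy_ofReal h.meas h.bound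

theorem HasBddPartial.isBddBy' (h : HasBddPartial i a a' C) : IsBddBy (fun x => (a' x : ℂ)) C :=
  isBddBy_ofReal h.meas' h.bound'

theorem HasBddPartial.nonneg (h : HasBddPartial i a a' C) : 0 ≤ C :=
  (abs_nonneg _).trans (h.bound 0)

theorem HasBddPartial.add (ha : HasBddPartial i a a' A) (hb : HasBddPartial i b b' B) :
    HasBddPartial i (fun x => a x + b x) (fun x => a' x + b' x) (A + B) where
  meas := ha.meas.add hb.meas
  meas' := ha.meas'.add hb.meas'
  bound x := (abs_add_le _ _).trans (add_le_add (ha.bound x) (hb.bound x))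
  bound' x := (abs_add_le _ _).trans (add_le_add (ha.bound' x) (hb.bound' x))
  deriv x := (ha.deriv x).add (hb.deriv x)

theorem HasBddPartial.abs_sub_le (h : HasBddPartial i a a' C) (x : R3) (s : ℝ) :
    |a (x + s • basisVec i) - a x| ≤ C * |s| := by
  have hd : ∀ r : ℝ, HasDerivAt (fun r : ℝ => a (x + r • basisVec i)) (a' (x + r • basisVec i)) r := by
    intro r
    have h1 := h.deriv (x + r • basisVec i)
    rw [← sub_self r] at h1
    refine (h1.comp_sub_const r r).congr_of_eventuallyEq (Eventually.of_forall fun s => ?_)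
    dsimp only
    congr 1; module
  have := Convex.norm_image_sub_le_of_norm_hasDerivWithin_le (C := C) (s := Set.univ) (x := 0) (y := s)
    (fun r _ => (hd r).hasDerivWithinAt) (fun r _ => h.bound' _) convex_univ trivial trivial
  simpa using this

theorem shift_mulR (h : HasBddPartial i a a' C) (v : R3) (f : L2) :
    shift v (mulR a f) = mulR (fun x => a (x + v)) (shift v f) := by
  have hq := (measurePreserving_add_right (volume : Measure R3) v).quasiMeasurePreserving
  have hb : IsBddBy (fun x => ((a (x + v) : ℝ) : ℂ)) C :=
    isBddBy_ofReal (h.meas.comp_quasiMeasurePreserving hq) fun x => h.bound _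
  refine Lp.ext ?_
  filter_upwards [shift_coe v (mulR a f), hb.mulL2_coe (shift v f), shift_coe v f,
    hq.ae (h.isBddBy.mulL2_coe f)] with x h1 h2 h3 h4
  rw [h1, mulR, mulR, h2, h3, h4]

/-- The product rule. -/
theorem HasBddPartial.isPartial (h : HasBddPartial i a a' C) {f g : L2} (hf : IsPartial i f g) :
    IsPartial i (mulR a f) (mulR a' f + mulR a g) := by
  rw [isPartial_iff_hasDerivAt] at *
  have hC := h.nonneg
  have h0 : ∀ f, shift ((0 : ℝ) • basisVec i) f = f := by
    intro f
    refine Lp.ext ?_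
    filter_upwards [shift_coe ((0 : ℝ) • basisVec i) f] with x hx
    rw [hx]; simp
  rw [hasDerivAt_iff_tendsto_slope] at *
  set sl := slope (fun h : ℝ => shift (h • basisVec i) f) 0 with hsl
  have hbs : ∀ s : ℝ, IsBddBy (fun x => ((a (x + s • basisVec i) : ℝ) : ℂ)) C := fun s =>
    isBddBy_ofReal (h.meas.comp_quasiMeasurePreserving
      (measurePreserving_add_right (volume : Measure R3) _).quasiMeasurePreserving) fun x => h.bound _
  have hbq : ∀ s : ℝ, IsBddBy (fun x => ((s⁻¹ * (a (x + s • basisVec i) - a x) : ℝ) : ℂ)) C := by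
    intro s
    refine isBddBy_ofReal ?_ fun x => ?_
    · exact ((h.meas.comp_quasiMeasurePreserving
      (measurePreserving_add_right (volume : Measure R3) _).quasiMeasurePreserving).sub h.meas).const_mul _
    · rw [abs_mul, abs_inv]
      have h1 := h.abs_sub_le x s
      rcases eq_or_ne s 0 with rfl | hs
      · simp [hC]
      · rw [inv_mul_le_iff₀ (abs_pos.2 hs)]; linarith
  -- The discrete Leibniz rule: the quotient of `a` times `f`, plus the translate of `a` times the
  -- quotient of `f`.
  have key : ∀ s : ℝ, slope (fun h : ℝ => shift (h • basisVec i) (mulR a f)) 0 s =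
      mulR (fun x => s⁻¹ * (a (x + s • basisVec i) - a x)) f +
        mulR (fun x => a (x + s • basisVec i)) (sl s) := by
    intro s
    have e1 : sl s = ((s⁻¹ : ℝ) : ℂ) • (shift (s • basisVec i) f - f) := by
      rw [hsl, slope_def_module, h0, sub_zero]; exact (Complex.coe_smul _ _).symm
    have e2 : slope (fun h : ℝ => shift (h • basisVec i) (mulR a f)) 0 s =
        ((s⁻¹ : ℝ) : ℂ) • (shift (s • basisVec i) (mulR a f) - mulR a f) := by
      rw [slope_def_module, h0, sub_zero]; exact (Complex.coe_smul _ _).symm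
    rw [e1, e2, shift_mulR h]
    refine Lp.ext ?_
    filter_upwards [Lp.coeFn_smul ((s⁻¹ : ℝ) : ℂ) (mulR (fun x => a (x + s • basisVec i))
        (shift (s • basisVec i) f) - mulR a f),
      Lp.coeFn_sub (mulR (fun x => a (x + s • basisVec i)) (shift (s • basisVec i) f)) (mulR a f),
      (hbs s).mulL2_coe (shift (s • basisVec i) f), h.isBddBy.mulL2_coe f,
      Lp.coeFn_add (mulR (fun x => s⁻¹ * (a (x + s • basisVec i) - a x)) f)
        (mulR (fun x => a (x + s • basisVec i)) (((s⁻¹ : ℝ) : ℂ) • (shift (s • basisVec i) f - f))),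
      (hbq s).mulL2_coe f, (hbs s).mulL2_coe (((s⁻¹ : ℝ) : ℂ) • (shift (s • basisVec i) f - f)),
      Lp.coeFn_smul ((s⁻¹ : ℝ) : ℂ) (shift (s • basisVec i) f - f),
      Lp.coeFn_sub (shift (s • basisVec i) f) f] with x e1 e2 e3 e4 e5 e6 e7 e8 e9
    rw [e1, e5]
    rw [Pi.smul_apply, Pi.add_apply, e2, Pi.sub_apply]
    simp only [mulR] at *
    rw [e3, e4, e6, e7, e8, Pi.smul_apply, e9]
    simp only [Pi.sub_apply, smul_eq_mul]
    push_cast; ring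
  simp only [funext key]
  refine Tendsto.add ?_ ?_
  -- By the mean value inequality the quotients of `a` are bounded by `C`, and they converge
  -- pointwise to `a'`.
  · refine tendsto_L2_of_dominated (F := f) (b := fun _ => 2 * C)
      (Eventually.of_forall fun s => (hbq s).mulL2_coe f) (h.isBddBy'.mulL2_coe f)
      (Eventually.of_forall fun s => ?_)
      (mul_sq_integrable (fun _ => rfl) _) (Eventually.of_forall fun x => ?_)
    · filter_upwards [(hbq s).bound, h.isBddBy'.bound] with x h1 h2
      refine (norm_sub_le _ _).trans ?_
      linarith
    · have := (h.deriv x).tendsto_slope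
      refine (((Complex.continuous_ofReal.tendsto _).comp this)).congr fun s => ?_
      simp [slope_def_field, div_eq_inv_mul]
  -- The quotients of `f` converge in `L²` and are multiplied by functions bounded by `C`, so they
  -- may be replaced by their limit `g`; then dominated convergence applies with `g` fixed.
  · have t1 : Tendsto (fun s : ℝ => mulR (fun x => a (x + s • basisVec i)) (sl s - g)) (𝓝[≠] 0) (𝓝 0) := by
      refine squeeze_zero_norm (fun s => (hbs s).norm_mulL2_le _) ?_
      have := (tendsto_iff_norm_sub_tendsto_zero.1 hf).const_mul C
      simpa using this
    have t2 : Tendsto (fun s : ℝ => mulR (fun x => a (x + s • basisVec i)) g) (𝓝[≠] 0) (𝓝 (mulR a g)) := by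
      refine tendsto_L2_of_dominated (F := g) (b := fun _ => 2 * C)
        (Eventually.of_forall fun s => (hbs s).mulL2_coe g) (h.isBddBy.mulL2_coe g)
        (Eventually.of_forall fun s => ?_)
        (mul_sq_integrable (fun _ => rfl) _) (Eventually.of_forall fun x => ?_)
      · filter_upwards [(hbs s).bound, h.isBddBy.bound] with x h1 h2
        refine (norm_sub_le _ _).trans ?_
        linarith
      · have := (h.deriv x).continuousAt.tendsto
        simp only [zero_smul, add_zero] at this
        exact (Complex.continuous_ofReal.tendsto _).comp (this.mono_left nhdsWithin_le_nhds)
    have t3 := t1.add t2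
    rw [zero_add] at t3
    refine t3.congr fun s => ?_
    rw [mulR, mulR, ← (hbs s).mulL2_add, sub_add_cancel]; rfl

end HasBddPartial

/-- Bounded functions with bounded partial derivatives. -/
def IsC1b (a : R3 → ℝ) (a' : Fin 3 → R3 → ℝ) (C : ℝ) : Prop := ∀ i, HasBddPartial i a (a' i) C

section IsC1b
variable {a b : R3 → ℝ} {a' b' : Fin 3 → R3 → ℝ} {A B C : ℝ}

theorem IsC1b.add (ha : IsC1b a a' A) (hb : IsC1b b b' B) :
    IsC1b (fun x => a x + b x) (fun i x => a' i x + b' i x) (A + B) := fun i => (ha i).add (hb i)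

/-- Multiplication on `H¹`. -/
def IsC1b.mulH (h : IsC1b a a' C) (u : H1) : H1 :=
  H1.mk (mulR a u.fn) (fun i => mulR (a' i) u.fn + mulR a (u.partialDeriv i))
    (fun i => (h i).isPartial (u.isPartial i))

@[simp] theorem IsC1b.mulH_fn (h : IsC1b a a' C) (u : H1) : (h.mulH u).fn = mulR a u.fn := rfl
@[simp] theorem IsC1b.mulH_partialDeriv (h : IsC1b a a' C) (u : H1) (i) :
    (h.mulH u).partialDeriv i = mulR (a' i) u.fn + mulR a (u.partialDeriv i) := rfl

/-- One factor 2 comes from the two terms of the product rule, the other from the four components of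
the norm. -/
theorem IsC1b.norm_mulH_le (h : IsC1b a a' C) (u : H1) : ‖h.mulH u‖ ≤ 4 * C * ‖u‖ := by
  have hC := (h 0).nonneg
  have : ‖h.mulH u‖ ≤ 2 * (2 * C * ‖u‖) := by
    refine H1.norm_le_of_bound _ ?_ fun i => ?_
    · rw [IsC1b.mulH_fn]
      refine ((h 0).isBddBy.norm_mulL2_le _).trans ?_
      have := mul_le_mul_of_nonneg_left u.norm_fn_le hC
      nlinarith [mul_nonneg hC (norm_nonneg u)]
    · rw [IsC1b.mulH_partialDeriv]
      refine (norm_add_le _ _).trans ?_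
      have h1 := (h i).isBddBy'.norm_mulL2_le u.fn
      have h2 := (h i).isBddBy.norm_mulL2_le (u.partialDeriv i)
      have h3 := mul_le_mul_of_nonneg_left u.norm_fn_le hC
      have h4 := mul_le_mul_of_nonneg_left (u.norm_partialDeriv_le i) hC
      simp only [mulR]
      linarith
  linarith

theorem IsC1b.mulH_sub (h : IsC1b a a' C) (u w : H1) : h.mulH (u - w) = h.mulH u - h.mulH w :=
  H1.ext ((h 0).isBddBy.mulL2_sub u.fn w.fn)

theorem IsC1b.mulH_add (h : IsC1b a a' C) (u w : H1) : h.mulH (u + w) = h.mulH u + h.mulH w :=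
  H1.ext ((h 0).isBddBy.mulL2_add u.fn w.fn)

theorem IsC1b.mulH_eq_add {c : R3 → ℝ} {c' : Fin 3 → R3 → ℝ} (ha : IsC1b a a' A) (hb : IsC1b b b' B)
    (hc : IsC1b c c' C) (h : ∀ x, c x = a x + b x) (u : H1) : hc.mulH u = ha.mulH u + hb.mulH u := by
  refine H1.ext ?_
  rw [IsC1b.mulH_fn, mulR, mulL2_congr (b := fun x => ((a x : ℂ) + (b x : ℂ)))
    (fun x => by rw [h]; push_cast; rfl), (ha 0).isBddBy.add_mulL2 (hb 0).isBddBy]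
  rfl

end IsC1b

/-! ### Hardy's inequality -/

theorem norm_add_smul_basisVec_sq (y : R3) (i : Fin 3) (h : ℝ) :
    ‖y + h • basisVec i‖ ^ 2 = ‖y‖ ^ 2 + 2 * h * y i + h ^ 2 := by
  rw [norm_add_sq_real, real_inner_smul_right, inner_basisVec, norm_smul]
  simp [basisVec]; ring

theorem abs_apply_le_norm (y : R3) (i : Fin 3) : |y i| ≤ ‖y‖ := by
  simpa using PiLp.norm_apply_le y i

/-- The regularized field `(y - x)/(|y - x|² + ε)` has bounded derivatives. -/
theorem hasBddPartial_hardy (x : R3) {ε : ℝ} (hε : 0 < ε) (i : Fin 3) :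
    HasBddPartial i (fun y => (y - x) i / (‖y - x‖ ^ 2 + ε))
      (fun y => 1 / (‖y - x‖ ^ 2 + ε) - 2 * (y - x) i ^ 2 / (‖y - x‖ ^ 2 + ε) ^ 2)
      (1 / ε * 3 + 1) := by
  have hpos : ∀ y : R3, 0 < ‖y - x‖ ^ 2 + ε := fun y => by positivity
  have hci : Continuous fun y : R3 => (y - x) i := by fun_prop
  refine ⟨?_, ?_, fun y => ?_, fun y => ?_, fun y => ?_⟩
  · exact (hci.div (by fun_prop) fun y => (hpos y).ne').aestronglyMeasurable
  · refine Continuous.aestronglyMeasurable ?_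
    refine (continuous_const.div (by fun_prop) fun y => (hpos y).ne').sub ?_
    exact ((hci.pow 2).const_mul 2 |>.div (by fun_prop) fun y => (pow_pos (hpos y) 2).ne')
  · rw [abs_div, abs_of_pos (hpos y), div_le_iff₀ (hpos y)]
    have h1 := abs_apply_le_norm (y - x) i
    have h2 : (1 / ε * 3 + 1) * (‖y - x‖ ^ 2 + ε) = 1 / ε * 3 * ‖y - x‖ ^ 2 + 3 + ‖y - x‖ ^ 2 + ε := by
      field_simp; ring
    rw [h2]
    have h3 : 0 ≤ 1 / ε * 3 * ‖y - x‖ ^ 2 := by positivity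
    nlinarith [sq_nonneg (‖y - x‖ - 1)]
  · have h1 : |1 / (‖y - x‖ ^ 2 + ε)| ≤ 1 / ε := by
      rw [abs_of_pos (by positivity)]
      exact one_div_le_one_div_of_le hε (by nlinarith [sq_nonneg ‖y - x‖])
    have h2 : |2 * (y - x) i ^ 2 / (‖y - x‖ ^ 2 + ε) ^ 2| ≤ 2 * (1 / ε) := by
      rw [abs_of_nonneg (by positivity), div_le_iff₀ (pow_pos (hpos y) 2)]
      have h4 : (y - x) i ^ 2 ≤ ‖y - x‖ ^ 2 := sq_le_sq.2 (by
        rw [abs_of_nonneg (norm_nonneg (y - x))]; exact abs_apply_le_norm (y - x) i)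
      have h5 : 2 * (1 / ε) * (‖y - x‖ ^ 2 + ε) ^ 2 =
          2 * (1 / ε) * ‖y - x‖ ^ 4 + 4 * ‖y - x‖ ^ 2 + 2 * ε := by field_simp; ring
      rw [h5]
      have h6 : 0 ≤ 2 * (1 / ε) * ‖y - x‖ ^ 4 := by positivity
      nlinarith [sq_nonneg ‖y - x‖]
    have := abs_sub (1 / (‖y - x‖ ^ 2 + ε)) (2 * (y - x) i ^ 2 / (‖y - x‖ ^ 2 + ε) ^ 2)
    linarith
  · have e1 : ∀ h : ℝ, y + h • basisVec i - x = (y - x) + h • basisVec i := fun h => by module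
    simp only [e1, norm_add_smul_basisVec_sq]
    have e2 : ∀ h : ℝ, ((y - x) + h • basisVec i) i = (y - x) i + h := fun h => by
      simp [basisVec]
    simp only [e2]
    have d1 : HasDerivAt (fun h : ℝ => (y - x) i + h) 1 0 := (hasDerivAt_id _).const_add _
    have d2 : HasDerivAt (fun h : ℝ => ‖y - x‖ ^ 2 + 2 * h * (y - x) i + h ^ 2 + ε) (2 * (y - x) i) 0 := by
      have := (((((hasDerivAt_id (0 : ℝ)).const_mul 2).mul_const ((y - x) i)).const_add (‖y - x‖ ^ 2)).add
        ((hasDerivAt_id (0 : ℝ)).pow 2)).add_const ε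
      refine HasDerivAt.congr_deriv this ?_
      simp
    have hne : ‖y - x‖ ^ 2 + 2 * (0 : ℝ) * (y - x) i + 0 ^ 2 + ε ≠ 0 := by
      have := hpos y; simp; exact this.ne'
    refine (d1.div d2 hne).congr_deriv ?_
    have h0 := (hpos y).ne'
    simp only [mul_zero, zero_mul, add_zero, ne_eq, OfNat.ofNat_ne_zero, not_false_eq_true, zero_pow]
    field_simp

theorem norm_mulR_sq {a : R3 → ℝ} {C : ℝ} (h : IsBddBy (fun x => (a x : ℂ)) C) (f : L2) :
    ‖mulR a f‖ ^ 2 = ∫ x, a x ^ 2 * ‖f x‖ ^ 2 := by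
  rw [L2_norm_sq_eq]
  refine integral_congr_ae ?_
  filter_upwards [h.mulL2_coe f] with x hx
  simp only [mulR, hx, norm_mul, Complex.norm_real, Real.norm_eq_abs, mul_pow, sq_abs]

theorem inner_mulR {a : R3 → ℝ} {C : ℝ} (h : IsBddBy (fun x => (a x : ℂ)) C) (f g : L2) :
    inner ℂ f (mulR a g) = inner ℂ (mulR a f) g := by
  rw [L2_inner_eq, L2_inner_eq]
  refine integral_congr_ae ?_
  filter_upwards [h.mulL2_coe f, h.mulL2_coe g] with x h1 h2
  simp only [mulR, h1, h2, map_mul, Complex.conj_ofReal]; ring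

theorem inner_mulR_self {a : R3 → ℝ} {C : ℝ} (h : IsBddBy (fun x => (a x : ℂ)) C) (f : L2) :
    inner ℂ f (mulR a f) = ((∫ x, a x * ‖f x‖ ^ 2 : ℝ) : ℂ) := by
  rw [L2_inner_eq, ← integral_complex_ofReal]
  refine integral_congr_ae ?_
  filter_upwards [h.mulL2_coe f] with x h1
  simp only [mulR, h1]
  push_cast
  rw [← Complex.mul_conj']; ring

theorem integrable_bdd_mul_norm_sq {a : R3 → ℝ} {C : ℝ} (hm : AEStronglyMeasurable a volume)
    (hb : ∀ x, |a x| ≤ C) (f : L2) : Integrable (fun x => a x * ‖f x‖ ^ 2) :=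
  (integrable_norm_sq f).bdd_mul hm (Eventually.of_forall hb)

/-- Let `a = (y - x)/(|y - x|² + ε)` and `q = 1/(|y - x|² + ε)`. In three dimensions `div a = 3q -
2|y - x|²q² ≥ q`, while `aᵢ² ≤ q`. Integrating `div a` against `|u|²` by parts and applying
Cauchy–Schwarz in each of the three directions gives `S ≤ 6‖u‖√S`, hence `S ≤ 36‖u‖²`. The
regularization makes `a` bounded with bounded derivatives, as the product rule requires, and makes
`S` finite beforehand. -/
theorem hardy_regularized (x : R3) {ε : ℝ} (hε : 0 < ε) (u : H1) :
    ∫ y, 1 / (‖y - x‖ ^ 2 + ε) * ‖u.fn y‖ ^ 2 ≤ 36 * ‖u‖ ^ 2 := by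
  set S := ∫ y, 1 / (‖y - x‖ ^ 2 + ε) * ‖u.fn y‖ ^ 2 with hS
  have hpos : ∀ y : R3, 0 < ‖y - x‖ ^ 2 + ε := fun y => by positivity
  set a : Fin 3 → R3 → ℝ := fun i y => (y - x) i / (‖y - x‖ ^ 2 + ε)
  set a' : Fin 3 → R3 → ℝ := fun i y =>
    1 / (‖y - x‖ ^ 2 + ε) - 2 * (y - x) i ^ 2 / (‖y - x‖ ^ 2 + ε) ^ 2
  have ha := fun i => hasBddPartial_hardy x hε i
  have hqm : AEStronglyMeasurable (fun y : R3 => 1 / (‖y - x‖ ^ 2 + ε)) volume :=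
    (continuous_const.div (by fun_prop) fun y => (hpos y).ne').aestronglyMeasurable
  have hqb : ∀ y : R3, |1 / (‖y - x‖ ^ 2 + ε)| ≤ 1 / ε := fun y => by
    rw [abs_of_pos (by have := hpos y; positivity)]
    exact one_div_le_one_div_of_le hε (by nlinarith [sq_nonneg ‖y - x‖])
  have hint := integrable_bdd_mul_norm_sq hqm hqb u.fn
  have hS0 : 0 ≤ S := integral_nonneg fun y => by have := hpos y; positivity
  have h1 : ∀ i, (∫ y, a' i y * ‖u.fn y‖ ^ 2) =
      -2 * (inner ℂ (u.partialDeriv i) (mulR (a i) u.fn)).re := by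
    intro i
    have e1 := IsPartial.inner_eq (u.isPartial i) ((ha i).isPartial (u.isPartial i))
    rw [inner_add_right, inner_mulR_self (ha i).isBddBy', inner_mulR (ha i).isBddBy] at e1
    have e2 := congrArg Complex.re e1
    simp only [Complex.add_re, Complex.ofReal_re, Complex.neg_re] at e2
    have e3 : (inner ℂ (mulR (a i) u.fn) (u.partialDeriv i)).re =
        (inner ℂ (u.partialDeriv i) (mulR (a i) u.fn)).re :=
      inner_re_symm (𝕜 := ℂ) _ _
    rw [e3] at e2
    linarith
  have h2 : ∀ i, ‖mulR (a i) u.fn‖ ≤ √S := by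
    intro i
    refine Real.le_sqrt_of_sq_le ?_
    rw [norm_mulR_sq (ha i).isBddBy]
    refine integral_mono_of_nonneg (Eventually.of_forall fun y => by positivity) hint
      (Eventually.of_forall fun y => ?_)
    refine mul_le_mul_of_nonneg_right ?_ (by positivity)
    simp only
    rw [div_pow, div_le_div_iff₀ (pow_pos (hpos y) 2) (hpos y)]
    have h4 : (y - x) i ^ 2 ≤ ‖y - x‖ ^ 2 := sq_le_sq.2 (by
        rw [abs_of_nonneg (norm_nonneg (y - x))]; exact abs_apply_le_norm (y - x) i)
    have := hpos y
    nlinarith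
  have h3 : ∀ i, (∫ y, a' i y * ‖u.fn y‖ ^ 2) ≤ 2 * (‖u‖ * √S) := by
    intro i
    rw [h1]
    have e1 := abs_le.1 (Complex.abs_re_le_norm (inner ℂ (u.partialDeriv i) (mulR (a i) u.fn)))
    have e2 := norm_inner_le_norm (𝕜 := ℂ) (u.partialDeriv i) (mulR (a i) u.fn)
    have e3 : ‖u.partialDeriv i‖ * ‖mulR (a i) u.fn‖ ≤ ‖u‖ * √S :=
      mul_le_mul (u.norm_partialDeriv_le i) (h2 i) (norm_nonneg _) (norm_nonneg _)
    linarith [e1.1]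
  have h4 : S ≤ ∑ i, ∫ y, a' i y * ‖u.fn y‖ ^ 2 := by
    rw [← integral_finsetSum _ fun i _ => integrable_bdd_mul_norm_sq (ha i).meas' (ha i).bound' u.fn]
    refine integral_mono_ae hint (integrable_finsetSum _ fun i _ =>
      integrable_bdd_mul_norm_sq (ha i).meas' (ha i).bound' u.fn) (Eventually.of_forall fun y => ?_)
    simp only [← Finset.sum_mul]
    refine mul_le_mul_of_nonneg_right ?_ (by positivity)
    have e1 : ∑ i, (y - x) i ^ 2 = ‖y - x‖ ^ 2 := by rw [EuclideanSpace.norm_sq_eq]; simp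
    simp only [Finset.sum_sub_distrib, Finset.sum_const, ← Finset.sum_div, ← Finset.mul_sum, e1]
    simp only [Finset.card_univ, Fintype.card_fin, nsmul_eq_mul, Nat.cast_ofNat]
    have := hpos y
    have e2 : 2 * ‖y - x‖ ^ 2 / (‖y - x‖ ^ 2 + ε) ^ 2 ≤ 2 * (1 / (‖y - x‖ ^ 2 + ε)) := by
      rw [mul_one_div, div_le_div_iff₀ (pow_pos this 2) this]
      nlinarith [sq_nonneg ‖y - x‖, mul_pos hε this]
    linarith
  have h5 : S ≤ 6 * ‖u‖ * √S := by
    refine h4.trans ((Finset.sum_le_sum fun i _ => h3 i).trans ?_)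
    simp; linarith
  have h6 := Real.sq_sqrt hS0
  rcases eq_or_lt_of_le (Real.sqrt_nonneg S) with h7 | h7
  · have h8 : S = 0 := by rw [← h6, ← h7]; simp
    rw [h8]; positivity
  · have h8 : √S ≤ 6 * ‖u‖ := by
      refine le_of_mul_le_mul_right ?_ h7
      nlinarith
    nlinarith [norm_nonneg u, Real.sqrt_nonneg S]

/-- Hardy's inequality. -/
theorem hardy (x : R3) (u : H1) : Integrable (fun y => (‖y - x‖ ^ 2)⁻¹ * ‖u.fn y‖ ^ 2) ∧
    ∫ y, (‖y - x‖ ^ 2)⁻¹ * ‖u.fn y‖ ^ 2 ≤ 36 * ‖u‖ ^ 2 := by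
  have hm : AEStronglyMeasurable (fun y => (‖y - x‖ ^ 2)⁻¹ * ‖u.fn y‖ ^ 2) volume := by
    refine AEStronglyMeasurable.mul ?_ (integrable_norm_sq u.fn).1
    exact (by fun_prop : Measurable fun y : R3 => (‖y - x‖ ^ 2)⁻¹).aestronglyMeasurable
  -- Fatou's lemma with `ε = 1/(n + 1)`, since the bound of `hardy_regularized` does not depend on
  -- `ε`.
  have hl : ∫⁻ y, ENNReal.ofReal ((‖y - x‖ ^ 2)⁻¹ * ‖u.fn y‖ ^ 2) ≤ ENNReal.ofReal (36 * ‖u‖ ^ 2) := by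
    set e : ℕ → ℝ := fun n => 1 / ((n : ℝ) + 1) with he
    have he0 : ∀ n, 0 < e n := fun n => by positivity
    have hlim : ∀ᵐ y, Tendsto (fun n => ENNReal.ofReal (1 / (‖y - x‖ ^ 2 + e n) * ‖u.fn y‖ ^ 2)) atTop
        (𝓝 (ENNReal.ofReal ((‖y - x‖ ^ 2)⁻¹ * ‖u.fn y‖ ^ 2))) := by
      have hne : ∀ᵐ y : R3, y ≠ x := by
        simp [ae_iff]
      filter_upwards [hne] with y hy
      refine (ENNReal.continuous_ofReal.tendsto _).comp (Tendsto.mul_const _ ?_)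
      have h1 : Tendsto (fun n => ‖y - x‖ ^ 2 + e n) atTop (𝓝 (‖y - x‖ ^ 2 + 0)) :=
        tendsto_const_nhds.add tendsto_one_div_add_atTop_nhds_zero_nat
      rw [add_zero] at h1
      have h2 : ‖y - x‖ ^ 2 ≠ 0 := by
        have := norm_ne_zero_iff.2 (sub_ne_zero.2 hy); positivity
      simpa only [one_div] using h1.inv₀ h2
    calc ∫⁻ y, ENNReal.ofReal ((‖y - x‖ ^ 2)⁻¹ * ‖u.fn y‖ ^ 2)
        = ∫⁻ y, liminf (fun n => ENNReal.ofReal (1 / (‖y - x‖ ^ 2 + e n) * ‖u.fn y‖ ^ 2)) atTop := by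
          refine lintegral_congr_ae ?_
          filter_upwards [hlim] with y hy
          exact hy.liminf_eq.symm
      _ ≤ liminf (fun n => ∫⁻ y, ENNReal.ofReal (1 / (‖y - x‖ ^ 2 + e n) * ‖u.fn y‖ ^ 2)) atTop := by
          refine lintegral_liminf_le' fun n => ?_
          refine AEMeasurable.ennreal_ofReal ?_
          refine AEMeasurable.mul ?_ (integrable_norm_sq u.fn).1.aemeasurable
          exact (by fun_prop : Measurable fun y : R3 => 1 / (‖y - x‖ ^ 2 + e n)).aemeasurable
      _ ≤ ENNReal.ofReal (36 * ‖u‖ ^ 2) := by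
          refine liminf_le_of_le (by isBoundedDefault) fun b hb => ?_
          obtain ⟨n, hn⟩ := hb.exists
          refine hn.trans ?_
          rw [← ofReal_integral_eq_lintegral_ofReal]
          · exact ENNReal.ofReal_le_ofReal (hardy_regularized x (he0 n) u)
          · refine integrable_bdd_mul_norm_sq (C := 1 / e n) ?_ (fun y => ?_) u.fn
            · exact (by fun_prop : Measurable fun y : R3 => 1 / (‖y - x‖ ^ 2 + e n)).aestronglyMeasurable
            · have := he0 n
              rw [abs_of_pos (by positivity)]
              exact one_div_le_one_div_of_le this (by nlinarith [sq_nonneg ‖y - x‖])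
          · exact Eventually.of_forall fun y => by have := he0 n; positivity
  have hnn : ∀ y, 0 ≤ (‖y - x‖ ^ 2)⁻¹ * ‖u.fn y‖ ^ 2 := fun y => by positivity
  constructor
  · refine ⟨hm, ?_⟩
    rw [hasFiniteIntegral_iff_ofReal (Eventually.of_forall hnn)]
    exact hl.trans_lt ENNReal.ofReal_lt_top
  · rw [integral_eq_lintegral_of_nonneg_ae (Eventually.of_forall hnn) hm]
    exact ENNReal.toReal_le_of_le_ofReal (by positivity) hl

/-! ### The Hartree potential -/

/-- Even convolution kernels `v` such that multiplication by a translate of `v` maps `H¹` to `L²`,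
with norm at most `K`. -/
structure IsKernel (v : R3 → ℝ) (K : ℝ) : Prop where
  meas : AEStronglyMeasurable v volume
  even : ∀ᵐ x, v (-x) = v x
  memLp : ∀ (x : R3) (u : H1), MemLp (fun y => (v (x - y) : ℂ) * u.fn y) 2 volume
  norm_le : ∀ (x : R3) (u : H1), ‖mulR (fun y => v (x - y)) u.fn‖ ≤ K * ‖u‖
  nonneg : 0 ≤ K

theorem quasiMeasurePreserving_sub_left (x : R3) :
    Measure.QuasiMeasurePreserving (fun y : R3 => x - y) volume volume :=
  (Measure.measurePreserving_sub_left (volume : Measure R3) x).quasiMeasurePreserving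

/-- From `(a + b)² ≤ 2a² + 2b²`: the Coulomb part is controlled by Hardy's inequality, with `72 = 2
· 36`, and `v₂` by its essential bound. -/
theorem PotentialCondition.exists_isKernel {v w : R3 → ℝ} (h : PotentialCondition v w) :
    ∃ K, IsKernel v K := by
  obtain ⟨lam, v₂, hv₂, hv⟩ := h.v_decomp
  obtain ⟨M, hM⟩ : ∃ M : ℝ, ∀ᵐ x, |v₂ x| ≤ M := by
    refine ⟨(eLpNormEssSup v₂ volume).toReal, ?_⟩
    have hfin : eLpNormEssSup v₂ volume ≠ ∞ := by
      rw [← eLpNorm_exponent_top]; exact hv₂.2.ne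
    filter_upwards [enorm_ae_le_eLpNormEssSup v₂ volume] with x hx
    have := ENNReal.toReal_mono hfin hx
    simpa using this
  have hmeas : AEStronglyMeasurable v volume := by
    have h1 : AEStronglyMeasurable (fun x : R3 => lam * ‖x‖⁻¹ + v₂ x) volume :=
      (by fun_prop : Measurable fun x : R3 => lam * ‖x‖⁻¹).aestronglyMeasurable.add hv₂.1
    exact h1.congr (hv.mono fun x hx => hx.symm)
  have hsq : ∀ (x : R3) (u : H1), ∀ᵐ y, ‖(v (x - y) : ℂ) * u.fn y‖ ^ 2 ≤
      2 * lam ^ 2 * ((‖y - x‖ ^ 2)⁻¹ * ‖u.fn y‖ ^ 2) + 2 * M ^ 2 * ‖u.fn y‖ ^ 2 := by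
    intro x u
    filter_upwards [(quasiMeasurePreserving_sub_left x).ae hv,
      (quasiMeasurePreserving_sub_left x).ae hM] with y h1 h2
    rw [norm_mul, mul_pow, Complex.norm_real, Real.norm_eq_abs, sq_abs, h1, norm_sub_rev x y]
    have h3 : v₂ (x - y) ^ 2 ≤ M ^ 2 := by
      rw [← sq_abs]; exact pow_le_pow_left₀ (abs_nonneg _) h2 2
    have h4 : (lam * ‖y - x‖⁻¹ + v₂ (x - y)) ^ 2 ≤
        2 * lam ^ 2 * (‖y - x‖ ^ 2)⁻¹ + 2 * M ^ 2 := by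
      rw [← inv_pow]
      nlinarith [sq_nonneg (lam * ‖y - x‖⁻¹ - v₂ (x - y))]
    calc _ ≤ (2 * lam ^ 2 * (‖y - x‖ ^ 2)⁻¹ + 2 * M ^ 2) * ‖u.fn y‖ ^ 2 :=
          mul_le_mul_of_nonneg_right h4 (by positivity)
      _ = _ := by ring
  have hint : ∀ (x : R3) (u : H1), Integrable (fun y =>
      2 * lam ^ 2 * ((‖y - x‖ ^ 2)⁻¹ * ‖u.fn y‖ ^ 2) + 2 * M ^ 2 * ‖u.fn y‖ ^ 2) := fun x u =>
    ((hardy x u).1.const_mul _).add ((integrable_norm_sq u.fn).const_mul _)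
  have hm : ∀ (x : R3) (u : H1), AEStronglyMeasurable (fun y => (v (x - y) : ℂ) * u.fn y) volume :=
    fun x u => (Complex.continuous_ofReal.comp_aestronglyMeasurable
      (hmeas.comp_quasiMeasurePreserving (quasiMeasurePreserving_sub_left x))).mul
        (Lp.aestronglyMeasurable u.fn)
  have hmem : ∀ (x : R3) (u : H1), MemLp (fun y => (v (x - y) : ℂ) * u.fn y) 2 volume := by
    intro x u
    rw [memLp_two_iff_integrable_sq_norm (hm x u)]
    refine (hint x u).mono' ((hm x u).norm.pow 2) ?_
    filter_upwards [hsq x u] with y hy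
    rwa [Real.norm_eq_abs, abs_of_nonneg (by positivity)]
  refine ⟨√(72 * lam ^ 2 + 2 * M ^ 2), hmeas, h.v_even, hmem, fun x u => ?_, Real.sqrt_nonneg _⟩
  refine le_of_sq_le_sq ?_ (by positivity)
  rw [mul_pow, Real.sq_sqrt (by positivity), L2_norm_sq_eq]
  calc ∫ y, ‖mulR (fun y => v (x - y)) u.fn y‖ ^ 2
      ≤ ∫ y, (2 * lam ^ 2 * ((‖y - x‖ ^ 2)⁻¹ * ‖u.fn y‖ ^ 2) + 2 * M ^ 2 * ‖u.fn y‖ ^ 2) := by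
        refine integral_mono_ae (integrable_norm_sq _) (hint x u) ?_
        filter_upwards [hsq x u, mulL2_coe_of_memLp (hmem x u)] with y h1 h2
        rw [mulR, h2]; exact h1
    _ = 2 * lam ^ 2 * (∫ y, ((‖y - x‖ ^ 2)⁻¹ * ‖u.fn y‖ ^ 2)) + 2 * M ^ 2 * ‖u.fn‖ ^ 2 := by
        rw [integral_add ((hardy x u).1.const_mul _) ((integrable_norm_sq u.fn).const_mul _),
          integral_const_mul, integral_const_mul, L2_norm_sq_eq]
    _ ≤ 2 * lam ^ 2 * (36 * ‖u‖ ^ 2) + 2 * M ^ 2 * ‖u‖ ^ 2 := by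
        have := (hardy x u).2
        have := u.norm_fn_le
        gcongr
    _ = _ := by ring

/-- The polarized Hartree potential `v * Re(f̄ g)`. -/
def pairB (v : R3 → ℝ) (f g : L2) (x : R3) : ℝ := (inner ℂ f (mulR (fun y => v (x - y)) g)).re

section IsKernel
variable {v : R3 → ℝ} {K : ℝ}

theorem IsKernel.inner_mulR_eq (hv : IsKernel v K) (f : L2) (g : H1) (x : R3) :
    inner ℂ f (mulR (fun y => v (x - y)) g.fn) = ∫ y, (v (x - y) : ℂ) * (conj (f y) * g.fn y) := by
  rw [L2_inner_eq]
  refine integral_congr_ae ?_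
  filter_upwards [mulL2_coe_of_memLp (hv.memLp x g)] with y hy
  simp only [mulR, hy]; ring

theorem IsKernel.integrable_mul (hv : IsKernel v K) (f : L2) (g : H1) (x : R3) :
    Integrable (fun y => (v (x - y) : ℂ) * (conj (f y) * g.fn y)) := by
  refine (integrable_conj_mul f (mulR (fun y => v (x - y)) g.fn)).congr ?_
  filter_upwards [mulL2_coe_of_memLp (hv.memLp x g)] with y hy
  simp only [mulR, hy]; ring

theorem IsKernel.integrable_mul_re (hv : IsKernel v K) (f : L2) (g : H1) (x : R3) :
    Integrable (fun y => v (x - y) * (conj (f y) * g.fn y).re) := by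
  refine (hv.integrable_mul f g x).re.congr (Eventually.of_forall fun y => ?_)
  simp

theorem IsKernel.pairB_eq (hv : IsKernel v K) (f : L2) (g : H1) (x : R3) :
    pairB v f g.fn x = ∫ y, v (x - y) * (conj (f y) * g.fn y).re := by
  rw [pairB, hv.inner_mulR_eq, ← RCLike.re_eq_complex_re, ← integral_re (hv.integrable_mul f g x)]
  congr 1; ext y; simp

/-- Cauchy–Schwarz, with the singular kernel absorbed by the `H¹` factor. The other factor enters
only through its `L²` norm, which leaves room for a derivative or a difference quotient there. -/
theorem IsKernel.abs_pairB_le (hv : IsKernel v K) (f : L2) (g : H1) (x : R3) :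
    |pairB v f g.fn x| ≤ K * ‖f‖ * ‖g‖ := by
  refine (Complex.abs_re_le_norm _).trans ((norm_inner_le_norm _ _).trans ?_)
  have := mul_le_mul_of_nonneg_left (hv.norm_le x g) (norm_nonneg f)
  linarith

theorem IsKernel.pairB_comm (hv : IsKernel v K) (f g : H1) (x : R3) :
    pairB v f.fn g.fn x = pairB v g.fn f.fn x := by
  rw [hv.pairB_eq, hv.pairB_eq]
  congr 1; ext y; congr 1
  simp only [Complex.mul_re, Complex.conj_re, Complex.conj_im]; ring

theorem IsKernel.hartree_eq (hv : IsKernel v K) (f : H1) (x : R3) :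
    hartree v f.fn x = pairB v f.fn f.fn x := by
  rw [hv.pairB_eq, hartree]
  congr 1; ext y
  rw [mul_comm (conj _), Complex.mul_conj', ← Complex.ofReal_pow, Complex.ofReal_re]

theorem pairB_sub_left (f f' g : L2) (x : R3) :
    pairB v (f - f') g x = pairB v f g x - pairB v f' g x := by
  simp [pairB, inner_sub_left]

theorem pairB_smul_left (c : ℝ) (f g : L2) (x : R3) :
    pairB v ((c : ℂ) • f) g x = c * pairB v f g x := by
  rw [pairB, inner_smul_left, Complex.conj_ofReal, Complex.re_ofReal_mul, pairB]

theorem IsKernel.pairB_add_right (hv : IsKernel v K) (f : L2) (g g' : H1) (x : R3) :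
    pairB v f (g + g').fn x = pairB v f g.fn x + pairB v f g'.fn x := by
  rw [pairB, pairB, pairB, H1.fn_add, mulR, mulL2_add_of_memLp (hv.memLp x g) (hv.memLp x g'),
    inner_add_right]
  simp [mulR]

theorem IsKernel.pairB_sub_right (hv : IsKernel v K) (f : L2) (g g' : H1) (x : R3) :
    pairB v f (g - g').fn x = pairB v f g.fn x - pairB v f g'.fn x := by
  have := hv.pairB_add_right f (g - g') g' x
  rw [sub_add_cancel] at this
  linarith

/-- Convergence of the first factor is asked only in `L²`, so that it can be a difference quotient
of an `H¹` function. -/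
theorem IsKernel.tendsto_pairB (hv : IsKernel v K) {ι : Type*} {l : Filter ι} {f : ι → L2} {f₀ : L2}
    {g : ι → H1} {g₀ : H1} (hf : Tendsto f l (𝓝 f₀)) (hg : Tendsto g l (𝓝 g₀)) (x : R3) :
    Tendsto (fun n => pairB v (f n) (g n).fn x) l (𝓝 (pairB v f₀ g₀.fn x)) := by
  rw [tendsto_iff_norm_sub_tendsto_zero]
  have h1 : ∀ n, pairB v (f n) (g n).fn x - pairB v f₀ g₀.fn x =
      pairB v (f n - f₀) (g n).fn x + pairB v f₀ (g n - g₀).fn x := fun n => by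
    rw [pairB_sub_left, hv.pairB_sub_right]; ring
  have h2 : Tendsto (fun n => K * ‖f n - f₀‖ * ‖g n‖ + K * ‖f₀‖ * ‖g n - g₀‖) l (𝓝 0) := by
    have e1 := tendsto_iff_norm_sub_tendsto_zero.1 hf
    have e2 := tendsto_iff_norm_sub_tendsto_zero.1 hg
    have := ((e1.const_mul K).mul hg.norm).add (e2.const_mul (K * ‖f₀‖))
    simpa using this
  refine squeeze_zero (fun _ => norm_nonneg _) (fun n => ?_) h2
  rw [h1]
  exact (norm_add_le _ _).trans (add_le_add (hv.abs_pairB_le _ _ _) (hv.abs_pairB_le _ _ _))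

theorem IsKernel.pairB_shift (hv : IsKernel v K) (a : R3) (f : L2) (g : H1) (x : R3) :
    pairB v (shift a f) (shiftH a g).fn x = pairB v f g.fn (x + a) := by
  rw [hv.pairB_eq, hv.pairB_eq,
    ← integral_add_right_eq_self (fun y => v (x + a - y) * (conj (f y) * g.fn y).re) a]
  refine integral_congr_ae ?_
  filter_upwards [shift_coe a f, shift_coe a g.fn] with y h1 h2
  rw [shiftH_fn, h1, h2, add_sub_add_right_eq_sub]

theorem IsKernel.aestronglyMeasurable_pairB (hv : IsKernel v K) (f : L2) (g : H1) :
    AEStronglyMeasurable (pairB v f g.fn) volume := by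
  rw [funext (hv.pairB_eq f g)]
  have h1 : AEStronglyMeasurable (fun p : R3 × R3 => v (p.1 - p.2)) (volume.prod volume) :=
    hv.meas.comp_quasiMeasurePreserving (quasiMeasurePreserving_sub volume volume)
  have h2 : AEStronglyMeasurable (fun y => (conj (f y) * g.fn y).re) volume :=
    (integrable_conj_mul f g.fn).re.1
  have h3 := h1.mul (h2.comp_snd (μ := (volume : Measure R3)))
  exact h3.integral_prod_right'

/-- A translate of the convolution is the convolution of the translates, so the derivative never
falls on `v`. In each of the two terms the difference quotient of one factor converges in `L²` while
the other factor converges in `H¹`, which is what `tendsto_pairB` asks for; symmetry moves the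
quotient to the first place. -/
theorem IsKernel.hasDerivAt_pairB (hv : IsKernel v K) (f g : H1) (i : Fin 3) (x : R3) :
    HasDerivAt (fun h : ℝ => pairB v f.fn g.fn (x + h • basisVec i))
      (pairB v (f.partialDeriv i) g.fn x + pairB v (g.partialDeriv i) f.fn x) 0 := by
  rw [hasDerivAt_iff_tendsto_slope]
  have hsh : ∀ u : H1, Tendsto (fun h : ℝ => shiftH (h • basisVec i) u) (𝓝[≠] 0) (𝓝 u) := by
    intro u
    have h0 : shiftH ((0 : ℝ) • basisVec i) u = u := by
      refine H1.ext (Lp.ext ?_)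
      filter_upwards [shift_coe ((0 : ℝ) • basisVec i) u.fn] with y hy
      rw [shiftH_fn, hy]; simp
    have h1 : Continuous fun h : ℝ => shiftH (h • basisVec i) u :=
      (continuous_shiftH u).comp (by fun_prop)
    have := h1.tendsto 0
    rw [h0] at this
    exact this.mono_left nhdsWithin_le_nhds
  have hsl : ∀ u : H1, Tendsto (fun h : ℝ => (((h⁻¹ : ℝ) : ℂ) • (shift (h • basisVec i) u.fn - u.fn) : L2))
      (𝓝[≠] 0) (𝓝 (u.partialDeriv i)) := by
    intro u
    have h0 : shift ((0 : ℝ) • basisVec i) u.fn = u.fn := by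
      refine (Lp.ext ?_)
      filter_upwards [shift_coe ((0 : ℝ) • basisVec i) u.fn] with y hy
      rw [hy]; simp
    have := (isPartial_iff_hasDerivAt.1 (u.isPartial i)).tendsto_slope
    refine this.congr fun h => ?_
    rw [slope_def_module, h0, sub_zero]; exact (Complex.coe_smul _ _).symm
  have t1 := hv.tendsto_pairB (hsl f) (hsh g) x
  have t2 := hv.tendsto_pairB (hsl g) (tendsto_const_nhds (x := f)) x
  refine (t1.add t2).congr fun h => ?_
  rw [pairB_smul_left, pairB_smul_left, pairB_sub_left, pairB_sub_left, slope_def_field]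
  have e1 : pairB v (shift (h • basisVec i) g.fn) f.fn x = pairB v f.fn (shiftH (h • basisVec i) g).fn x :=
    hv.pairB_comm (shiftH (h • basisVec i) g) f x
  have e2 := hv.pairB_comm f g x
  rw [hv.pairB_shift, e1, ← e2]
  simp only [zero_smul, add_zero, sub_zero]
  ring

/-- The polarized Hartree potential of two `H¹` functions is `C¹` with bounded derivatives. -/
theorem IsKernel.isC1b (hv : IsKernel v K) (f g : H1) :
    IsC1b (pairB v f.fn g.fn)
      (fun i x => pairB v (f.partialDeriv i) g.fn x + pairB v (g.partialDeriv i) f.fn x)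
      (2 * K * ‖f‖ * ‖g‖) := by
  intro i
  have hK := hv.nonneg
  have h0 : ∀ x, |pairB v f.fn g.fn x| ≤ K * ‖f‖ * ‖g‖ := fun x =>
    (hv.abs_pairB_le f.fn g x).trans (by have := f.norm_fn_le; gcongr)
  have h1 : ∀ x, |pairB v (f.partialDeriv i) g.fn x| ≤ K * ‖f‖ * ‖g‖ := fun x =>
    (hv.abs_pairB_le _ g x).trans (by have := f.norm_partialDeriv_le i; gcongr)
  have h2 : ∀ x, |pairB v (g.partialDeriv i) f.fn x| ≤ K * ‖f‖ * ‖g‖ := fun x =>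
    (hv.abs_pairB_le _ f x).trans (by
      have := g.norm_partialDeriv_le i
      calc K * ‖g.partialDeriv i‖ * ‖f‖ ≤ K * ‖g‖ * ‖f‖ := by gcongr
        _ = _ := by ring)
  refine ⟨hv.aestronglyMeasurable_pairB _ _,
    (hv.aestronglyMeasurable_pairB _ _).add (hv.aestronglyMeasurable_pairB _ _),
    fun x => ?_, fun x => ?_, fun x => hv.hasDerivAt_pairB f g i x⟩
  · have : 0 ≤ K * ‖f‖ * ‖g‖ := by positivity
    linarith [h0 x]
  · refine (abs_add_le _ _).trans ?_
    linarith [h1 x, h2 x]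

end IsKernel

/-! ### The tracer potential -/

/-- Bounded functions with bounded and Lipschitz continuous first derivative. -/
structure IsTame (w : R3 → ℝ) (C : ℝ) : Prop where
  diff : Differentiable ℝ w
  bound : ∀ x, |w x| ≤ C
  bound_fderiv : ∀ x, ‖fderiv ℝ w x‖ ≤ C
  lip_fderiv : ∀ x y, ‖fderiv ℝ w x - fderiv ℝ w y‖ ≤ C * ‖x - y‖

theorem norm_basisVec (i : Fin 3) : ‖basisVec i‖ = 1 := by simp [basisVec]

theorem norm_sub_le_of_fderiv_bound {E F : Type*} [NormedAddCommGroup E] [NormedSpace ℝ E]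
    [NormedAddCommGroup F] [NormedSpace ℝ F] {f : E → F} {C : ℝ} (hf : Differentiable ℝ f)
    (hb : ∀ x, ‖fderiv ℝ f x‖ ≤ C) (x y : E) : ‖f x - f y‖ ≤ C * ‖x - y‖ :=
  Convex.norm_image_sub_le_of_norm_fderiv_le (s := Set.univ) (fun z _ => hf z) (fun z _ => hb z)
    convex_univ trivial trivial

theorem norm_fderiv_sub_le_of_iteratedFDeriv_bound {E F : Type*} [NormedAddCommGroup E]
    [NormedSpace ℝ E] [NormedAddCommGroup F] [NormedSpace ℝ F] {f : E → F} {C : ℝ}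
    (hf : ContDiff ℝ 2 f) (hb : ∀ x, ‖iteratedFDeriv ℝ 2 f x‖ ≤ C) (x y : E) :
    ‖fderiv ℝ f x - fderiv ℝ f y‖ ≤ C * ‖x - y‖ := by
  have h1 : ContDiff ℝ 1 (fderiv ℝ f) := hf.fderiv_right (by norm_num)
  refine norm_sub_le_of_fderiv_bound (h1.differentiable (by norm_num)) (fun z => ?_) x y
  rw [← norm_iteratedFDeriv_one, norm_iteratedFDeriv_fderiv]; exact hb z

/-- A bound on the next derivative gives the Lipschitz condition, so `w` uses two derivatives and
`∂ⱼw` all three. The constant is the sum of the four bounds. The statement on `∂ⱼw` serves the `H²`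
regularity only. -/
theorem PotentialCondition.exists_isTame {v w : R3 → ℝ} (h : PotentialCondition v w) :
    ∃ C, IsTame w C ∧ ∀ j, IsTame (fun x => fderiv ℝ w x (basisVec j)) C := by
  obtain ⟨C0, h0⟩ := h.w_bounded 0 (by norm_num)
  obtain ⟨C1, h1⟩ := h.w_bounded 1 (by norm_num)
  obtain ⟨C2, h2⟩ := h.w_bounded 2 (by norm_num)
  obtain ⟨C3, h3⟩ := h.w_bounded 3 (by norm_num)
  have hw := h.w_contDiff
  have hd0 : Differentiable ℝ w := hw.differentiable (by norm_num)
  have hw1 : ContDiff ℝ 2 (fderiv ℝ w) := hw.fderiv_right (by norm_num)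
  have hd1 : Differentiable ℝ (fderiv ℝ w) := hw1.differentiable (by norm_num)
  have b0 : ∀ x, |w x| ≤ C0 := fun x => by simpa using h0 x
  have b1 : ∀ x, ‖fderiv ℝ w x‖ ≤ C1 := fun x => by simpa [norm_iteratedFDeriv_one] using h1 x
  have b2 : ∀ x, ‖fderiv ℝ (fderiv ℝ w) x‖ ≤ C2 := fun x => by
    rw [← norm_iteratedFDeriv_one, norm_iteratedFDeriv_fderiv]; exact h2 x
  have n0 := (abs_nonneg _).trans (b0 0)
  have n1 := (norm_nonneg _).trans (b1 0)
  have n2 : 0 ≤ C2 := (norm_nonneg _).trans (h2 0)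
  have n3 : 0 ≤ C3 := (norm_nonneg _).trans (h3 0)
  have l1 := norm_fderiv_sub_le_of_iteratedFDeriv_bound (hw.of_le (by norm_num)) h2
  have l2 := norm_fderiv_sub_le_of_iteratedFDeriv_bound (C := C3) hw1 (fun x => by
    rw [norm_iteratedFDeriv_fderiv]; exact h3 x)
  refine ⟨C0 + C1 + C2 + C3, ⟨hd0, fun x => (b0 x).trans (by linarith),
    fun x => (b1 x).trans (by linarith), fun x y => (l1 x y).trans ?_⟩, fun j => ?_⟩
  · exact mul_le_mul_of_nonneg_right (by linarith) (norm_nonneg _)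
  · have hj : ∀ x, HasFDerivAt (fun x => fderiv ℝ w x (basisVec j))
        ((fderiv ℝ (fderiv ℝ w) x).flip (basisVec j)) x := fun x => by
      have := (hd1 x).hasFDerivAt.clm_apply (hasFDerivAt_const (basisVec j) x)
      simpa using this
    have hflip : ∀ A : R3 →L[ℝ] R3 →L[ℝ] ℝ, ‖A.flip (basisVec j)‖ ≤ ‖A‖ := fun A => by
      have := A.flip.le_opNorm (basisVec j)
      rwa [norm_basisVec, mul_one, ContinuousLinearMap.opNorm_flip] at this
    refine ⟨fun x => (hj x).differentiableAt, fun x => ?_, fun x => ?_, fun x y => ?_⟩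
    · have := (fderiv ℝ w x).le_opNorm (basisVec j)
      rw [norm_basisVec, mul_one] at this
      exact this.trans ((b1 x).trans (by linarith))
    · rw [(hj x).fderiv]
      exact (hflip _).trans ((b2 x).trans (by linarith))
    · rw [(hj x).fderiv, (hj y).fderiv]
      have e : (fderiv ℝ (fderiv ℝ w) x).flip (basisVec j) - (fderiv ℝ (fderiv ℝ w) y).flip (basisVec j) =
          (fderiv ℝ (fderiv ℝ w) x - fderiv ℝ (fderiv ℝ w) y).flip (basisVec j) := by
        ext z; simp
      rw [e]
      refine (hflip _).trans ((l2 x y).trans ?_)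
      exact mul_le_mul_of_nonneg_right (by linarith) (norm_nonneg _)

/-- The position of a particle as a continuous linear function of the configuration. -/
def particleL {m : ℕ} (l : Fin m) : Config m →L[ℝ] R3 :=
  LinearMap.toContinuousLinearMap
    { toFun := fun X => X.particle l
      map_add' := fun _ _ => rfl
      map_smul' := fun _ _ => rfl }

theorem norm_particle_le {m : ℕ} (l : Fin m) (X : Config m) : ‖X.particle l‖ ≤ ‖X‖ := by
  refine le_of_sq_le_sq ?_ (norm_nonneg _)
  rw [EuclideanSpace.norm_sq_eq, EuclideanSpace.norm_sq_eq, Fintype.sum_prod_type]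
  exact Finset.single_le_sum (f := fun l => ∑ i, ‖X (l, i)‖ ^ 2)
    (fun _ _ => Finset.sum_nonneg fun _ _ => by positivity) (Finset.mem_univ l)

theorem norm_particleL_le {m : ℕ} (l : Fin m) : ‖(particleL l : Config m →L[ℝ] R3)‖ ≤ 1 :=
  ContinuousLinearMap.opNorm_le_bound _ zero_le_one fun X => by
    rw [one_mul]; exact norm_particle_le l X

section Tracer
variable {w : R3 → ℝ} {C : ℝ} {m : ℕ}

theorem IsTame.nonneg (hw : IsTame w C) : 0 ≤ C := (abs_nonneg _).trans (hw.bound 0)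

theorem IsTame.continuous_fderiv (hw : IsTame w C) : Continuous (fderiv ℝ w) := by
  have : LipschitzWith C.toNNReal (fderiv ℝ w) := LipschitzWith.of_dist_le_mul fun x y => by
    rw [dist_eq_norm, dist_eq_norm, Real.coe_toNNReal _ hw.nonneg]; exact hw.lip_fderiv x y
  exact this.continuous

/-- The partial derivatives of the total tracer potential. -/
def tracerPartial (w : R3 → ℝ) (X : Config m) (i : Fin 3) (x : R3) : ℝ :=
  ∑ l, fderiv ℝ w (x - X.particle l) (basisVec i)

theorem abs_sum_fin_le {f : Fin m → ℝ} {B : ℝ} (h : ∀ l, |f l| ≤ B) : |∑ l, f l| ≤ m * B := by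
  refine (Finset.abs_sum_le_sum_abs _ _).trans ((Finset.sum_le_sum fun l _ => h l).trans ?_)
  simp

theorem IsTame.continuous_totalTracer (hw : IsTame w C) (X : Config m) :
    Continuous (fun x => totalTracer w x X) := by
  have := hw.diff.continuous
  unfold totalTracer; fun_prop

theorem IsTame.continuous_tracerPartial (hw : IsTame w C) (X : Config m) (i : Fin 3) :
    Continuous (tracerPartial w X i) := by
  have := hw.continuous_fderiv
  unfold tracerPartial; fun_prop

theorem IsTame.hasDerivAt_totalTracer (hw : IsTame w C) (X : Config m) (i : Fin 3) (x : R3) :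
    HasDerivAt (fun h : ℝ => totalTracer w (x + h • basisVec i) X) (tracerPartial w X i x) 0 := by
  unfold totalTracer tracerPartial
  refine HasDerivAt.fun_sum fun l _ => ?_
  have h1 : HasDerivAt (fun h : ℝ => x + h • basisVec i - X.particle l) (basisVec i) 0 := by
    have := (((hasDerivAt_id (0 : ℝ)).smul_const (basisVec i)).const_add x).sub_const (X.particle l)
    simpa using this
  have h2 : HasFDerivAt w (fderiv ℝ w (x - X.particle l)) (x + (0 : ℝ) • basisVec i - X.particle l) := by
    simpa using (hw.diff (x - X.particle l)).hasFDerivAt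
  exact h2.comp_hasDerivAt 0 h1

theorem IsTame.isC1b (hw : IsTame w C) (X : Config m) :
    IsC1b (fun x => totalTracer w x X) (tracerPartial w X) (m * C) := by
  intro i
  refine ⟨(hw.continuous_totalTracer X).aestronglyMeasurable,
    (hw.continuous_tracerPartial X i).aestronglyMeasurable,
    fun x => abs_sum_fin_le fun l => hw.bound _, fun x => abs_sum_fin_le fun l => ?_,
    fun x => hw.hasDerivAt_totalTracer X i x⟩
  have := (fderiv ℝ w (x - X.particle l)).le_opNorm (basisVec i)
  rw [norm_basisVec, mul_one] at this
  exact this.trans (hw.bound_fderiv _)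

theorem IsTame.abs_sub_le (hw : IsTame w C) (x y : R3) : |w x - w y| ≤ C * ‖x - y‖ :=
  norm_sub_le_of_fderiv_bound hw.diff hw.bound_fderiv x y

theorem norm_sub_particle_le (X Y : Config m) (x : R3) (l : Fin m) :
    ‖x - X.particle l - (x - Y.particle l)‖ ≤ ‖X - Y‖ := by
  rw [sub_sub_sub_cancel_left, ← norm_neg, neg_sub]
  exact norm_particle_le l (X - Y)

/-- The Lipschitz condition on the derivative of `w` enters here. It makes multiplication by the
tracer potential, as an operator on `H¹`, Lipschitz in the configuration. -/
theorem IsTame.isC1b_sub (hw : IsTame w C) (X Y : Config m) :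
    IsC1b (fun x => totalTracer w x X - totalTracer w x Y)
      (fun i x => tracerPartial w X i x - tracerPartial w Y i x) (m * (C * ‖X - Y‖)) := by
  intro i
  have hC := hw.nonneg
  refine ⟨((hw.isC1b X) i).meas.sub ((hw.isC1b Y) i).meas, ((hw.isC1b X) i).meas'.sub ((hw.isC1b Y) i).meas',
    fun x => ?_, fun x => ?_, fun x => ((hw.isC1b X) i).deriv x |>.sub (((hw.isC1b Y) i).deriv x)⟩
  · rw [totalTracer, totalTracer, ← Finset.sum_sub_distrib]
    refine abs_sum_fin_le fun l => (hw.abs_sub_le _ _).trans ?_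
    exact mul_le_mul_of_nonneg_left (norm_sub_particle_le X Y x l) hC
  · simp only [tracerPartial]
    rw [← Finset.sum_sub_distrib]
    refine abs_sum_fin_le fun l => ?_
    have := (fderiv ℝ w (x - X.particle l) - fderiv ℝ w (x - Y.particle l)).le_opNorm (basisVec i)
    rw [norm_basisVec, mul_one] at this
    refine this.trans ((hw.lip_fderiv _ _).trans ?_)
    exact mul_le_mul_of_nonneg_left (norm_sub_particle_le X Y x l) hC

/-- The derivative of the total tracer potential with respect to the configuration. -/
def tracerDeriv (w : R3 → ℝ) (X : Config m) (x : R3) : Config m →L[ℝ] ℝ :=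
  -∑ l, (fderiv ℝ w (x - X.particle l)).comp (particleL l)

theorem IsTame.hasFDerivAt_config (hw : IsTame w C) (X : Config m) (x : R3) :
    HasFDerivAt (fun Y : Config m => totalTracer w x Y) (tracerDeriv w X x) X := by
  unfold totalTracer tracerDeriv
  rw [← Finset.sum_neg_distrib]
  refine HasFDerivAt.fun_sum fun l _ => ?_
  have h1 : HasFDerivAt (fun Y : Config m => x - Y.particle l) (-(particleL l)) X :=
    (particleL l).hasFDerivAt.const_sub x
  have := (hw.diff (x - X.particle l)).hasFDerivAt.comp X h1
  rwa [ContinuousLinearMap.comp_neg] at this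

theorem norm_sum_fin_le {E : Type*} [SeminormedAddCommGroup E] {f : Fin m → E} {B : ℝ}
    (h : ∀ l, ‖f l‖ ≤ B) : ‖∑ l, f l‖ ≤ m * B := by
  refine (norm_sum_le _ _).trans ((Finset.sum_le_sum fun l _ => h l).trans ?_)
  simp

theorem IsTame.norm_tracerDeriv_le (hw : IsTame w C) (X : Config m) (x : R3) :
    ‖tracerDeriv w X x‖ ≤ m * C := by
  rw [tracerDeriv, norm_neg]
  refine norm_sum_fin_le fun l => (ContinuousLinearMap.opNorm_comp_le _ _).trans ?_
  have := mul_le_mul (hw.bound_fderiv (x - X.particle l)) (norm_particleL_le l) (norm_nonneg _) hw.nonneg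
  simpa using this

theorem IsTame.norm_tracerDeriv_sub_le (hw : IsTame w C) (X Y : Config m) (x : R3) :
    ‖tracerDeriv w X x - tracerDeriv w Y x‖ ≤ m * (C * ‖X - Y‖) := by
  rw [tracerDeriv, tracerDeriv, neg_sub_neg, ← Finset.sum_sub_distrib]
  refine norm_sum_fin_le fun l => ?_
  rw [← ContinuousLinearMap.sub_comp]
  refine (ContinuousLinearMap.opNorm_comp_le _ _).trans ?_
  have h1 := (hw.lip_fderiv (x - Y.particle l) (x - X.particle l)).trans
    (mul_le_mul_of_nonneg_left (norm_sub_particle_le Y X x l) hw.nonneg)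
  have := mul_le_mul h1 (norm_particleL_le l) (norm_nonneg _)
    (mul_nonneg hw.nonneg (norm_nonneg _))
  rwa [mul_one, norm_sub_rev Y X] at this

theorem IsTame.gradient_eq (hw : IsTame w C) (X : Config m) (x : R3) :
    ∇ (fun Y : Config m => totalTracer w x Y) X =
      (InnerProductSpace.toDual ℝ (Config m)).symm (tracerDeriv w X x) := by
  rw [gradient, (hw.hasFDerivAt_config X x).fderiv]

theorem IsTame.continuous_gradient (hw : IsTame w C) (X : Config m) :
    Continuous fun x => ∇ (fun Y : Config m => totalTracer w x Y) X := by
  simp only [hw.gradient_eq]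
  refine (InnerProductSpace.toDual ℝ (Config m)).symm.continuous.comp ?_
  have := hw.continuous_fderiv
  unfold tracerDeriv
  refine (continuous_finsetSum _ fun l _ => ?_).neg
  exact (this.comp (by fun_prop)).clm_comp continuous_const

theorem IsTame.norm_gradient_le (hw : IsTame w C) (X : Config m) (x : R3) :
    ‖∇ (fun Y : Config m => totalTracer w x Y) X‖ ≤ m * C := by
  rw [hw.gradient_eq, LinearIsometryEquiv.norm_map]; exact hw.norm_tracerDeriv_le X x

theorem IsTame.norm_gradient_sub_le (hw : IsTame w C) (X Y : Config m) (x : R3) :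
    ‖∇ (fun Z : Config m => totalTracer w x Z) X - ∇ (fun Z : Config m => totalTracer w x Z) Y‖ ≤
      m * (C * ‖X - Y‖) := by
  rw [hw.gradient_eq, hw.gradient_eq, ← map_sub, LinearIsometryEquiv.norm_map]
  exact hw.norm_tracerDeriv_sub_le X Y x

theorem integral_norm_mul_norm_le (f g : L2) :
    Integrable (fun x => ‖f x‖ * ‖g x‖) ∧ ∫ x, ‖f x‖ * ‖g x‖ ≤ ‖f‖ * ‖g‖ := by
  have hi : Integrable (fun x => ‖f x‖ * ‖g x‖) := by
    refine (integrable_conj_mul f g).norm.congr (Eventually.of_forall fun x => ?_)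
    simp
  refine ⟨hi, ?_⟩
  have h := integral_mul_norm_le_Lp_mul_Lq (μ := (volume : Measure R3)) (f := f) (g := g)
    (p := 2) (q := 2) Real.HolderConjugate.two_two (by simpa using Lp.memLp f) (by simpa using Lp.memLp g)
  simp only [Real.rpow_ofNat, ← L2_norm_sq_eq] at h
  rwa [← Real.sqrt_eq_rpow, ← Real.sqrt_eq_rpow, Real.sqrt_sq (norm_nonneg _),
    Real.sqrt_sq (norm_nonneg _)] at h

theorem integral_abs_norm_sq_sub_le (f g : L2) :
    ∫ x, |‖f x‖ ^ 2 - ‖g x‖ ^ 2| ≤ ‖f - g‖ * (‖f‖ + ‖g‖) := by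
  have h1 := integral_norm_mul_norm_le (f - g) f
  have h2 := integral_norm_mul_norm_le (f - g) g
  calc ∫ x, |‖f x‖ ^ 2 - ‖g x‖ ^ 2|
      ≤ ∫ x, (‖(f - g : L2) x‖ * ‖f x‖ + ‖(f - g : L2) x‖ * ‖g x‖) := by
        refine integral_mono_ae ((integrable_norm_sq f).sub (integrable_norm_sq g)).abs
          (h1.1.add h2.1) ?_
        filter_upwards [Lp.coeFn_sub f g] with x hx
        rw [hx, Pi.sub_apply, sq_sub_sq, abs_mul, abs_of_nonneg (by positivity), ← mul_add, mul_comm]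
        exact mul_le_mul_of_nonneg_right (abs_norm_sub_norm_le _ _) (by positivity)
    _ ≤ _ := by
        rw [integral_add h1.1 h2.1]; linarith [h1.2, h2.2]

theorem IsTame.integrable_acceleration (hw : IsTame w C) (X : Config m) (φ : L2) :
    Integrable (fun x => ‖φ x‖ ^ 2 • ∇ (fun Y : Config m => totalTracer w x Y) X) :=
  (integrable_norm_sq φ).smul_bdd (m * C) (hw.continuous_gradient X).aestronglyMeasurable
    (Eventually.of_forall fun x => hw.norm_gradient_le X x)

theorem IsTame.norm_acceleration_sub_le (hw : IsTame w C) (X Y : Config m) (φ χ : L2) :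
    ‖acceleration w X φ - acceleration w Y χ‖ ≤
      m * C * (‖φ - χ‖ * (‖φ‖ + ‖χ‖)) + m * (C * ‖X - Y‖) * ‖χ‖ ^ 2 := by
  set G : Config m → R3 → Config m := fun X x => ∇ (fun Z : Config m => totalTracer w x Z) X with hG
  have hC := hw.nonneg
  rw [acceleration, acceleration, neg_sub_neg, norm_sub_rev,
    ← integral_sub (hw.integrable_acceleration X φ) (hw.integrable_acceleration Y χ)]
  have i1 : Integrable fun x => m * C * |‖φ x‖ ^ 2 - ‖χ x‖ ^ 2| :=
    ((integrable_norm_sq φ).sub (integrable_norm_sq χ)).abs.const_mul _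
  have i2 : Integrable fun x => m * (C * ‖X - Y‖) * ‖χ x‖ ^ 2 := (integrable_norm_sq χ).const_mul _
  calc _ ≤ ∫ x, (m * C * |‖φ x‖ ^ 2 - ‖χ x‖ ^ 2| + m * (C * ‖X - Y‖) * ‖χ x‖ ^ 2) := by
        refine norm_integral_le_of_norm_le (i1.add i2) (Eventually.of_forall fun x => ?_)
        have e : ‖φ x‖ ^ 2 • G X x - ‖χ x‖ ^ 2 • G Y x =
            (‖φ x‖ ^ 2 - ‖χ x‖ ^ 2) • G X x + ‖χ x‖ ^ 2 • (G X x - G Y x) := by module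
        simp only [hG] at e
        rw [e]
        refine (norm_add_le _ _).trans (add_le_add ?_ ?_)
        · rw [norm_smul, Real.norm_eq_abs, mul_comm]
          exact mul_le_mul_of_nonneg_right (hw.norm_gradient_le X x) (abs_nonneg _)
        · rw [norm_smul, Real.norm_eq_abs, abs_of_nonneg (by positivity), mul_comm]
          exact mul_le_mul_of_nonneg_right (hw.norm_gradient_sub_le X Y x) (by positivity)
    _ ≤ _ := by
        rw [integral_add i1 i2, integral_const_mul, integral_const_mul, ← L2_norm_sq_eq]
        have := integral_abs_norm_sq_sub_le φ χ
        gcongr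

end Tracer

/-! ### The interaction -/

section Interaction
variable {v w : R3 → ℝ} {K C : ℝ} {m : ℕ}

/-- The total potential is `C¹` with bounded derivatives. -/
theorem isC1b_potential (hv : IsKernel v K) (hw : IsTame w C) (X : Config m) (φ : H1) :
    IsC1b (fun x => pairB v φ.fn φ.fn x + totalTracer w x X)
      (fun i x => (pairB v (φ.partialDeriv i) φ.fn x + pairB v (φ.partialDeriv i) φ.fn x)
        + tracerPartial w X i x)
      (2 * K * ‖φ‖ * ‖φ‖ + m * C) := (hv.isC1b φ φ).add (hw.isC1b X)

/-- The interaction term of the field equation, as an `H¹` function. -/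
def interaction (hv : IsKernel v K) (hw : IsTame w C) (X : Config m) (φ : H1) : H1 :=
  (isC1b_potential hv hw X φ).mulH φ

/-- The inhomogeneity in the definition of a mild solution is thus determined by the state and is
automatically in `H¹`. -/
theorem isInteraction_iff (hv : IsKernel v K) (hw : IsTame w C) (X : Config m) (φ : H1) (F : L2) :
    IsInteraction v w X φ.fn F ↔ F = (interaction hv hw X φ).fn := by
  have h := (isC1b_potential hv hw X φ 0).isBddBy.mulL2_coe φ.fn
  constructor
  · intro hF
    refine Lp.ext ?_
    filter_upwards [h, hF] with x h1 h2
    rw [h2, hv.hartree_eq]; exact h1.symm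
  · rintro rfl
    filter_upwards [h] with x h1
    rw [hv.hartree_eq]; exact h1

/-- Since `|φ|² - |χ|² = Re((φ - χ)‾ (φ + χ))`, the difference of the two Hartree potentials is a
single polarized potential with the small factor `φ - χ`. -/
theorem interaction_sub_eq (hv : IsKernel v K) (hw : IsTame w C) (X Y : Config m) (φ χ : H1) :
    interaction hv hw X φ - interaction hv hw Y χ =
      (isC1b_potential hv hw X φ).mulH (φ - χ) +
        ((hv.isC1b (φ - χ) (φ + χ)).add (hw.isC1b_sub X Y)).mulH χ := by
  have hD := (hv.isC1b (φ - χ) (φ + χ)).add (hw.isC1b_sub X Y)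
  have e : (isC1b_potential hv hw X φ).mulH χ =
      (isC1b_potential hv hw Y χ).mulH χ + hD.mulH χ := by
    refine IsC1b.mulH_eq_add _ _ _ (fun x => ?_) χ
    rw [H1.fn_sub, pairB_sub_left, hv.pairB_add_right, hv.pairB_add_right, hv.pairB_comm χ φ]
    ring
  rw [IsC1b.mulH_sub, e, interaction, interaction]
  abel

theorem norm_interaction_sub_le (hv : IsKernel v K) (hw : IsTame w C) (X Y : Config m) (φ χ : H1) :
    ‖interaction hv hw X φ - interaction hv hw Y χ‖ ≤
      4 * (2 * K * ‖φ‖ * ‖φ‖ + m * C) * ‖φ - χ‖ +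
        4 * (2 * K * ‖φ - χ‖ * ‖φ + χ‖ + m * (C * ‖X - Y‖)) * ‖χ‖ := by
  rw [interaction_sub_eq]
  exact (norm_add_le _ _).trans (add_le_add (IsC1b.norm_mulH_le _ _) (IsC1b.norm_mulH_le _ _))

/-- The nonlinear part of the vector field of the mean-field equations. -/
def nonlinearity (hv : IsKernel v K) (hw : IsTame w C) (z : Phase m) : Phase m :=
  (z.2.1, acceleration w z.1 z.2.2.fn, -(Complex.I • interaction hv hw z.1 z.2.2))

theorem nonlinearity_lipschitzOn (hv : IsKernel v K) (hw : IsTame w C) (R : ℝ) :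
    ∃ L : NNReal, LipschitzOnWith L (nonlinearity (m := m) hv hw) (Metric.closedBall 0 R) := by
  have hK := hv.nonneg
  have hC := hw.nonneg
  have hmC : 0 ≤ (m : ℝ) * C := by positivity
  -- Replacing `R` by `|R|` makes the constants nonnegative for every radius; it only enlarges the
  -- ball.
  set R' := |R| with hR'
  have hR0 : 0 ≤ R' := abs_nonneg R
  -- The three groups are the Lipschitz constants of the position, velocity and field components.
  -- The phase space carries the maximum norm, so each component is compared with `L` separately.
  set L : ℝ := 1 + (m * C * (2 * R') + m * C * R' ^ 2) +
    (4 * (2 * K * R' * R' + m * C) + 4 * (2 * K * (2 * R') + m * C) * R') with hL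
  have hL0 : 0 ≤ L := by positivity
  refine ⟨L.toNNReal, LipschitzOnWith.of_dist_le_mul fun z hz y hy => ?_⟩
  rw [Real.coe_toNNReal _ hL0, dist_eq_norm, dist_eq_norm]
  rw [mem_closedBall_zero_iff] at hz hy
  replace hz := hz.trans (le_abs_self R)
  replace hy := hy.trans (le_abs_self R)
  obtain ⟨X, V, φ⟩ := z
  obtain ⟨Y, W, χ⟩ := y
  set d := ‖((X, V, φ) - (Y, W, χ) : Phase m)‖ with hd
  have hd0 : 0 ≤ d := norm_nonneg _
  have dX : ‖X - Y‖ ≤ d := norm_fst_le ((X, V, φ) - (Y, W, χ) : Phase m)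
  have dVφ : ‖((V, φ) - (W, χ) : Config m × H1)‖ ≤ d := norm_snd_le ((X, V, φ) - (Y, W, χ) : Phase m)
  have dV : ‖V - W‖ ≤ d := (norm_fst_le ((V, φ) - (W, χ) : Config m × H1)).trans dVφ
  have dφ : ‖φ - χ‖ ≤ d := (norm_snd_le ((V, φ) - (W, χ) : Config m × H1)).trans dVφ
  have bφ : ‖φ‖ ≤ R' := ((norm_snd_le (V, φ)).trans (norm_snd_le (X, V, φ))).trans hz
  have bχ : ‖χ‖ ≤ R' := ((norm_snd_le (W, χ)).trans (norm_snd_le (Y, W, χ))).trans hy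
  have n1 : 0 ≤ m * C * (2 * R') + m * C * R' ^ 2 := by positivity
  have n2 : 0 ≤ 4 * (2 * K * R' * R' + m * C) + 4 * (2 * K * (2 * R') + m * C) * R' := by positivity
  refine max_le ?_ (max_le ?_ ?_)
  · refine dV.trans ?_
    nlinarith
  · refine (hw.norm_acceleration_sub_le X Y φ.fn χ.fn).trans ?_
    have e1 : ‖φ.fn - χ.fn‖ ≤ d := (φ - χ).norm_fn_le.trans dφ
    have e2 : ‖φ.fn‖ ≤ R' := φ.norm_fn_le.trans bφ
    have e3 : ‖χ.fn‖ ≤ R' := χ.norm_fn_le.trans bχ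
    calc m * C * (‖φ.fn - χ.fn‖ * (‖φ.fn‖ + ‖χ.fn‖)) + m * (C * ‖X - Y‖) * ‖χ.fn‖ ^ 2
        ≤ m * C * (d * (R' + R')) + m * (C * d) * R' ^ 2 := by gcongr
      _ = (m * C * (2 * R') + m * C * R' ^ 2) * d := by ring
      _ ≤ L * d := mul_le_mul_of_nonneg_right (by linarith) hd0
  · change ‖-(Complex.I • interaction hv hw X φ) - -(Complex.I • interaction hv hw Y χ)‖ ≤ L * d
    rw [neg_sub_neg, ← smul_sub, norm_smul, Complex.norm_I, one_mul, norm_sub_rev]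
    refine (norm_interaction_sub_le hv hw X Y φ χ).trans ?_
    have e1 : ‖φ + χ‖ ≤ R' + R' := (norm_add_le _ _).trans (add_le_add bφ bχ)
    calc 4 * (2 * K * ‖φ‖ * ‖φ‖ + m * C) * ‖φ - χ‖ +
        4 * (2 * K * ‖φ - χ‖ * ‖φ + χ‖ + m * (C * ‖X - Y‖)) * ‖χ‖
        ≤ 4 * (2 * K * R' * R' + m * C) * d + 4 * (2 * K * d * (R' + R') + m * (C * d)) * R' := by
          gcongr
      _ = (4 * (2 * K * R' * R' + m * C) + 4 * (2 * K * (2 * R') + m * C) * R') * d := by ring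
      _ ≤ L * d := mul_le_mul_of_nonneg_right (by linarith) hd0

end Interaction

/-! ### Ordinary differential equations with an a priori bound -/

section ODE
open Set Metric
variable {E : Type*} [NormedAddCommGroup E] [NormedSpace ℝ E] {f : ℝ → E → E}

/-- Lipschitz continuity on balls, locally uniformly in time. -/
def IsLocLip (f : ℝ → E → E) : Prop :=
  ∀ T R : ℝ, ∃ K : NNReal, ∀ t ∈ Icc (-T) T, LipschitzOnWith K (f t) (closedBall 0 R)

/-- A solution of `y' = f(t, y)` on `(-S, S)`. -/
def IsSolutionOn (f : ℝ → E → E) (y : ℝ → E) (S : ℝ) : Prop :=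
  ∀ t ∈ Ioo (-S) S, HasDerivAt y (f t (y t)) t

/-- On a compact subinterval both solutions stay in a common ball, where the field is Lipschitz
uniformly in time. -/
theorem IsLocLip.unique (hf : IsLocLip f) {y₁ y₂ : ℝ → E} {S : ℝ} (h₁ : IsSolutionOn f y₁ S)
    (h₂ : IsSolutionOn f y₂ S) (h0 : y₁ 0 = y₂ 0) : EqOn y₁ y₂ (Ioo (-S) S) := by
  intro t ht
  obtain ⟨s, hs1, hs2⟩ : ∃ s, |t| < s ∧ s < S := exists_between (abs_lt.2 ht)
  have hs0 : 0 < s := (abs_nonneg t).trans_lt hs1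
  have hsub : Icc (-s) s ⊆ Ioo (-S) S := fun r hr => ⟨by linarith [hr.1], by linarith [hr.2]⟩
  have hb : ∀ y : ℝ → E, IsSolutionOn f y S → ∃ R, ∀ r ∈ Icc (-s) s, ‖y r‖ ≤ R := fun y hy =>
    isCompact_Icc.exists_bound_of_continuousOn fun r hr => (hy r (hsub hr)).continuousAt.continuousWithinAt
  obtain ⟨R₁, hR₁⟩ := hb y₁ h₁
  obtain ⟨R₂, hR₂⟩ := hb y₂ h₂
  obtain ⟨K, hK⟩ := hf s (max R₁ R₂)
  refine ODE_solution_unique_of_mem_Ioo (a := -s) (b := s) (t₀ := 0) (v := f) (K := K)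
    (s := fun _ => closedBall 0 (max R₁ R₂)) (fun r hr => hK r (Ioo_subset_Icc_self hr))
    ⟨by linarith, hs0⟩ (fun r hr => ?_) (fun r hr => ?_) h0 (abs_lt.1 hs1)
  · exact ⟨h₁ r (hsub (Ioo_subset_Icc_self hr)), mem_closedBall_zero_iff.2
      ((hR₁ r (Ioo_subset_Icc_self hr)).trans (le_max_left _ _))⟩
  · exact ⟨h₂ r (hsub (Ioo_subset_Icc_self hr)), mem_closedBall_zero_iff.2
      ((hR₂ r (Ioo_subset_Icc_self hr)).trans (le_max_right _ _))⟩

/-- A cut-off function, one for `r ≤ R` and zero for `r ≥ R + 1`. -/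
def cutoff (R r : ℝ) : ℝ := max 0 (min 1 (R + 1 - r))

theorem cutoff_eq_one {R r : ℝ} (h : r ≤ R) : cutoff R r = 1 := by
  rw [cutoff, min_eq_left (by linarith), max_eq_right zero_le_one]

theorem cutoff_eq_zero {R r : ℝ} (h : R + 1 ≤ r) : cutoff R r = 0 := by
  rw [cutoff, max_eq_left]; exact (min_le_right _ _).trans (by linarith)

theorem cutoff_nonneg (R r : ℝ) : 0 ≤ cutoff R r := le_max_left _ _
theorem cutoff_le_one (R r : ℝ) : cutoff R r ≤ 1 := max_le zero_le_one (min_le_left _ _)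

theorem abs_cutoff_sub_le (R r s : ℝ) : |cutoff R r - cutoff R s| ≤ |r - s| := by
  unfold cutoff
  refine (abs_max_sub_max_le_max _ _ _ _).trans (max_le (by simp) ?_)
  refine (abs_min_sub_min_le_max _ _ _ _).trans (max_le (by simp) ?_)
  rw [show R + 1 - r - (R + 1 - s) = -(r - s) by ring, abs_neg]

/-- The vector field cut off outside a ball is globally Lipschitz. -/
theorem norm_cutoff_smul_sub_le {g : E → E} {R B : ℝ} {K : NNReal}
    (hK : LipschitzOnWith K g (closedBall 0 (R + 1))) (hB : ∀ x ∈ closedBall 0 (R + 1), ‖g x‖ ≤ B)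
    (hB0 : 0 ≤ B) (x y : E) :
    ‖cutoff R ‖x‖ • g x - cutoff R ‖y‖ • g y‖ ≤ (K + B) * ‖x - y‖ := by
  have hxy := abs_cutoff_sub_le R ‖x‖ ‖y‖
  have hn := abs_norm_sub_norm_le x y
  have hKB : B * ‖x - y‖ ≤ (K + B) * ‖x - y‖ :=
    mul_le_mul_of_nonneg_right (by have := K.2; linarith [NNReal.coe_nonneg K]) (norm_nonneg _)
  by_cases hx : ‖x‖ ≤ R + 1
  · by_cases hy : ‖y‖ ≤ R + 1
    · have hx' := mem_closedBall_zero_iff.2 hx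
      have hy' := mem_closedBall_zero_iff.2 hy
      have e : cutoff R ‖x‖ • g x - cutoff R ‖y‖ • g y =
          cutoff R ‖x‖ • (g x - g y) + (cutoff R ‖x‖ - cutoff R ‖y‖) • g y := by module
      rw [e, add_mul]
      refine (norm_add_le _ _).trans (add_le_add ?_ ?_)
      · rw [norm_smul, Real.norm_eq_abs, abs_of_nonneg (cutoff_nonneg _ _)]
        have h1 := hK.dist_le_mul x hx' y hy'
        rw [dist_eq_norm, dist_eq_norm] at h1
        calc _ ≤ 1 * ‖g x - g y‖ := mul_le_mul_of_nonneg_right (cutoff_le_one _ _) (norm_nonneg _)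
          _ ≤ _ := by rw [one_mul]; exact h1
      · rw [norm_smul, Real.norm_eq_abs, mul_comm]
        exact mul_le_mul (hB y hy') (hxy.trans hn) (abs_nonneg _) hB0
    -- If one point lies outside the larger ball, its cut-off vanishes, and the cut-off at the other
    -- point is at most the distance of the two norms; only the bound `B` is needed.
    · have h0 : cutoff R ‖y‖ = 0 := cutoff_eq_zero (le_of_not_ge hy)
      rw [h0, zero_smul, sub_zero, norm_smul, Real.norm_eq_abs]
      rw [h0, sub_zero] at hxy
      refine le_trans ?_ hKB
      rw [mul_comm]
      exact mul_le_mul (hB x (mem_closedBall_zero_iff.2 hx)) (hxy.trans hn) (abs_nonneg _) hB0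
  · have h0 : cutoff R ‖x‖ = 0 := cutoff_eq_zero (le_of_not_ge hx)
    by_cases hy : ‖y‖ ≤ R + 1
    · rw [h0, zero_smul, zero_sub, norm_neg, norm_smul, Real.norm_eq_abs]
      rw [h0, zero_sub, abs_neg] at hxy
      refine le_trans ?_ hKB
      rw [mul_comm]
      exact mul_le_mul (hB y (mem_closedBall_zero_iff.2 hy)) (hxy.trans hn) (abs_nonneg _) hB0
    · rw [h0, cutoff_eq_zero (le_of_not_ge hy)]
      simp; positivity

theorem norm_cutoff_smul_le {g : E → E} {R B : ℝ} (hB : ∀ x ∈ closedBall 0 (R + 1), ‖g x‖ ≤ B)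
    (hB0 : 0 ≤ B) (x : E) : ‖cutoff R ‖x‖ • g x‖ ≤ B := by
  by_cases hx : ‖x‖ ≤ R + 1
  · rw [norm_smul, Real.norm_eq_abs, abs_of_nonneg (cutoff_nonneg _ _)]
    calc _ ≤ 1 * ‖g x‖ := mul_le_mul_of_nonneg_right (cutoff_le_one _ _) (norm_nonneg _)
      _ ≤ _ := by rw [one_mul]; exact hB x (mem_closedBall_zero_iff.2 hx)
  · rw [cutoff_eq_zero (le_of_not_ge hx)]; simpa using hB0

/-- Grönwall's inequality in both time directions. -/
theorem norm_le_of_norm_deriv_le {y y' : ℝ → E} {S K ε : ℝ} (hK : 0 ≤ K) (hε : 0 ≤ ε)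
    (h : ∀ t ∈ Ioo (-S) S, HasDerivAt y (y' t) t)
    (hb : ∀ t ∈ Ioo (-S) S, ‖y' t‖ ≤ K * ‖y t‖ + ε) :
    ∀ t ∈ Ioo (-S) S, ‖y t‖ ≤ gronwallBound ‖y 0‖ K ε S := by
  intro t ht
  have hmono := gronwallBound_mono (norm_nonneg (y 0)) hε hK
  rcases le_total 0 t with h0 | h0
  · have hsub : Icc 0 t ⊆ Ioo (-S) S := fun r hr => ⟨by linarith [hr.1, ht.2], by linarith [hr.2, ht.2]⟩
    have := norm_le_gronwallBound_of_norm_deriv_right_le (f := y) (f' := y') (a := 0) (b := t)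
      (δ := ‖y 0‖) (fun r hr => (h r (hsub hr)).continuousAt.continuousWithinAt)
      (fun r hr => (h r (hsub (Ico_subset_Icc_self hr))).hasDerivWithinAt) le_rfl
      (fun r hr => hb r (hsub (Ico_subset_Icc_self hr))) t ⟨h0, le_rfl⟩
    exact this.trans (hmono (by linarith [ht.2]))
  · have hsub : ∀ r ∈ Icc 0 (-t), -r ∈ Ioo (-S) S := fun r hr =>
      ⟨by linarith [hr.2, ht.1], by linarith [hr.1, ht.1, ht.2]⟩
    have hd : ∀ r ∈ Icc 0 (-t), HasDerivAt (fun r => y (-r)) (-y' (-r)) r := fun r hr => by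
      have := (h (-r) (hsub r hr)).scomp r (hasDerivAt_neg r)
      rw [neg_smul, one_smul] at this
      exact this
    have := norm_le_gronwallBound_of_norm_deriv_right_le (f := fun r => y (-r)) (f' := fun r => -y' (-r))
      (a := 0) (b := -t)
      (δ := ‖y 0‖) (K := K) (ε := ε) (fun r hr => (hd r hr).continuousAt.continuousWithinAt)
      (fun r hr => (hd r (Ico_subset_Icc_self hr)).hasDerivWithinAt) (by simp)
      (fun r hr => by rw [norm_neg]; exact hb (-r) (hsub r (Ico_subset_Icc_self hr))) (-t) ⟨by linarith, le_rfl⟩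
    simp only [neg_neg] at this
    exact this.trans (hmono (by linarith [ht.1]))

variable [CompleteSpace E]

/-- The cut off equation has a solution on every interval. -/
theorem IsLocLip.exists_cutoff_solution (hf : IsLocLip f) (hc : ∀ x, Continuous fun t => f t x)
    (y₀ : E) (R : ℝ) (hR : 0 ≤ R) {T : ℝ} (hT : 0 < T) :
    ∃ y : ℝ → E, y 0 = y₀ ∧ ContinuousOn y (Icc (-T) T) ∧
      IsSolutionOn (fun t x => cutoff R ‖x‖ • f t x) y T := by
  obtain ⟨K, hK⟩ := hf T (R + 1)
  obtain ⟨B₀, hB₀⟩ := isCompact_Icc.exists_bound_of_continuousOn (s := Icc (-T) T) (hc 0).continuousOn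
  set B := |B₀| + K * (R + 1) with hBdef
  have hB0 : 0 ≤ B := by positivity
  have hB : ∀ t ∈ Icc (-T) T, ∀ x ∈ closedBall 0 (R + 1), ‖f t x‖ ≤ B := by
    intro t ht x hx
    have h1 := (hK t ht).dist_le_mul x hx 0 (mem_closedBall_self (by positivity))
    rw [dist_eq_norm, dist_zero_right] at h1
    rw [mem_closedBall_zero_iff] at hx
    calc ‖f t x‖ = ‖f t 0 + (f t x - f t 0)‖ := by congr 1; abel
      _ ≤ ‖f t 0‖ + ‖f t x - f t 0‖ := norm_add_le _ _
      _ ≤ |B₀| + K * (R + 1) := add_le_add ((hB₀ t ht).trans (le_abs_self _))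
          (h1.trans (mul_le_mul_of_nonneg_left hx (NNReal.coe_nonneg K)))
  have h0mem : (0 : ℝ) ∈ Icc (-T) T := ⟨by linarith, hT.le⟩
  -- The cut-off field is globally Lipschitz and bounded by `B`, so a solution moves by at most `BT`
  -- on `[-T, T]`. A ball of radius `BT` around `y₀` therefore yields a solution on the whole
  -- interval at once.
  have hPL : IsPicardLindelof (fun t x => cutoff R ‖x‖ • f t x) (⟨0, h0mem⟩ : Icc (-T) T) y₀
      (B * T).toNNReal 0 B.toNNReal (K + B.toNNReal) := by
    refine ⟨fun t ht => ?_, fun x _ => ?_, fun t ht x _ => ?_, ?_⟩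
    · refine LipschitzOnWith.of_dist_le_mul fun x _ y _ => ?_
      rw [dist_eq_norm, dist_eq_norm, NNReal.coe_add, Real.coe_toNNReal _ hB0]
      exact norm_cutoff_smul_sub_le (hK t ht) (hB t ht) hB0 x y
    · exact ((hc x).const_smul _).continuousOn
    · rw [Real.coe_toNNReal _ hB0]
      exact norm_cutoff_smul_le (hB t ht) hB0 x
    · rw [Real.coe_toNNReal _ hB0, Real.coe_toNNReal _ (by positivity)]
      simp
  obtain ⟨y, hy0, hy⟩ := hPL.exists_eq_forall_mem_Icc_hasDerivWithinAt₀
  refine ⟨y, hy0, fun t ht => (hy t ht).continuousWithinAt, fun t ht => ?_⟩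
  exact (hy t (Ioo_subset_Icc_self ht)).hasDerivAt (Icc_mem_nhds ht.1 ht.2)

/-- Global existence from an a priori bound. -/
theorem IsLocLip.exists_solutionOn (hf : IsLocLip f) (hc : ∀ x, Continuous fun t => f t x)
    (y₀ : E) {T M : ℝ} (hT : 0 < T)
    (hM : ∀ S, 0 < S → S ≤ T → ∀ y : ℝ → E, y 0 = y₀ → IsSolutionOn f y S →
      ∀ t ∈ Ioo (-S) S, ‖y t‖ ≤ M) :
    ∃ y : ℝ → E, y 0 = y₀ ∧ IsSolutionOn f y T := by
  -- The cut-off radius lies strictly above the a priori bound and the initial norm; the gap gives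
  -- the contradiction in the continuity argument.
  set R := max M ‖y₀‖ + 1 with hRdef
  have hMR : M < R := by have := le_max_left M ‖y₀‖; linarith
  have hyR : ‖y₀‖ < R := by have := le_max_right M ‖y₀‖; linarith
  have hR0 : 0 ≤ R := (norm_nonneg _).trans hyR.le
  obtain ⟨y, hy0, hyc, hy⟩ := hf.exists_cutoff_solution hc y₀ R hR0 hT
  have htrue : ∀ S ≤ T, (∀ t ∈ Ioo (-S) S, ‖y t‖ ≤ R) → IsSolutionOn f y S := by
    intro S hS hb t ht
    have := hy t ⟨by linarith [ht.1], by linarith [ht.2]⟩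
    dsimp only at this
    rwa [cutoff_eq_one (hb t ht), one_smul] at this
  have hlt : ∀ s ∈ Icc 0 T, ‖y s‖ < R ∧ ‖y (-s)‖ < R := by
    by_contra hcon
    push Not at hcon
    set φ : ℝ → ℝ := fun s => max ‖y s‖ ‖y (-s)‖ with hφ
    have hφc : ContinuousOn φ (Icc 0 T) := by
      refine ContinuousOn.sup ?_ ?_
      · exact (hyc.mono (Icc_subset_Icc (by linarith) le_rfl)).norm
      · refine (hyc.comp continuousOn_neg fun s hs => ?_).norm
        exact ⟨by linarith [hs.2], by linarith [hs.1]⟩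
    set A := {s ∈ Icc (0 : ℝ) T | R ≤ φ s} with hA
    have hAne : A.Nonempty := by
      obtain ⟨s, hs, h⟩ := hcon
      refine ⟨s, hs, ?_⟩
      by_cases h1 : ‖y s‖ < R
      · exact (h h1).trans (le_max_right _ _)
      · exact (not_lt.1 h1).trans (le_max_left _ _)
    have hAcl : IsClosed A := by
      have := hφc.preimage_isClosed_of_isClosed isClosed_Icc (isClosed_Ici (a := R))
      exact this
    have hAbdd : BddBelow A := ⟨0, fun s hs => hs.1.1⟩
    -- The first time at which the solution reaches norm `R` in either time direction. Before it the
    -- cut-off is inactive, so the true equation holds and the a priori bound gives `φ ≤ M` on `[0,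
    -- s)`. By continuity `φ s ≤ M < R`, which is absurd.
    set s := sInf A with hs
    have hsA : s ∈ A := hAcl.csInf_mem hAne hAbdd
    have hs0 : 0 < s := by
      rcases eq_or_lt_of_le hsA.1.1 with h | h
      · have h2 := hsA.2
        rw [← h] at h2
        simp only [hφ, neg_zero, hy0, max_self] at h2
        linarith
      · exact h
    have hlow : ∀ r, 0 ≤ r → r < s → φ r < R := by
      intro r hr hrs
      by_contra hge
      have : r ∈ A := ⟨⟨hr, hrs.le.trans hsA.1.2⟩, not_lt.1 hge⟩
      exact absurd (csInf_le hAbdd this) (not_le.2 hrs)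
    have hbR : ∀ t ∈ Ioo (-s) s, ‖y t‖ ≤ R := by
      intro t ht
      rcases le_total 0 t with h | h
      · exact ((le_max_left _ _).trans_lt (hlow t h ht.2)).le
      · have := hlow (-t) (by linarith) (by linarith [ht.1])
        simp only [hφ, neg_neg] at this
        exact ((le_max_right _ _).trans_lt this).le
    have hbM := hM s hs0 hsA.1.2 y hy0 (htrue s hsA.1.2 hbR)
    have hφM : ∀ r ∈ Ico 0 s, φ r ≤ M := fun r hr =>
      max_le (hbM r ⟨by linarith [hr.1], hr.2⟩) (hbM (-r) ⟨by linarith [hr.2], by linarith [hr.1]⟩)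
    have hφs : φ s ≤ M := by
      have hcw : ContinuousWithinAt φ (Ico 0 s) s :=
        (hφc s hsA.1).mono fun r hr => ⟨hr.1, hr.2.le.trans hsA.1.2⟩
      refine hcw.closure_le ?_ continuousWithinAt_const hφM
      rw [closure_Ico hs0.ne]; exact ⟨hs0.le, le_rfl⟩
    linarith [hsA.2]
  refine ⟨y, hy0, htrue T le_rfl fun t ht => ?_⟩
  rcases le_total 0 t with h | h
  · exact (hlt t ⟨h, ht.2.le⟩).1.le
  · have := (hlt (-t) ⟨by linarith, by linarith [ht.1]⟩).2.le
    rwa [neg_neg] at this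

/-- Global existence from an a priori bound on every bounded time interval. -/
theorem IsLocLip.exists_global (hf : IsLocLip f) (hc : ∀ x, Continuous fun t => f t x)
    (y₀ : E)
    (hM : ∀ T, ∃ M, ∀ S, 0 < S → S ≤ T → ∀ y : ℝ → E, y 0 = y₀ → IsSolutionOn f y S →
      ∀ t ∈ Ioo (-S) S, ‖y t‖ ≤ M) :
    ∃ y : ℝ → E, y 0 = y₀ ∧ ∀ t, HasDerivAt y (f t (y t)) t := by
  have h1 : ∀ T : ℝ, 0 < T → ∃ y : ℝ → E, y 0 = y₀ ∧ IsSolutionOn f y T := fun T hT => by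
    obtain ⟨M, hM⟩ := hM T
    exact hf.exists_solutionOn hc y₀ hT hM
  choose! Y hY0 hY using h1
  have hagree : ∀ S T t, |t| < S → S ≤ T → Y T t = Y S t := by
    intro S T t ht hST
    have hS : 0 < S := (abs_nonneg t).trans_lt ht
    have h2 : IsSolutionOn f (Y T) S := fun r hr =>
      hY T (hS.trans_le hST) r ⟨by linarith [hr.1], by linarith [hr.2]⟩
    exact hf.unique h2 (hY S hS) ((hY0 T (hS.trans_le hST)).trans (hY0 S hS).symm) (abs_lt.1 ht)
  -- The interval used at time `s` depends on `s`. Near `t` all these solutions agree with the one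
  -- on `(-(|t| + 2), |t| + 2)`, which gives the derivative.
  refine ⟨fun t => Y (|t| + 1) t, by simpa using hY0 1 one_pos, fun t => ?_⟩
  have hpos : 0 < |t| + 2 := by positivity
  have h3 := hY (|t| + 2) hpos t (abs_lt.1 (by linarith))
  have h4 : (fun s => Y (|s| + 1) s) =ᶠ[𝓝 t] Y (|t| + 2) := by
    have : ∀ᶠ s in 𝓝 t, |s| < |t| + 1 := continuous_abs.continuousAt.eventually_lt continuousAt_const (by linarith)
    filter_upwards [this] with s hs
    exact (hagree (|s| + 1) (|t| + 2) s (by linarith) (by linarith)).symm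
  have h5 : Y (|t| + 1) t = Y (|t| + 2) t := (hagree (|t| + 1) (|t| + 2) t (by linarith) (by linarith)).symm
  simp only [h5]
  exact h3.congr_of_eventuallyEq h4

end ODE

/-! ### The interaction picture -/

/-- The free group is only strongly continuous; the uniform Lipschitz bound upgrades this to joint
continuity. -/
theorem continuous_uncurry_of_lipschitzWith {E : Type*} [NormedAddCommGroup E] {T : ℝ → E → E}
    (hT : ∀ t, LipschitzWith 1 (T t)) (hc : ∀ u, Continuous fun t => T t u) :
    Continuous fun p : ℝ × E => T p.1 p.2 := by
  have h : Continuous fun p : E × ℝ => T p.2 p.1 :=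
    continuous_prod_of_continuous_lipschitzWith (fun p : E × ℝ => T p.2 p.1) 1 hc hT
  exact h.comp continuous_swap

section Evolve
variable {m : ℕ}

/-- The free evolution of the field, with the tracers at rest. -/
def evolve (t : ℝ) (z : Phase m) : Phase m := (z.1, z.2.1, schH t z.2.2)

theorem evolve_evolve (s t : ℝ) (z : Phase m) : evolve s (evolve t z) = evolve (s + t) z := by
  simp [evolve, schH_add]

theorem evolve_zero (z : Phase m) : evolve 0 z = z := by simp [evolve, schH_zero]

theorem evolve_evolve_neg (t : ℝ) (z : Phase m) : evolve t (evolve (-t) z) = z := by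
  rw [evolve_evolve, add_neg_cancel, evolve_zero]

theorem norm_evolve (t : ℝ) (z : Phase m) : ‖evolve t z‖ = ‖z‖ := by
  simp only [evolve, Prod.norm_def, LinearIsometry.norm_map]

theorem evolve_sub (t : ℝ) (z y : Phase m) : evolve t (z - y) = evolve t z - evolve t y := by
  simp [evolve]

theorem continuous_evolve : Continuous fun p : ℝ × Phase m => evolve p.1 p.2 := by
  refine continuous_uncurry_of_lipschitzWith (T := fun t z => evolve t z) (fun t => ?_) fun z => ?_
  · refine LipschitzWith.of_dist_le_mul fun x y => ?_
    rw [dist_eq_norm, dist_eq_norm, ← evolve_sub, norm_evolve, NNReal.coe_one, one_mul]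
  · exact continuous_const.prodMk (continuous_const.prodMk (continuous_schH z.2.2))

end Evolve

section Field
variable {v w : R3 → ℝ} {K C : ℝ} {m : ℕ}

theorem continuous_nonlinearity (hv : IsKernel v K) (hw : IsTame w C) :
    Continuous (nonlinearity (m := m) hv hw) := by
  rw [continuous_iff_continuousAt]
  intro z
  obtain ⟨L, hL⟩ := nonlinearity_lipschitzOn (m := m) hv hw (‖z‖ + 1)
  refine hL.continuousOn.continuousAt (Metric.closedBall_mem_nhds_of_mem ?_)
  rw [mem_ball_zero_iff]; linarith

/-- The vector field of the mean-field equations in the interaction picture. -/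
def fieldI (hv : IsKernel v K) (hw : IsTame w C) (t : ℝ) (y : Phase m) : Phase m :=
  evolve (-t) (nonlinearity hv hw (evolve t y))

/-- The free evolution is linear and isometric, so it preserves balls and Lipschitz constants; the
constant does not depend on time. -/
theorem isLocLip_fieldI (hv : IsKernel v K) (hw : IsTame w C) : IsLocLip (fieldI (m := m) hv hw) := by
  intro T R
  obtain ⟨L, hL⟩ := nonlinearity_lipschitzOn (m := m) hv hw R
  refine ⟨L, fun t _ => LipschitzOnWith.of_dist_le_mul fun x hx y hy => ?_⟩
  rw [mem_closedBall_zero_iff] at hx hy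
  have := hL.dist_le_mul (evolve t x) (by rwa [mem_closedBall_zero_iff, norm_evolve])
    (evolve t y) (by rwa [mem_closedBall_zero_iff, norm_evolve])
  rw [dist_eq_norm, dist_eq_norm, ← evolve_sub, norm_evolve] at this
  rwa [fieldI, fieldI, dist_eq_norm, dist_eq_norm, ← evolve_sub, norm_evolve]

theorem continuous_fieldI (hv : IsKernel v K) (hw : IsTame w C) :
    Continuous fun p : ℝ × Phase m => fieldI hv hw p.1 p.2 := by
  unfold fieldI
  exact continuous_evolve.comp
    (continuous_fst.neg.prodMk ((continuous_nonlinearity hv hw).comp continuous_evolve))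

theorem hasDerivAt_clm {E F : Type*} [NormedAddCommGroup E] [NormedSpace ℝ E] [NormedAddCommGroup F]
    [NormedSpace ℝ F] (L : E →L[ℝ] F) {y : ℝ → E} {y' : E} {t : ℝ} (h : HasDerivAt y y' t) :
    HasDerivAt (fun s => L (y s)) (L y') t := L.hasFDerivAt.comp_hasDerivAt t h

theorem hasDerivAt_position {y : ℝ → Phase m} {y' : Phase m} {t : ℝ} (h : HasDerivAt y y' t) :
    HasDerivAt (fun s => (y s).1) y'.1 t := hasDerivAt_clm (ContinuousLinearMap.fst ℝ _ _) h

theorem hasDerivAt_velocity {y : ℝ → Phase m} {y' : Phase m} {t : ℝ} (h : HasDerivAt y y' t) :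
    HasDerivAt (fun s => (y s).2.1) y'.2.1 t :=
  hasDerivAt_clm ((ContinuousLinearMap.fst ℝ (Config m) H1).comp
    (ContinuousLinearMap.snd ℝ (Config m) (Config m × H1))) h

theorem hasDerivAt_boson {y : ℝ → Phase m} {y' : Phase m} {t : ℝ} (h : HasDerivAt y y' t) :
    HasDerivAt (fun s => (y s).2.2) y'.2.2 t :=
  hasDerivAt_clm ((ContinuousLinearMap.snd ℝ (Config m) H1).comp
    (ContinuousLinearMap.snd ℝ (Config m) (Config m × H1))) h

/-- The underlying function as a real linear map. -/
def fnR : H1 →L[ℝ] L2 := fnL.restrictScalars ℝ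

/-- A global solution in the interaction picture gives a mild solution. -/
theorem isMildSolution_of_hasDerivAt (hv : IsKernel v K) (hw : IsTame w C) {y : ℝ → Phase m}
    (hy : ∀ t, HasDerivAt y (fieldI hv hw t (y t)) t) :
    Continuous (fun t => evolve t (y t)) ∧ IsMildSolution v w (y 0) (fun t => evolve t (y t)) := by
  have hyc : Continuous y := continuous_iff_continuousAt.2 fun t => (hy t).continuousAt
  have hz : Continuous fun t => evolve t (y t) := continuous_evolve.comp (continuous_id.prodMk hyc)
  have hd : Continuous fun t => fieldI hv hw t (y t) :=
    (continuous_fieldI hv hw).comp (continuous_id.prodMk hyc)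
  refine ⟨hz, ⟨fun t => ?_, fun t => ?_, fun s => (interaction hv hw (y s).1 (schH s (y s).2.2)).fn,
    fun s => ?_, fun t => ?_⟩⟩
  · have := intervalIntegral.integral_eq_sub_of_hasDerivAt (a := 0) (b := t)
      (fun s _ => hasDerivAt_position (hy s)) (hd.fst.intervalIntegrable _ _)
    change (y t).1 = (y 0).1 + ∫ s in (0 : ℝ)..t, (y s).2.1
    rw [add_comm, ← sub_eq_iff_eq_add]
    exact this.symm
  · have := intervalIntegral.integral_eq_sub_of_hasDerivAt (a := 0) (b := t)
      (fun s _ => hasDerivAt_velocity (hy s)) (hd.snd.fst.intervalIntegrable _ _)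
    rw [add_comm, ← sub_eq_iff_eq_add]
    exact this.symm
  · exact (isInteraction_iff hv hw _ _ _).2 rfl
  · set F : ℝ → H1 := fun s => interaction hv hw (y s).1 (schH s (y s).2.2) with hF
    have hG : Continuous fun s => schU (-s) (F s).fn := by
      have h1 : Continuous fun s => (Complex.I • (fieldI hv hw s (y s)).2.2).fn :=
        (Complex.I • fnL).continuous.comp hd.snd.snd
      have h2 : ∀ s, (Complex.I • (fieldI hv hw s (y s)).2.2).fn = schU (-s) (F s).fn := by
        intro s
        change Complex.I • schU (-s) (-(Complex.I • (F s).fn)) = _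
        rw [map_neg, map_smul, smul_neg, smul_smul, Complex.I_mul_I, neg_one_smul, neg_neg]
      simpa only [h2] using h1
    -- The factor `exp(itΔ)` comes out of the Duhamel integral and leaves an integrand independent
    -- of `t`, to which the fundamental theorem of calculus applies.
    have e1 : ∀ s, freeSchrodinger (t - s) (F s).fn = schU t (schU (-s) (F s).fn) := by
      intro s
      rw [← schU_add, ← sub_eq_add_neg]; rfl
    have e2 : Continuous fun s => freeSchrodinger (t - s) (F s).fn := by
      simp only [e1]; exact (schU t).continuous.comp hG
    refine ⟨e2.intervalIntegrable _ _, ?_⟩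
    have h1 : ∀ s, HasDerivAt (fun s => (y s).2.2.fn) (-(Complex.I • schU (-s) (F s).fn)) s := by
      intro s
      have := hasDerivAt_clm fnR (hasDerivAt_boson (hy s))
      refine this.congr_deriv ?_
      change schU (-s) (-(Complex.I • (F s).fn)) = _
      rw [map_neg, map_smul]
    have h2 := intervalIntegral.integral_eq_sub_of_hasDerivAt (a := 0) (b := t)
      (fun s _ => h1 s) ((hG.const_smul Complex.I).neg.intervalIntegrable _ _)
    rw [intervalIntegral.integral_neg, intervalIntegral.integral_smul] at h2
    have h3 : (∫ s in (0 : ℝ)..t, freeSchrodinger (t - s) (F s).fn) =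
        schU t (∫ s in (0 : ℝ)..t, schU (-s) (F s).fn) := by
      simp only [e1]
      exact (schU t).toContinuousLinearMap.intervalIntegral_comp_comm (hG.intervalIntegrable _ _)
    change schU t (y t).2.2.fn = schU t (y 0).2.2.fn - Complex.I • ∫ s in (0 : ℝ)..t, freeSchrodinger (t - s) (F s).fn
    rw [h3, ← map_smul, ← map_sub]
    congr 1
    rw [sub_eq_add_neg, h2]; abel

/-- A continuous mild solution is a solution in the interaction picture. -/
theorem hasDerivAt_of_isMildSolution (hv : IsKernel v K) (hw : IsTame w C) {z₀ : Phase m}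
    {z : ℝ → Phase m} (hz : Continuous z) (h : IsMildSolution v w z₀ z) :
    evolve (-0) (z 0) = z₀ ∧ ∀ t, HasDerivAt (fun t => evolve (-t) (z t))
      (fieldI hv hw t (evolve (-t) (z t))) t := by
  have hN : Continuous fun t => evolve (-t) (nonlinearity hv hw (z t)) :=
    continuous_evolve.comp (continuous_neg.prodMk ((continuous_nonlinearity hv hw).comp hz))
  have hX : ∀ t, (z t).1 = z₀.1 + ∫ s in (0 : ℝ)..t, (evolve (-s) (nonlinearity hv hw (z s))).1 := h.position
  have hV : ∀ t, (z t).2.1 = z₀.2.1 + ∫ s in (0 : ℝ)..t, (evolve (-s) (nonlinearity hv hw (z s))).2.1 := h.velocity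
  have hψ : ∀ t, schH (-t) (z t).2.2 = z₀.2.2 +
      ∫ s in (0 : ℝ)..t, (evolve (-s) (nonlinearity hv hw (z s))).2.2 := by
    intro t
    obtain ⟨F, hF, hint⟩ := h.field
    have hFeq : ∀ s, F s = (interaction hv hw (z s).1 (z s).2.2).fn := fun s =>
      (isInteraction_iff hv hw _ _ _).1 (hF s)
    -- Duhamel's formula is an identity in `L²`. The integrand is continuous in `H¹`, because the
    -- nonlinearity is, so the formula lifts to an `H¹` integral; this is what makes differentiation
    -- in `H¹` possible.
    refine H1.ext ?_
    have h1 : (∫ s in (0 : ℝ)..t, (evolve (-s) (nonlinearity hv hw (z s))).2.2).fn =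
        ∫ s in (0 : ℝ)..t, (evolve (-s) (nonlinearity hv hw (z s))).2.2.fn :=
      (fnR.intervalIntegral_comp_comm (hN.snd.snd.intervalIntegrable _ _)).symm
    have h2 : ∀ s, (evolve (-s) (nonlinearity hv hw (z s))).2.2.fn =
        -(Complex.I • schU (-t) (freeSchrodinger (t - s) (F s))) := by
      intro s
      rw [← schU_apply, ← schU_add, hFeq, show -t + (t - s) = -s by ring]
      change schU (-s) (-(Complex.I • (interaction hv hw (z s).1 (z s).2.2).fn)) = _
      rw [map_neg, map_smul]
    rw [schH_fn, H1.fn_add, h1, (hint t).2, map_sub, map_smul]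
    simp only [h2]
    rw [intervalIntegral.integral_neg, intervalIntegral.integral_smul, ← schU_apply, ← schU_add,
      neg_add_cancel, schU_zero, sub_eq_add_neg]
    congr 3
    exact ((schU (-t)).toContinuousLinearMap.intervalIntegral_comp_comm (hint t).1).symm
  have hint : ∀ t, evolve (-t) (z t) = z₀ + ∫ s in (0 : ℝ)..t, evolve (-s) (nonlinearity hv hw (z s)) := by
    intro t
    have hi := hN.intervalIntegrable 0 t (μ := volume)
    refine Prod.ext ?_ (Prod.ext ?_ ?_)
    · refine (hX t).trans ?_
      rw [Prod.fst_add]; congr 1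
      exact (ContinuousLinearMap.fst ℝ (Config m) (Config m × H1)).intervalIntegral_comp_comm hi
    · refine (hV t).trans ?_
      rw [Prod.snd_add, Prod.fst_add]; congr 1
      exact ((ContinuousLinearMap.fst ℝ (Config m) H1).comp
        (ContinuousLinearMap.snd ℝ (Config m) (Config m × H1))).intervalIntegral_comp_comm hi
    · refine (hψ t).trans ?_
      rw [Prod.snd_add, Prod.snd_add]; congr 1
      exact ((ContinuousLinearMap.snd ℝ (Config m) H1).comp
        (ContinuousLinearMap.snd ℝ (Config m) (Config m × H1))).intervalIntegral_comp_comm hi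
  constructor
  · have := hint 0
    simpa using this
  · intro t
    have h1 := (hN.integral_hasStrictDerivAt 0 t).hasDerivAt.const_add z₀
    rw [fieldI, evolve_evolve_neg]
    refine h1.congr_of_eventuallyEq (Eventually.of_forall fun s => ?_)
    exact hint s

end Field

/-! ### The weak derivative of the free group on `H¹` -/

theorem schrodingerSymbol_eq_exp (t : ℝ) (ξ : R3) :
    schrodingerSymbol t ξ =
      Complex.exp ((t * (-(2 * Real.pi * ‖ξ‖) ^ 2) : ℝ) * Complex.I) := by
  rw [schrodingerSymbol]; congr 1; push_cast; ring

theorem fourier_schU_exp (f : L2) (t : ℝ) : (𝓕 (schU t f) : L2) =ᵐ[volume]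
    fun ξ => Complex.exp ((t * (-(2 * Real.pi * ‖ξ‖) ^ 2) : ℝ) * Complex.I) * (𝓕 f : L2) ξ := by
  filter_upwards [fourier_schU t f] with ξ h
  rw [h, schrodingerSymbol_eq_exp]

theorem norm_sq_eq_sum (ξ : R3) : ‖ξ‖ ^ 2 = ∑ j, ξ j ^ 2 := by
  rw [EuclideanSpace.norm_sq_eq]; simp

theorem sum_conj_partialSymbol (ξ : R3) (a b : ℂ) :
    ∑ j, conj (partialSymbol j ξ * a) * (partialSymbol j ξ * b) =
      (((2 * Real.pi * ‖ξ‖) ^ 2 : ℝ) : ℂ) * (conj a * b) := by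
  have h : (((2 * Real.pi * ‖ξ‖) ^ 2 : ℝ) : ℂ) = ∑ j, (2 * Real.pi) ^ 2 * ((ξ j : ℝ) : ℂ) ^ 2 := by
    rw [mul_pow, norm_sq_eq_sum, Finset.mul_sum]; push_cast; rfl
  rw [h, Finset.sum_mul]
  refine Finset.sum_congr rfl fun j _ => ?_
  simp only [partialSymbol, map_mul, Complex.conj_I, Complex.conj_ofReal, map_ofNat]
  linear_combination (-(4 * Real.pi ^ 2 * ((ξ j : ℝ) : ℂ) ^ 2 * conj a * b)) * Complex.I_sq

theorem sum_norm_partialSymbol (ξ : R3) (a b : ℂ) :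
    ∑ j, ‖partialSymbol j ξ * a‖ * ‖partialSymbol j ξ * b‖ =
      (2 * Real.pi * ‖ξ‖) ^ 2 * ‖conj a * b‖ := by
  rw [mul_pow, norm_sq_eq_sum, Finset.mul_sum, Finset.sum_mul]
  refine Finset.sum_congr rfl fun j _ => ?_
  have : ‖partialSymbol j ξ‖ ^ 2 = (2 * Real.pi) ^ 2 * ξ j ^ 2 := by
    simp only [partialSymbol, norm_mul, Complex.norm_real, Complex.norm_I, mul_pow, Real.norm_eq_abs,
      sq_abs]
    simp
  rw [norm_mul, norm_mul, norm_mul, RCLike.norm_conj, ← this]; ring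

theorem norm_fourier (f : L2) : ‖(𝓕 f : L2)‖ = ‖f‖ := (Lp.fourierTransformₗᵢ R3 ℂ).norm_map f

theorem inner_slope_schU (g u : H1) (h : ℝ) :
    inner ℂ g.fn (slope (fun s => schU s u.fn) 0 h) =
      ∫ ξ, (((h⁻¹ : ℝ) : ℂ) * (Complex.exp ((h * (-(2 * Real.pi * ‖ξ‖) ^ 2) : ℝ) * Complex.I) - 1)) *
        (conj ((𝓕 g.fn : L2) ξ) * (𝓕 u.fn : L2) ξ) := by
  rw [← Lp.inner_fourier_eq, L2_inner_eq]
  refine integral_congr_ae ?_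
  filter_upwards [fourier_slope (fourier_schU_exp u.fn) h] with ξ h1
  rw [h1]; ring

/-- The common bound of the integrands of `inner_slope_schU`. -/
theorem ae_norm_slope_integrand_le (g u : H1) : ∀ᵐ ξ, ∀ h : ℝ,
    ‖(((h⁻¹ : ℝ) : ℂ) * (Complex.exp ((h * (-(2 * Real.pi * ‖ξ‖) ^ 2) : ℝ) * Complex.I) - 1)) *
        (conj ((𝓕 g.fn : L2) ξ) * (𝓕 u.fn : L2) ξ)‖ ≤
      ∑ j, ‖(𝓕 (g.partialDeriv j) : L2) ξ‖ * ‖(𝓕 (u.partialDeriv j) : L2) ξ‖ := by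
  filter_upwards [ae_all_iff.2 fun j => isPartial_iff.1 (g.isPartial j),
    ae_all_iff.2 fun j => isPartial_iff.1 (u.isPartial j)] with ξ h1 h2 h
  simp only [h1, h2]
  rw [sum_norm_partialSymbol, norm_mul]
  refine mul_le_mul_of_nonneg_right ((norm_exp_slope_le _ _).trans ?_) (norm_nonneg _)
  rw [abs_neg, abs_of_nonneg (by positivity)]

/-- On the Fourier side the quotient is at most `(2π|ξ|)²`. One factor `2π|ξ|` is given to `g` and
one to `u`, so the quotients are bounded uniformly in `h` as functionals on `H¹`; the 3 counts
directions. -/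
theorem norm_inner_slope_schU_le (g u : H1) (h : ℝ) :
    ‖inner ℂ g.fn (slope (fun s => schU s u.fn) 0 h)‖ ≤ 3 * (‖g‖ * ‖u‖) := by
  have hi : ∀ j, _ := fun j : Fin 3 =>
    integral_norm_mul_norm_le (𝓕 (g.partialDeriv j) : L2) (𝓕 (u.partialDeriv j) : L2)
  rw [inner_slope_schU]
  refine (norm_integral_le_of_norm_le (integrable_finsetSum _ fun j _ => (hi j).1)
    ((ae_norm_slope_integrand_le g u).mono fun ξ hξ => hξ h)).trans ?_
  rw [integral_finsetSum _ fun j _ => (hi j).1]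
  refine (Finset.sum_le_sum fun j _ => (hi j).2.trans ?_).trans (b := ∑ j : Fin 3, ‖g‖ * ‖u‖) ?_
  · rw [norm_fourier, norm_fourier]
    exact mul_le_mul (g.norm_partialDeriv_le j) (u.norm_partialDeriv_le j) (norm_nonneg _) (norm_nonneg _)
  · simp

/-- The weak form of `d/dt exp(itΔ)u = iΔu` at time zero: one derivative is moved to the test
function, so `u ∈ H¹` suffices. -/
theorem tendsto_inner_slope_schU (g u : H1) :
    Tendsto (fun h => inner ℂ g.fn (slope (fun s => schU s u.fn) 0 h)) (𝓝[≠] 0)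
      (𝓝 (-(Complex.I * ∑ j, inner ℂ (g.partialDeriv j) (u.partialDeriv j)))) := by
  have hi : ∀ j, _ := fun j : Fin 3 =>
    integral_norm_mul_norm_le (𝓕 (g.partialDeriv j) : L2) (𝓕 (u.partialDeriv j) : L2)
  have hlim : -(Complex.I * ∑ j, inner ℂ (g.partialDeriv j) (u.partialDeriv j)) =
      ∫ ξ, (((-(2 * Real.pi * ‖ξ‖) ^ 2 : ℝ) : ℂ) * Complex.I) *
        (conj ((𝓕 g.fn : L2) ξ) * (𝓕 u.fn : L2) ξ) := by
    have e : ∀ f f' : L2, inner ℂ f f' = ∫ ξ, conj ((𝓕 f : L2) ξ) * (𝓕 f' : L2) ξ := fun f f' => by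
      rw [← Lp.inner_fourier_eq, L2_inner_eq]
    simp only [e]
    rw [← integral_finsetSum _ fun j _ => integrable_conj_mul _ _, ← integral_const_mul, ← integral_neg]
    refine integral_congr_ae ?_
    filter_upwards [ae_all_iff.2 fun j => isPartial_iff.1 (g.isPartial j),
      ae_all_iff.2 fun j => isPartial_iff.1 (u.isPartial j)] with ξ h1 h2
    simp only [h1, h2]
    rw [sum_conj_partialSymbol]; push_cast; ring
  rw [hlim]
  simp_rw [inner_slope_schU]
  refine tendsto_integral_filter_of_dominated_convergence
    (fun ξ => ∑ j, ‖(𝓕 (g.partialDeriv j) : L2) ξ‖ * ‖(𝓕 (u.partialDeriv j) : L2) ξ‖)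
    (Eventually.of_forall fun h => ?_)
    (Eventually.of_forall fun h => (ae_norm_slope_integrand_le g u).mono fun ξ hξ => hξ h)
    (integrable_finsetSum _ fun j _ => (hi j).1)
    (Eventually.of_forall fun ξ => (tendsto_exp_slope _).mul_const _)
  refine AEStronglyMeasurable.mul (Continuous.aestronglyMeasurable ?_) (integrable_conj_mul _ _).1
  fun_prop

/-- The bound uniform in `h` allows the test function to vary with `h`. -/
theorem tendsto_inner_slope_schU_of_tendsto {g : ℝ → H1} {g₀ : H1}
    (hg : Tendsto g (𝓝[≠] 0) (𝓝 g₀)) (u : H1) :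
    Tendsto (fun h => inner ℂ (g h).fn (slope (fun s => schU s u.fn) 0 h)) (𝓝[≠] 0)
      (𝓝 (-(Complex.I * ∑ j, inner ℂ (g₀.partialDeriv j) (u.partialDeriv j)))) := by
  have h1 : Tendsto (fun h => inner ℂ (g h - g₀).fn (slope (fun s => schU s u.fn) 0 h)) (𝓝[≠] 0)
      (𝓝 0) := by
    refine squeeze_zero_norm (fun h => norm_inner_slope_schU_le (g h - g₀) u h) ?_
    have := ((tendsto_iff_norm_sub_tendsto_zero.1 hg).mul_const ‖u‖).const_mul 3
    simpa using this
  have h2 := (tendsto_inner_slope_schU g₀ u).add h1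
  rw [add_zero] at h2
  refine h2.congr fun h => ?_
  rw [H1.fn_sub, inner_sub_left, add_sub_cancel]

/-! ### Conservation of mass -/

theorem hasDerivAt_norm_sq {E : Type*} [NormedAddCommGroup E] [InnerProductSpace ℂ E]
    [NormedSpace ℝ E] [IsScalarTower ℝ ℂ E] {f : ℝ → E} {f' : E} {t : ℝ} (hf : HasDerivAt f f' t) :
    HasDerivAt (fun s => ‖f s‖ ^ 2) (2 * (inner ℂ (f t) f').re) t := by
  have h := hf.inner ℂ hf
  have h1 := hasDerivAt_clm Complex.reCLM h
  refine (h1.congr_deriv ?_).congr_of_eventuallyEq (Eventually.of_forall fun s => ?_)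
  · rw [Complex.reCLM_apply, Complex.add_re, ← inner_conj_symm f' (f t), Complex.conj_re]; ring
  · exact (inner_self_eq_norm_sq (𝕜 := ℂ) (f s)).symm

theorem inner_schU_neg (t : ℝ) (f g : L2) : inner ℂ f (schU (-t) g) = inner ℂ (schU t f) g := by
  rw [← (schU t).inner_map_map f, ← schU_add, add_neg_cancel, schU_zero]

theorem inner_schH_neg (t : ℝ) (f g : H1) : inner ℂ f (schH (-t) g) = inner ℂ (schH t f) g := by
  rw [← (schH t).inner_map_map f, ← schH_add, add_neg_cancel, schH_zero]

section Conservation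
variable {v w : R3 → ℝ} {K C : ℝ} {m : ℕ}

theorem inner_interaction_im (hv : IsKernel v K) (hw : IsTame w C) (X : Config m) (φ : H1) :
    (inner ℂ φ.fn (interaction hv hw X φ).fn).im = 0 := by
  rw [interaction, IsC1b.mulH_fn, inner_mulR_self (isC1b_potential hv hw X φ 0).isBddBy,
    Complex.ofReal_im]

/-- The mass is conserved. -/
theorem hasDerivAt_mass (hv : IsKernel v K) (hw : IsTame w C) {y : ℝ → Phase m} {t : ℝ}
    (hy : HasDerivAt y (fieldI hv hw t (y t)) t) :
    HasDerivAt (fun s => ‖(y s).2.2.fn‖ ^ 2) 0 t := by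
  refine (hasDerivAt_norm_sq (hasDerivAt_clm fnR (hasDerivAt_boson hy))).congr_deriv ?_
  change 2 * (inner ℂ (y t).2.2.fn (schU (-t) (-(Complex.I •
    (interaction hv hw (y t).1 (schH t (y t).2.2)).fn)))).re = 0
  -- By unitarity the free group drops out. What remains is the real part of `-i⟨φ, Vφ⟩` with a real
  -- potential `V`, which is zero.
  rw [inner_schU_neg, inner_neg_right, inner_smul_right, ← schH_fn]
  have := inner_interaction_im hv hw (y t).1 (schH t (y t).2.2)
  simpa using this

end Conservation

/-! ### The potential energy -/

section Symmetry
variable {v : R3 → ℝ} {K : ℝ}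

/-- The kernel `|v|` provides the absolute integrability needed for Fubini's theorem. -/
theorem IsKernel.abs (hv : IsKernel v K) : IsKernel (fun x => |v x|) K := by
  have hae : ∀ (x : R3) (u : H1), MemLp (fun y => ((|v (x - y)| : ℝ) : ℂ) * u.fn y) 2 volume := by
    intro x u
    refine (hv.memLp x u).of_le ?_ (Eventually.of_forall fun y => by simp)
    refine AEStronglyMeasurable.mul (Complex.continuous_ofReal.comp_aestronglyMeasurable ?_)
      (Lp.aestronglyMeasurable _)
    exact (hv.meas.comp_quasiMeasurePreserving (quasiMeasurePreserving_sub_left x)).norm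
  refine ⟨hv.meas.norm, ?_, hae, fun x u => ?_, hv.nonneg⟩
  · filter_upwards [hv.even] with x hx
    rw [hx]
  · refine le_of_eq_of_le (norm_eq_of_ae_norm_eq ?_) (hv.norm_le x u)
    filter_upwards [mulL2_coe_of_memLp (hae x u), mulL2_coe_of_memLp (hv.memLp x u)] with y h1 h2
    simp only [mulR, h1, h2]; simp

theorem IsKernel.integrable_prod (hv : IsKernel v K) (f g : H1) :
    Integrable (fun p : R3 × R3 => ‖f.fn p.1‖ ^ 2 * (v (p.1 - p.2) * ‖g.fn p.2‖ ^ 2))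
      (volume.prod volume) := by
  have h1 : AEStronglyMeasurable (fun p : R3 × R3 => v (p.1 - p.2)) (volume.prod volume) :=
    hv.meas.comp_quasiMeasurePreserving (quasiMeasurePreserving_sub volume volume)
  have hm : AEStronglyMeasurable
      (fun p : R3 × R3 => ‖f.fn p.1‖ ^ 2 * (v (p.1 - p.2) * ‖g.fn p.2‖ ^ 2)) (volume.prod volume) :=
    ((integrable_norm_sq f.fn).1.comp_fst).mul (h1.mul (integrable_norm_sq g.fn).1.comp_snd)
  have hsq : ∀ (u : H1) y, (conj (u.fn y) * u.fn y).re = ‖u.fn y‖ ^ 2 := fun u y => by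
    rw [mul_comm, Complex.mul_conj', ← Complex.ofReal_pow, Complex.ofReal_re]
  rw [integrable_prod_iff hm]
  constructor
  · refine Eventually.of_forall fun x => ?_
    have := (hv.integrable_mul_re g.fn g x).const_mul (‖f.fn x‖ ^ 2)
    simpa only [hsq] using this
  · have h2 : ∀ x, ∫ y, ‖‖f.fn x‖ ^ 2 * (v (x - y) * ‖g.fn y‖ ^ 2)‖ =
        pairB (fun x => |v x|) g.fn g.fn x * ‖f.fn x‖ ^ 2 := by
      intro x
      rw [hv.abs.pairB_eq, mul_comm, ← integral_const_mul]
      congr 1; ext y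
      rw [hsq, norm_mul, norm_mul]; simp
    simp only [h2]
    exact integrable_bdd_mul_norm_sq (hv.abs.aestronglyMeasurable_pairB _ _)
      (fun x => hv.abs.abs_pairB_le g.fn g x) _

/-- The interaction energy of two densities is symmetric. -/
theorem IsKernel.integral_pairB_comm (hv : IsKernel v K) (f g : H1) :
    ∫ x, pairB v g.fn g.fn x * ‖f.fn x‖ ^ 2 = ∫ x, pairB v f.fn f.fn x * ‖g.fn x‖ ^ 2 := by
  have h : ∀ f g : H1, ∫ x, pairB v g.fn g.fn x * ‖f.fn x‖ ^ 2 =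
      ∫ x, ∫ y, ‖f.fn x‖ ^ 2 * (v (x - y) * ‖g.fn y‖ ^ 2) := by
    intro f g
    congr 1; ext x
    rw [← hv.hartree_eq, hartree, mul_comm, ← integral_const_mul]
  -- Fubini's theorem exchanges the variables, and evenness of `v` restores the kernel.
  rw [h, h, integral_integral_swap (hv.integrable_prod f g)]
  congr 1; ext y
  refine integral_congr_ae ?_
  have := (quasiMeasurePreserving_sub_left y).ae hv.even
  filter_upwards [this] with x hx
  rw [← hx, neg_sub]; ring

end Symmetry

/-- This is `Re((f + g)‾ (f - g)) = |f|² - |g|²`, multiplied by the real function `a` and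
integrated. -/
theorem re_inner_mulR_add_sub {a : R3 → ℝ} {A : ℝ} (ha : IsBddBy (fun x => (a x : ℂ)) A) (f g : L2) :
    (inner ℂ (mulR a (f + g)) (f - g)).re = (∫ x, a x * ‖f x‖ ^ 2) - ∫ x, a x * ‖g x‖ ^ 2 := by
  have h1 := congrArg Complex.re (inner_mulR_self ha f)
  have h2 := congrArg Complex.re (inner_mulR_self ha g)
  rw [Complex.ofReal_re, inner_mulR ha] at h1 h2
  have h3 : (inner ℂ (mulR a g) f).re = (inner ℂ (mulR a f) g).re := by
    rw [← inner_mulR ha g f, ← inner_conj_symm g, Complex.conj_re]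
  rw [mulR, ha.mulL2_add, inner_add_left, inner_sub_right, inner_sub_right, ← h1, ← h2]
  simp only [Complex.add_re, Complex.sub_re]
  change _ = (inner ℂ (mulR a f) f).re - (inner ℂ (mulR a g) g).re
  simp only [mulR] at h3 ⊢
  linarith

section Energy
variable {v w : R3 → ℝ} {K C : ℝ} {m : ℕ}

/-- The energy of the tracers in the density of the field. -/
def tracerEnergy (w : R3 → ℝ) (X : Config m) (φ : L2) : ℝ := ∫ x, totalTracer w x X * ‖φ x‖ ^ 2

/-- The potential energy of the field. -/
def potentialEnergy (v w : R3 → ℝ) (X : Config m) (φ : L2) : ℝ :=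
  (∫ x, pairB v φ φ x * ‖φ x‖ ^ 2) / 2 + tracerEnergy w X φ

theorem energy_eq (hv : IsKernel v K) (z : Phase m) :
    energy v w z = ‖z.2.1‖ ^ 2 / 2 + ‖z.2.2‖ ^ 2 + potentialEnergy v w z.1 z.2.2.fn := by
  have : ∀ x, ∫ y, ‖z.2.2.fn x‖ ^ 2 * v (x - y) * ‖z.2.2.fn y‖ ^ 2 =
      pairB v z.2.2.fn z.2.2.fn x * ‖z.2.2.fn x‖ ^ 2 := by
    intro x
    rw [← hv.hartree_eq, hartree, mul_comm, ← integral_const_mul]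
    congr 1; ext y; ring
  rw [energy, potentialEnergy, tracerEnergy]
  simp only [this]
  ring

theorem IsTame.integrable_tracer (hw : IsTame w C) (X : Config m) (φ : L2) :
    Integrable (fun x => totalTracer w x X * ‖φ x‖ ^ 2) :=
  integrable_bdd_mul_norm_sq (hw.isC1b X 0).meas (hw.isC1b X 0).bound φ

theorem IsKernel.integrable_pairB (hv : IsKernel v K) (f : L2) (g : H1) (φ : L2) :
    Integrable (fun x => pairB v f g.fn x * ‖φ x‖ ^ 2) :=
  integrable_bdd_mul_norm_sq (hv.aestronglyMeasurable_pairB f g) (hv.abs_pairB_le f g) φ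

/-- The derivative of the potential energy in the mean of two fields. -/
def meanInteraction (hv : IsKernel v K) (hw : IsTame w C) (X : Config m) (φ χ : H1) : H1 :=
  interaction hv hw X φ + interaction hv hw X χ -
    (1 / 2 : ℂ) • ((isC1b_potential hv hw X φ).mulH (φ - χ) - (isC1b_potential hv hw X χ).mulH (φ - χ))

/-- Let `V_φ` and `V_χ` be the Hartree potentials. As `∫ V_χ|φ|² = ∫ V_φ|χ|²`, the Hartree energies
differ by `½ ∫ (V_φ + V_χ)(|φ|² - |χ|²)`. The formula is exact, so no differentiability of `φ` in
time is used. `meanInteraction` equals half the sum of the two total potentials times `φ + χ`; its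
definition is arranged so that the limit `φ → χ` is visible. -/
theorem potentialEnergy_sub (hv : IsKernel v K) (hw : IsTame w C) (X : Config m) (φ χ : H1) :
    potentialEnergy v w X φ.fn - potentialEnergy v w X χ.fn =
      (inner ℂ (meanInteraction hv hw X φ χ).fn (φ.fn - χ.fn)).re := by
  have e : meanInteraction hv hw X φ χ = (1 / 2 : ℂ) • ((isC1b_potential hv hw X φ).mulH (φ + χ) +
      (isC1b_potential hv hw X χ).mulH (φ + χ)) := by
    rw [meanInteraction, interaction, interaction]
    simp only [IsC1b.mulH_add, IsC1b.mulH_sub]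
    module
  have key : ∀ η : H1, (inner ℂ ((isC1b_potential hv hw X η).mulH (φ + χ)).fn (φ.fn - χ.fn)).re =
      (∫ x, pairB v η.fn η.fn x * ‖φ.fn x‖ ^ 2) - (∫ x, pairB v η.fn η.fn x * ‖χ.fn x‖ ^ 2)
        + (tracerEnergy w X φ.fn - tracerEnergy w X χ.fn) := by
    intro η
    rw [IsC1b.mulH_fn, H1.fn_add, re_inner_mulR_add_sub (isC1b_potential hv hw X η 0).isBddBy]
    simp only [add_mul]
    rw [integral_add (hv.integrable_pairB _ _ _) (hw.integrable_tracer _ _),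
      integral_add (hv.integrable_pairB _ _ _) (hw.integrable_tracer _ _), tracerEnergy, tracerEnergy]
    ring
  rw [e, H1.fn_smul, inner_smul_left, H1.fn_add, inner_add_left]
  have h2 : conj (1 / 2 : ℂ) = ((1 / 2 : ℝ) : ℂ) := by
    rw [← Complex.conj_ofReal]; norm_num
  rw [h2, Complex.re_ofReal_mul, Complex.add_re, key, key, hv.integral_pairB_comm χ φ,
    potentialEnergy, potentialEnergy]
  ring

theorem tendsto_meanInteraction (hv : IsKernel v K) (hw : IsTame w C) (X : Config m) {φ : ℝ → H1}
    {χ : H1} {l : Filter ℝ} (hφ : Tendsto φ l (𝓝 χ)) :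
    Tendsto (fun h => meanInteraction hv hw X (φ h) χ) l
      (𝓝 ((2 : ℂ) • interaction hv hw X χ)) := by
  have hn := hφ.norm
  have hd : Tendsto (fun h => ‖φ h - χ‖) l (𝓝 0) := tendsto_iff_norm_sub_tendsto_zero.1 hφ
  have h0 : Tendsto (fun h => interaction hv hw X (φ h)) l (𝓝 (interaction hv hw X χ)) := by
    rw [tendsto_iff_norm_sub_tendsto_zero]
    refine squeeze_zero (fun _ => norm_nonneg _)
      (fun h => norm_interaction_sub_le hv hw X X (φ h) χ) ?_
    have h1 := (((hn.const_mul (2 * K)).mul hn).add_const (m * C)).const_mul 4 |>.mul hd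
    have h2 := ((((hd.const_mul (2 * K)).mul (hφ.add_const χ).norm).add_const
      (m * (C * ‖X - X‖))).const_mul 4).mul_const ‖χ‖
    have := h1.add h2
    simpa using this
  have h1 : Tendsto (fun h => (isC1b_potential hv hw X (φ h)).mulH (φ h - χ)) l (𝓝 0) := by
    refine squeeze_zero_norm (fun h => IsC1b.norm_mulH_le _ _) ?_
    have := (((hn.const_mul (2 * K)).mul hn).add_const (m * C)).const_mul 4 |>.mul hd
    simpa using this
  have h2 : Tendsto (fun h => (isC1b_potential hv hw X χ).mulH (φ h - χ)) l (𝓝 0) := by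
    refine squeeze_zero_norm (fun h => IsC1b.norm_mulH_le _ _) ?_
    simpa using hd.const_mul (4 * (2 * K * ‖χ‖ * ‖χ‖ + m * C))
  have := (h0.add_const (interaction hv hw X χ)).sub ((h1.sub h2).const_smul (1 / 2 : ℂ))
  rw [sub_zero, smul_zero, sub_zero, ← two_smul ℂ] at this
  exact this

theorem hasDerivAt_tracerEnergy_config (hw : IsTame w C) (φ : L2) {X : ℝ → Config m} {V : Config m}
    {t : ℝ} (hX : HasDerivAt X V t) :
    HasDerivAt (fun s => tracerEnergy w (X s) φ) (-inner ℝ V (acceleration w (X t) φ)) t := by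
  have h1 : HasFDerivAt (fun Y : Config m => tracerEnergy w Y φ)
      (∫ x, ‖φ x‖ ^ 2 • tracerDeriv w (X t) x) (X t) := by
    refine hasFDerivAt_integral_of_dominated_of_fderiv_le (s := Set.univ)
      (bound := fun x => m * C * ‖φ x‖ ^ 2)
      (F' := fun Y x => ‖φ x‖ ^ 2 • tracerDeriv w Y x) univ_mem
      (Eventually.of_forall fun Y => (hw.integrable_tracer Y φ).1) (hw.integrable_tracer _ φ) ?_
      (Eventually.of_forall fun x Y _ => ?_) ((integrable_norm_sq φ).const_mul _)
      (Eventually.of_forall fun x Y _ => ?_)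
    · refine (integrable_norm_sq φ).1.smul (Continuous.aestronglyMeasurable ?_)
      have := hw.continuous_fderiv
      unfold tracerDeriv
      refine (continuous_finsetSum _ fun l _ => ?_).neg
      exact ((by fun_prop : Continuous fun x : R3 => fderiv ℝ w (x - (X t).particle l))).clm_comp
        continuous_const
    · rw [norm_smul, mul_comm]
      refine mul_le_mul (hw.norm_tracerDeriv_le Y x) ?_ (norm_nonneg _)
        (mul_nonneg (Nat.cast_nonneg _) hw.nonneg)
      simp
    · have := (hw.hasFDerivAt_config Y x).const_mul (‖φ x‖ ^ 2)
      simpa only [mul_comm] using this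
  refine (h1.comp_hasDerivAt t hX).congr_deriv ?_
  rw [acceleration, inner_neg_right, neg_neg, ← integral_inner (hw.integrable_acceleration _ _)]
  rw [ContinuousLinearMap.integral_apply]
  · congr 1; ext x
    rw [inner_smul_right, hw.gradient_eq, real_inner_comm, InnerProductSpace.toDual_symm_apply]
    rfl
  · refine (integrable_norm_sq φ).smul_bdd (m * C) (Continuous.aestronglyMeasurable ?_)
      (Eventually.of_forall fun x => hw.norm_tracerDeriv_le _ x)
    have := hw.continuous_fderiv
    unfold tracerDeriv
    refine (continuous_finsetSum _ fun l _ => ?_).neg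
    exact ((by fun_prop : Continuous fun x : R3 => fderiv ℝ w (x - (X t).particle l))).clm_comp
      continuous_const

/-- A mixed difference, bounded by the product of the increments of the configuration and of the
field. It makes the cross term negligible when both move. -/
theorem IsTame.abs_tracerEnergy_sub_le (hw : IsTame w C) (X Y : Config m) (φ χ : L2) :
    |(tracerEnergy w X φ - tracerEnergy w Y φ) - (tracerEnergy w X χ - tracerEnergy w Y χ)| ≤
      m * (C * ‖X - Y‖) * (‖φ - χ‖ * (‖φ‖ + ‖χ‖)) := by
  have hC := hw.nonneg
  have e : (tracerEnergy w X φ - tracerEnergy w Y φ) - (tracerEnergy w X χ - tracerEnergy w Y χ) =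
      ∫ x, (totalTracer w x X - totalTracer w x Y) * (‖φ x‖ ^ 2 - ‖χ x‖ ^ 2) := by
    simp only [tracerEnergy]
    have hd : ∀ η : L2,
        Integrable (fun x => totalTracer w x X * ‖η x‖ ^ 2 - totalTracer w x Y * ‖η x‖ ^ 2) :=
      fun η => (hw.integrable_tracer X η).sub (hw.integrable_tracer Y η)
    rw [← integral_sub (hw.integrable_tracer _ _) (hw.integrable_tracer _ _),
      ← integral_sub (hw.integrable_tracer _ _) (hw.integrable_tracer _ _),
      ← integral_sub (hd φ) (hd χ)]
    congr 1; ext x; ring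
  rw [e, ← Real.norm_eq_abs]
  have hi := ((integrable_norm_sq φ).sub (integrable_norm_sq χ)).abs
  refine (norm_integral_le_of_norm_le (hi.const_mul (m * (C * ‖X - Y‖)))
    (Eventually.of_forall fun x => ?_)).trans ?_
  · rw [norm_mul]
    exact mul_le_mul_of_nonneg_right ((hw.isC1b_sub X Y 0).bound x) (norm_nonneg _)
  · rw [integral_const_mul]
    exact mul_le_mul_of_nonneg_left (integral_abs_norm_sq_sub_le φ χ) (by positivity)

end Energy

/-! ### Conservation of energy -/

theorem tendsto_uncurry_of_lipschitzWith {E : Type*} [NormedAddCommGroup E] {T : ℝ → E → E}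
    (hT : ∀ t, LipschitzWith 1 (T t)) (hc : ∀ u, Continuous fun t => T t u) {ι : Type*}
    {l : Filter ι} {a : ι → ℝ} {a₀ : ℝ} {q : ι → E} {q₀ : E} (ha : Tendsto a l (𝓝 a₀))
    (hq : Tendsto q l (𝓝 q₀)) : Tendsto (fun n => T (a n) (q n)) l (𝓝 (T a₀ q₀)) :=
  ((continuous_uncurry_of_lipschitzWith hT hc).tendsto (a₀, q₀)).comp (ha.prodMk_nhds hq)

theorem tendsto_const_add_nhdsNE (t : ℝ) : Tendsto (fun h : ℝ => t + h) (𝓝[≠] 0) (𝓝 t) := by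
  have : Tendsto (fun h : ℝ => t + h) (𝓝 0) (𝓝 (t + 0)) := (continuous_const_add t).tendsto 0
  rw [add_zero] at this
  exact this.mono_left nhdsWithin_le_nhds

section Energy
variable {v w : R3 → ℝ} {K C : ℝ} {m : ℕ}

/-- The difference quotients of `exp(itΔ)ψ`. -/
theorem slope_schU_comp (ψ : ℝ → L2) (t h : ℝ) :
    h⁻¹ • (schU (t + h) (ψ (t + h)) - schU t (ψ t)) =
      schU (t + h) (h⁻¹ • (ψ (t + h) - ψ t)) + slope (fun s => schU s (schU t (ψ t))) 0 h := by
  have e : schU (t + h) (h⁻¹ • (ψ (t + h) - ψ t)) = h⁻¹ • schU (t + h) (ψ (t + h) - ψ t) :=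
    (schU (t + h)).toLinearMap.map_smul_of_tower h⁻¹ _
  rw [e, slope_def_module, sub_zero, ← smul_add, map_sub, schU_zero, ← schU_add, add_comm h t]
  congr 1; abel

/-- The increment of `φ = exp(itΔ)ψ` is split into that of `ψ`, whose quotients converge in `L²`,
and that of the free group, whose quotients converge only against `H¹` functions. The other factor
of the inner product is in `H¹`, so both limits exist. -/
theorem slope_potentialEnergy (hv : IsKernel v K) (hw : IsTame w C) (ψ : ℝ → H1) (X : Config m)
    (t h : ℝ) :
    h⁻¹ • (potentialEnergy v w X (schH (t + h) (ψ (t + h))).fn -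
        potentialEnergy v w X (schH t (ψ t)).fn) =
      (inner ℂ (meanInteraction hv hw X (schH (t + h) (ψ (t + h))) (schH t (ψ t))).fn
          (schU (t + h) (h⁻¹ • ((ψ (t + h)).fn - (ψ t).fn))) +
        inner ℂ (meanInteraction hv hw X (schH (t + h) (ψ (t + h))) (schH t (ψ t))).fn
          (slope (fun s => schU s (schH t (ψ t)).fn) 0 h)).re := by
  have h1 := slope_schU_comp (fun s => (ψ s).fn) t h
  have h2 : ∀ f g : L2, inner ℂ f (h⁻¹ • g) = ((h⁻¹ : ℝ) : ℂ) * inner ℂ f g := fun f g => by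
    rw [← inner_smul_right]; rfl
  rw [potentialEnergy_sub hv hw, ← inner_add_right, schH_fn t, ← h1, h2, Complex.re_ofReal_mul,
    smul_eq_mul]
  rfl

theorem tendsto_schH {ψ : ℝ → H1} {t : ℝ} (hψ : ContinuousAt ψ t) :
    Tendsto (fun h => schH (t + h) (ψ (t + h))) (𝓝[≠] 0) (𝓝 (schH t (ψ t))) :=
  tendsto_uncurry_of_lipschitzWith (T := fun t u => schH t u) (fun t => (schH t).lipschitz)
    continuous_schH (tendsto_const_add_nhdsNE t) (hψ.tendsto.comp (tendsto_const_add_nhdsNE t))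

theorem tendsto_schU_slope {ψ : ℝ → L2} {ψ' : L2} {t : ℝ} (hψ : HasDerivAt ψ ψ' t) :
    Tendsto (fun h => schU (t + h) (h⁻¹ • (ψ (t + h) - ψ t))) (𝓝[≠] 0) (𝓝 (schU t ψ')) :=
  tendsto_uncurry_of_lipschitzWith (T := fun t u => schU t u) (fun t => (schU t).lipschitz)
    continuous_schU (tendsto_const_add_nhdsNE t) (hasDerivAt_iff_tendsto_slope_zero.1 hψ)

theorem tendsto_fn {ι : Type*} {l : Filter ι} {g : ι → H1} {g₀ : H1} (hg : Tendsto g l (𝓝 g₀)) :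
    Tendsto (fun n => (g n).fn) l (𝓝 g₀.fn) := (fnL.continuous.tendsto g₀).comp hg

theorem tendsto_re_inner_slope {G : ℝ → H1} {F : H1} {q : ℝ → L2} {q₀ : L2}
    (hG : Tendsto G (𝓝[≠] 0) (𝓝 ((2 : ℂ) • F))) (hq : Tendsto q (𝓝[≠] 0) (𝓝 q₀)) (u : H1) :
    Tendsto (fun h => (inner ℂ (G h).fn (q h) +
        inner ℂ (G h).fn (slope (fun s => schU s u.fn) 0 h)).re) (𝓝[≠] 0)
      (𝓝 (2 * (inner ℂ F.fn q₀ -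
        Complex.I * ∑ j, inner ℂ (F.partialDeriv j) (u.partialDeriv j)).re)) := by
  have h1 := Tendsto.inner (𝕜 := ℂ) (tendsto_fn hG) hq
  have h2 := tendsto_inner_slope_schU_of_tendsto hG u
  have h3 := (Complex.continuous_re.tendsto _).comp (h1.add h2)
  have e : (inner ℂ ((2 : ℂ) • F).fn q₀ +
      -(Complex.I * ∑ j, inner ℂ (((2 : ℂ) • F).partialDeriv j) (u.partialDeriv j))).re =
      2 * (inner ℂ F.fn q₀ -
        Complex.I * ∑ j, inner ℂ (F.partialDeriv j) (u.partialDeriv j)).re := by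
    simp only [H1.fn_smul, H1.partialDeriv_smul, inner_smul_left, ← Finset.mul_sum]
    have : conj (2 : ℂ) = ((2 : ℝ) : ℂ) := by rw [← Complex.conj_ofReal]; norm_num
    rw [this, ← Complex.re_ofReal_mul]
    congr 1; ring
  rw [e] at h3
  exact h3

theorem hasDerivAt_potentialEnergy (hv : IsKernel v K) (hw : IsTame w C) {ψ : ℝ → H1} {ψ' : H1}
    (X : Config m) {t : ℝ} (hψ : HasDerivAt ψ ψ' t) :
    HasDerivAt (fun s => potentialEnergy v w X (schH s (ψ s)).fn)
      (2 * (inner ℂ (interaction hv hw X (schH t (ψ t))).fn (schU t ψ'.fn) -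
        Complex.I * ∑ j, inner ℂ ((interaction hv hw X (schH t (ψ t))).partialDeriv j)
          ((schH t (ψ t)).partialDeriv j)).re) t := by
  rw [hasDerivAt_iff_tendsto_slope_zero]
  simp only [slope_potentialEnergy hv hw ψ X t]
  have h1 : HasDerivAt (fun s => (ψ s).fn) ψ'.fn t := hasDerivAt_clm fnR hψ
  exact tendsto_re_inner_slope (tendsto_meanInteraction hv hw X (tendsto_schH hψ.continuousAt))
    (tendsto_schU_slope h1) _

/-- The field is merely continuous in time. Replacing `φ_s` by `φ_t` costs the mixed difference,
which is `o(s - t)`, and then only the configuration moves. -/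
theorem hasDerivAt_tracerEnergy_sub (hw : IsTame w C) {X : ℝ → Config m} {V : Config m} {φ : ℝ → L2}
    {t : ℝ} (hX : HasDerivAt X V t) (hφ : ContinuousAt φ t) :
    HasDerivAt (fun s => tracerEnergy w (X s) (φ s) - tracerEnergy w (X t) (φ s))
      (-inner ℝ V (acceleration w (X t) (φ t))) t := by
  set e : ℝ → ℝ := fun s => (tracerEnergy w (X s) (φ s) - tracerEnergy w (X t) (φ s)) -
    (tracerEnergy w (X s) (φ t) - tracerEnergy w (X t) (φ t)) with he
  have h0 : HasDerivAt e 0 t := by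
    rw [hasDerivAt_iff_tendsto_slope_zero]
    have ht := tendsto_const_add_nhdsNE t
    have h1 : Tendsto (fun h => φ (t + h)) (𝓝[≠] 0) (𝓝 (φ t)) := hφ.tendsto.comp ht
    have h2 := hasDerivAt_iff_tendsto_slope_zero.1 hX
    have h3 := ((h2.norm.const_mul C).const_mul (m : ℝ)).mul
      ((tendsto_iff_norm_sub_tendsto_zero.1 h1).mul (h1.norm.add_const ‖φ t‖))
    rw [zero_mul, mul_zero] at h3
    refine squeeze_zero_norm (fun h => ?_) h3
    have h4 : e t = 0 := by simp [he]
    rw [h4, sub_zero, norm_smul, norm_smul, Real.norm_eq_abs (e _)]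
    have h5 := mul_le_mul_of_nonneg_left (hw.abs_tracerEnergy_sub_le (X (t + h)) (X t) (φ (t + h)) (φ t))
      (norm_nonneg h⁻¹)
    refine h5.trans_eq ?_
    ring
  have h1 := (hasDerivAt_tracerEnergy_config hw (φ t) hX).sub_const (tracerEnergy w (X t) (φ t))
  have h2 := h1.add h0
  rw [add_zero] at h2
  refine h2.congr_of_eventuallyEq (Eventually.of_forall fun s => ?_)
  simp [he]

/-- The energy is conserved. -/
theorem hasDerivAt_energy (hv : IsKernel v K) (hw : IsTame w C) {y : ℝ → Phase m} {t : ℝ}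
    (hy : HasDerivAt y (fieldI hv hw t (y t)) t) :
    HasDerivAt (fun s => energy v w (evolve s (y s))) 0 t := by
  set φ : H1 := schH t (y t).2.2 with hφ
  set F : H1 := interaction hv hw (y t).1 φ with hF
  have hX : HasDerivAt (fun s => (y s).1) (y t).2.1 t := hasDerivAt_position hy
  have hV : HasDerivAt (fun s => (y s).2.1) (acceleration w (y t).1 φ.fn) t := hasDerivAt_velocity hy
  have hψ : HasDerivAt (fun s => (y s).2.2) (schH (-t) (-(Complex.I • F))) t := hasDerivAt_boson hy
  have hcont : ContinuousAt (fun s => (schH s (y s).2.2).fn) t := by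
    have : ContinuousAt (fun s => schH s (y s).2.2) t :=
      tendsto_uncurry_of_lipschitzWith (T := fun t u => schH t u) (fun t => (schH t).lipschitz)
        continuous_schH tendsto_id hψ.continuousAt.tendsto
    exact (fnL.continuous.tendsto _).comp this
  -- The energy is the sum of four functions of time: the kinetic energy of the tracers, the `H¹`
  -- norm of `ψ`, the potential energy with the tracers frozen at time `t`, and the change of tracer
  -- energy due to their motion.
  have h1 := hV.norm_sq.div_const 2
  have h2 := hasDerivAt_norm_sq hψ
  have h3 := hasDerivAt_potentialEnergy hv hw (y t).1 hψ
  have h4 := hasDerivAt_tracerEnergy_sub hw hX hcont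
  have h5 := ((h1.add h2).add h3).add h4
  refine (h5.congr_deriv ?_).congr_of_eventuallyEq (Eventually.of_forall fun s => ?_)
  -- With `F` the interaction term, the `H¹` norm contributes `2 Im ∑ⱼ⟨∂ⱼφ, ∂ⱼF⟩`, since `⟨φ, F⟩` is
  -- real. The frozen potential energy contributes the same with the arguments exchanged, hence the
  -- opposite sign, since `⟨F, F⟩` is real. The kinetic term cancels against the motion of the
  -- tracers.
  · have e1 : schU t (schH (-t) (-(Complex.I • F))).fn = -(Complex.I • F.fn) := by
      rw [schH_fn, ← schU_add, add_neg_cancel, schU_zero]; rfl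
    have e0 : inner ℂ φ (-(Complex.I • F)) = -(Complex.I *
        (inner ℂ φ.fn F.fn + ∑ j, inner ℂ (φ.partialDeriv j) (F.partialDeriv j))) := by
      rw [H1.inner_eq]
      change inner ℂ φ.fn (-(Complex.I • F.fn)) +
        ∑ j, inner ℂ (φ.partialDeriv j) (-(Complex.I • F.partialDeriv j)) = _
      simp only [inner_neg_right, inner_smul_right, Finset.sum_neg_distrib, ← Finset.mul_sum]
      ring
    have e2 : (inner ℂ F.fn F.fn).im = 0 := inner_self_im (𝕜 := ℂ) F.fn
    have e3 : (inner ℂ φ.fn F.fn).im = 0 := inner_interaction_im hv hw (y t).1 φ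
    have e4 : ∑ j, inner ℂ (F.partialDeriv j) (φ.partialDeriv j) =
        conj (∑ j, inner ℂ (φ.partialDeriv j) (F.partialDeriv j)) := by
      rw [map_sum]
      exact Finset.sum_congr rfl fun j _ => (inner_conj_symm _ _).symm
    rw [e1, inner_schH_neg, ← hφ, e0, ← hF, e4, inner_neg_right, inner_smul_right]
    simp only [Complex.neg_re, Complex.I_mul_re, Complex.sub_re, Complex.add_im, Complex.conj_im, e2, e3]
    ring
  · simp only [energy_eq hv, evolve, LinearIsometry.norm_map, potentialEnergy, Pi.add_apply]
    ring

end Energy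

/-! ### A priori bounds and global solutions -/

section Global
variable {v w : R3 → ℝ} {K C : ℝ} {m : ℕ}

theorem abs_integral_mul_norm_sq_le {a : R3 → ℝ} {A : ℝ} (hb : ∀ x, |a x| ≤ A) (f : L2) :
    |∫ x, a x * ‖f x‖ ^ 2| ≤ A * ‖f‖ ^ 2 := by
  rw [L2_norm_sq_eq, ← integral_const_mul, ← Real.norm_eq_abs]
  refine norm_integral_le_of_norm_le ((integrable_norm_sq f).const_mul _)
    (Eventually.of_forall fun x => ?_)
  rw [norm_mul, Real.norm_eq_abs, Real.norm_eq_abs, abs_of_nonneg (sq_nonneg ‖f x‖)]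
  exact mul_le_mul_of_nonneg_right (hb x) (sq_nonneg _)

/-- The energy controls the velocities and the `H¹` norm. -/
theorem norm_sq_le_energy (hv : IsKernel v K) (hw : IsTame w C) (z : Phase m) :
    ‖z.2.1‖ ^ 2 + ‖z.2.2‖ ^ 2 ≤
      2 * energy v w z + (K ^ 2 + 2 * m * C + 1) * (‖z.2.2.fn‖ ^ 2 + ‖z.2.2.fn‖ ^ 6) := by
  set M := ‖z.2.2.fn‖
  have h1 : |∫ x, pairB v z.2.2.fn z.2.2.fn x * ‖z.2.2.fn x‖ ^ 2| ≤ K * M * ‖z.2.2‖ * M ^ 2 :=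
    abs_integral_mul_norm_sq_le (hv.abs_pairB_le _ _) _
  have h2 : |tracerEnergy w z.1 z.2.2.fn| ≤ m * C * M ^ 2 :=
    abs_integral_mul_norm_sq_le (hw.isC1b z.1 0).bound _
  have h3 := (abs_le.1 h1).1
  have h4 := (abs_le.1 h2).1
  have hC : 0 ≤ m * C := mul_nonneg (Nat.cast_nonneg _) hw.nonneg
  rw [energy_eq hv, potentialEnergy]
  have h5 : 0 ≤ m * C * M ^ 6 := by positivity
  have h6 : 0 ≤ K ^ 2 * M ^ 2 := by positivity
  have h7 : 0 ≤ K ^ 2 * M ^ 6 := by positivity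
  have h8 : 0 ≤ M ^ 6 := by positivity
  -- Twice the energy is at least `|V|² + 2‖φ‖² - KM³‖φ‖ - 2mCM²`, and completing the square gives
  -- `KM³‖φ‖ ≤ ‖φ‖² + K²M⁶/4`.
  nlinarith [sq_nonneg (‖z.2.2‖ - K * M ^ 3 / 2), sq_nonneg M]

theorem eq_of_hasDerivAt_zero {f : ℝ → ℝ} {S : ℝ} (hS : 0 < S)
    (hf : ∀ t ∈ Set.Ioo (-S) S, HasDerivAt f 0 t) {t : ℝ} (ht : t ∈ Set.Ioo (-S) S) : f t = f 0 :=
  isOpen_Ioo.is_const_of_deriv_eq_zero isPreconnected_Ioo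
    (fun s hs => (hf s hs).differentiableAt.differentiableWithinAt)
    (fun s hs => (hf s hs).deriv) ht ⟨by linarith, hS⟩

theorem norm_fn_eq_of_isSolutionOn (hv : IsKernel v K) (hw : IsTame w C) {y : ℝ → Phase m} {S : ℝ}
    (hS : 0 < S) (hy : IsSolutionOn (fieldI hv hw) y S) {t : ℝ} (ht : t ∈ Set.Ioo (-S) S) :
    ‖(evolve t (y t)).2.2.fn‖ = ‖(y 0).2.2.fn‖ := by
  have := eq_of_hasDerivAt_zero hS (fun s hs => hasDerivAt_mass hv hw (hy s hs)) ht
  rw [← (schU t).norm_map] at this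
  exact (pow_left_inj₀ (norm_nonneg _) (norm_nonneg _) two_ne_zero).1 this

theorem energy_eq_of_isSolutionOn (hv : IsKernel v K) (hw : IsTame w C) {y : ℝ → Phase m} {S : ℝ}
    (hS : 0 < S) (hy : IsSolutionOn (fieldI hv hw) y S) {t : ℝ} (ht : t ∈ Set.Ioo (-S) S) :
    energy v w (evolve t (y t)) = energy v w (y 0) := by
  have := eq_of_hasDerivAt_zero hS (fun s hs => hasDerivAt_energy hv hw (hy s hs)) ht
  rwa [evolve_zero] at this

theorem bound_of_isSolutionOn (hv : IsKernel v K) (hw : IsTame w C) {y : ℝ → Phase m} {S : ℝ}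
    (hS : 0 < S) (hy : IsSolutionOn (fieldI hv hw) y S) {t : ℝ} (ht : t ∈ Set.Ioo (-S) S) :
    ‖(y t).2.1‖ ^ 2 + ‖(y t).2.2‖ ^ 2 ≤ 2 * energy v w (y 0) +
      (K ^ 2 + 2 * m * C + 1) * (‖(y 0).2.2.fn‖ ^ 2 + ‖(y 0).2.2.fn‖ ^ 6) := by
  have := norm_sq_le_energy hv hw (evolve t (y t))
  rw [energy_eq_of_isSolutionOn hv hw hS hy ht, norm_fn_eq_of_isSolutionOn hv hw hS hy ht] at this
  simpa only [evolve, LinearIsometry.norm_map] using this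

theorem exists_global_solution (hv : IsKernel v K) (hw : IsTame w C) (z₀ : Phase m) :
    ∃ y : ℝ → Phase m, y 0 = z₀ ∧ ∀ t, HasDerivAt y (fieldI hv hw t (y t)) t := by
  refine (isLocLip_fieldI hv hw).exists_global
    (fun x => (continuous_fieldI hv hw).comp (continuous_id.prodMk continuous_const)) z₀ fun T => ?_
  set B := 2 * energy v w z₀ +
    (K ^ 2 + 2 * m * C + 1) * (‖z₀.2.2.fn‖ ^ 2 + ‖z₀.2.2.fn‖ ^ 6) with hB
  -- The velocity and the `H¹` norm are at most `√B`, so the position moves by at most `√B T`. The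
  -- extra `√B` lets one number dominate all three components.
  refine ⟨‖z₀.1‖ + √B * (T + 1), fun S hS hST y hy0 hy t ht => ?_⟩
  have hb : ∀ s ∈ Set.Ioo (-S) S, ‖(y s).2.1‖ ≤ √B ∧ ‖(y s).2.2‖ ≤ √B := by
    intro s hs
    have := bound_of_isSolutionOn hv hw hS hy hs
    rw [hy0, ← hB] at this
    exact ⟨Real.le_sqrt_of_sq_le (by nlinarith [sq_nonneg ‖(y s).2.2‖]),
      Real.le_sqrt_of_sq_le (by nlinarith [sq_nonneg ‖(y s).2.1‖])⟩
  have hX : ‖(y t).1 - (y 0).1‖ ≤ √B * ‖t - 0‖ :=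
    Convex.norm_image_sub_le_of_norm_hasDerivWithin_le
      (fun s hs => (hasDerivAt_position (hy s hs)).hasDerivWithinAt) (fun s hs => (hb s hs).1)
      (convex_Ioo (-S) S) ⟨by linarith, hS⟩ ht
  have h0 : 0 ≤ √B := Real.sqrt_nonneg _
  have ht' : ‖t - 0‖ ≤ T := by
    rw [sub_zero, Real.norm_eq_abs]; exact (abs_lt.2 ht).le.trans hST
  have h1 : ‖(y t).1‖ ≤ ‖z₀.1‖ + √B * T := by
    have h2 := norm_add_le ((y t).1 - (y 0).1) (y 0).1
    rw [sub_add_cancel, hy0] at h2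
    rw [hy0] at hX
    nlinarith [mul_le_mul_of_nonneg_left ht' h0]
  have hT : 0 ≤ T := (norm_nonneg _).trans ht'
  have h3 : 0 ≤ √B * T := mul_nonneg h0 hT
  have h4 := norm_nonneg z₀.1
  rw [Prod.norm_def, Prod.norm_def]
  refine max_le (by nlinarith) (max_le ?_ ?_)
  · nlinarith [(hb t ht).1]
  · nlinarith [(hb t ht).2]

theorem isSolutionOn_of_hasDerivAt {E : Type*} [NormedAddCommGroup E] [NormedSpace ℝ E]
    {f : ℝ → E → E} {y : ℝ → E} (h : ∀ t, HasDerivAt y (f t (y t)) t) (S : ℝ) :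
    IsSolutionOn f y S := fun t _ => h t

theorem isMildSolution_unique (hv : IsKernel v K) (hw : IsTame w C) {z₀ : Phase m} {z z' : ℝ → Phase m}
    (hz : Continuous z) (h : IsMildSolution v w z₀ z) (hz' : Continuous z')
    (h' : IsMildSolution v w z₀ z') : z = z' := by
  obtain ⟨h0, h1⟩ := hasDerivAt_of_isMildSolution hv hw hz h
  obtain ⟨h0', h1'⟩ := hasDerivAt_of_isMildSolution hv hw hz' h'
  ext1 t
  have := (isLocLip_fieldI hv hw).unique (S := |t| + 1) (isSolutionOn_of_hasDerivAt h1 _)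
    (isSolutionOn_of_hasDerivAt h1' _) (h0.trans h0'.symm)
    (⟨by linarith [neg_abs_le t], by linarith [le_abs_self t]⟩ : t ∈ Set.Ioo (-(|t| + 1)) (|t| + 1))
  have := congrArg (evolve t) this
  simpa only [evolve_evolve_neg] using this

end Global

/-! ### The linearized field equation -/

section Linearized
variable {v w : R3 → ℝ} {K C : ℝ} {m : ℕ}

/-- The product `(v * Re(f̄ g)) u`. -/
def triple (hv : IsKernel v K) (f g u : H1) : H1 := (hv.isC1b f g).mulH u

/-- The product of the tracer potential and `u`. -/
def tracerMul (hw : IsTame w C) (X : Config m) (u : H1) : H1 := (hw.isC1b X).mulH u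

theorem norm_triple_le (hv : IsKernel v K) (f g u : H1) :
    ‖triple hv f g u‖ ≤ 8 * K * (‖f‖ * ‖g‖ * ‖u‖) :=
  (IsC1b.norm_mulH_le _ _).trans_eq (by ring)

theorem triple_sub_left (hv : IsKernel v K) (f f' g u : H1) :
    triple hv (f - f') g u = triple hv f g u - triple hv f' g u :=
  eq_sub_of_add_eq' (IsC1b.mulH_eq_add (hv.isC1b f' g) (hv.isC1b (f - f') g) (hv.isC1b f g)
    (fun x => by rw [H1.fn_sub, pairB_sub_left]; ring) u).symm

theorem triple_sub_middle (hv : IsKernel v K) (f g g' u : H1) :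
    triple hv f (g - g') u = triple hv f g u - triple hv f g' u :=
  eq_sub_of_add_eq' (IsC1b.mulH_eq_add (hv.isC1b f g') (hv.isC1b f (g - g')) (hv.isC1b f g)
    (fun x => by rw [hv.pairB_sub_right]; ring) u).symm

theorem triple_sub_right (hv : IsKernel v K) (f g u u' : H1) :
    triple hv f g (u - u') = triple hv f g u - triple hv f g u' := IsC1b.mulH_sub _ _ _

theorem tendsto_triple (hv : IsKernel v K) {ι : Type*} {l : Filter ι} {f g u : ι → H1} {f₀ g₀ u₀ : H1}
    (hf : Tendsto f l (𝓝 f₀)) (hg : Tendsto g l (𝓝 g₀)) (hu : Tendsto u l (𝓝 u₀)) :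
    Tendsto (fun n => triple hv (f n) (g n) (u n)) l (𝓝 (triple hv f₀ g₀ u₀)) := by
  rw [tendsto_iff_norm_sub_tendsto_zero]
  have e : ∀ n, triple hv (f n) (g n) (u n) - triple hv f₀ g₀ u₀ =
      triple hv (f n) (g n) (u n - u₀) + triple hv (f n) (g n - g₀) u₀ +
        triple hv (f n - f₀) g₀ u₀ := fun n => by
    rw [triple_sub_left, triple_sub_middle, triple_sub_right]; abel
  have hdf := tendsto_iff_norm_sub_tendsto_zero.1 hf
  have hdg := tendsto_iff_norm_sub_tendsto_zero.1 hg
  have hdu := tendsto_iff_norm_sub_tendsto_zero.1 hu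
  refine squeeze_zero (fun n => norm_nonneg _) (fun n => ?_)
    (((((hf.norm.mul hg.norm).mul hdu).const_mul (8 * K)).add
      (((hf.norm.mul hdg).mul_const ‖u₀‖).const_mul (8 * K))).add
      (((hdf.mul_const ‖g₀‖).mul_const ‖u₀‖).const_mul (8 * K)) |>.trans_eq (by simp))
  rw [e]
  exact (norm_add₃_le).trans (add_le_add_three (norm_triple_le hv _ _ _) (norm_triple_le hv _ _ _)
    (norm_triple_le hv _ _ _))

theorem tendsto_tracerMul (hw : IsTame w C) {ι : Type*} {l : Filter ι} {X : ι → Config m}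
    {X₀ : Config m} {u : ι → H1} {u₀ : H1} (hX : Tendsto X l (𝓝 X₀)) (hu : Tendsto u l (𝓝 u₀)) :
    Tendsto (fun n => tracerMul hw (X n) (u n)) l (𝓝 (tracerMul hw X₀ u₀)) := by
  rw [tendsto_iff_norm_sub_tendsto_zero]
  have e : ∀ n, tracerMul hw (X n) (u n) - tracerMul hw X₀ u₀ =
      (hw.isC1b (X n)).mulH (u n - u₀) + (hw.isC1b_sub (X n) X₀).mulH u₀ := fun n => by
    have := IsC1b.mulH_eq_add (hw.isC1b X₀) (hw.isC1b_sub (X n) X₀) (hw.isC1b (X n))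
      (fun x => by ring) u₀
    rw [IsC1b.mulH_sub, this, tracerMul, tracerMul]; abel
  have hdX := tendsto_iff_norm_sub_tendsto_zero.1 hX
  have hdu := tendsto_iff_norm_sub_tendsto_zero.1 hu
  refine squeeze_zero (fun n => norm_nonneg _) (fun n => ?_)
    ((hdu.const_mul (4 * (m * C))).add
      ((((hdX.const_mul C).const_mul (m : ℝ)).const_mul 4).mul_const ‖u₀‖) |>.trans_eq (by simp))
  rw [e]
  exact (norm_add_le _ _).trans (add_le_add (IsC1b.norm_mulH_le _ _) (IsC1b.norm_mulH_le _ _))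

/-- The derivative of the interaction in the direction `j`, with `η` in place of `∂ⱼφ`. -/
def linearized (hv : IsKernel v K) (hw : IsTame w C) {j : Fin 3}
    (hj : IsTame (fun x => fderiv ℝ w x (basisVec j)) C) (X : Config m) (φ η : H1) : H1 :=
  (isC1b_potential hv hw X φ).mulH η + (triple hv η φ φ + triple hv η φ φ) + tracerMul hj X φ

variable {j : Fin 3}

theorem linearized_eq (hv : IsKernel v K) (hw : IsTame w C)
    (hj : IsTame (fun x => fderiv ℝ w x (basisVec j)) C) (X : Config m) (φ η : H1) :
    linearized hv hw hj X φ η = triple hv φ φ η + tracerMul hw X η +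
      (triple hv η φ φ + triple hv η φ φ) + tracerMul hj X φ := by
  rw [linearized, IsC1b.mulH_eq_add (hv.isC1b φ φ) (hw.isC1b X) (isC1b_potential hv hw X φ)
    (fun x => rfl)]
  rfl

theorem norm_linearized_sub_le (hv : IsKernel v K) (hw : IsTame w C)
    (hj : IsTame (fun x => fderiv ℝ w x (basisVec j)) C) (X : Config m) {φ : H1} {R : ℝ}
    (hφ : ‖φ‖ ≤ R) (η η' : H1) :
    ‖linearized hv hw hj X φ η - linearized hv hw hj X φ η'‖ ≤
      (24 * K * R ^ 2 + 4 * (m * C)) * ‖η - η'‖ := by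
  have hK := hv.nonneg
  have e : linearized hv hw hj X φ η - linearized hv hw hj X φ η' =
      triple hv φ φ (η - η') + tracerMul hw X (η - η') +
        (triple hv (η - η') φ φ + triple hv (η - η') φ φ) := by
    have ht : tracerMul hw X (η - η') = tracerMul hw X η - tracerMul hw X η' := IsC1b.mulH_sub _ _ _
    rw [linearized_eq, linearized_eq, triple_sub_left, triple_sub_right, ht]
    abel
  have h1 := norm_triple_le hv φ φ (η - η')
  have h2 := norm_triple_le hv (η - η') φ φ
  have h3 : ‖tracerMul hw X (η - η')‖ ≤ 4 * (m * C) * ‖η - η'‖ := IsC1b.norm_mulH_le _ _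
  have h4 : ‖φ‖ * ‖φ‖ ≤ R ^ 2 := by
    rw [← sq]; exact pow_le_pow_left₀ (norm_nonneg _) hφ 2
  have h5 := mul_le_mul_of_nonneg_left (mul_le_mul_of_nonneg_right h4 (norm_nonneg (η - η'))) hK
  rw [e]
  refine (norm_add₃_le).trans ?_
  have h6 := norm_add_le (triple hv (η - η') φ φ) (triple hv (η - η') φ φ)
  linarith

theorem norm_linearized_zero_le (hv : IsKernel v K) (hw : IsTame w C)
    (hj : IsTame (fun x => fderiv ℝ w x (basisVec j)) C) (X : Config m) (φ : H1) :
    ‖linearized hv hw hj X φ 0‖ ≤ 4 * (m * C) * ‖φ‖ := by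
  have h1 : ∀ f g, triple hv f g 0 = 0 := fun f g => by
    have := triple_sub_right hv f g 0 0; rwa [sub_zero, sub_self] at this
  have h2 : ∀ g u, triple hv 0 g u = 0 := fun g u => by
    have := triple_sub_left hv 0 0 g u; rwa [sub_zero, sub_self] at this
  have h3 : tracerMul hw X 0 = 0 := by
    have := IsC1b.mulH_sub (hw.isC1b X) 0 0
    rw [sub_zero, sub_self] at this; exact this
  rw [linearized_eq, h1, h2, h3, add_zero, add_zero, zero_add]
  exact IsC1b.norm_mulH_le _ _

theorem tendsto_linearized (hv : IsKernel v K) (hw : IsTame w C)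
    (hj : IsTame (fun x => fderiv ℝ w x (basisVec j)) C) {ι : Type*} {l : Filter ι} {X : ι → Config m}
    {X₀ : Config m} {φ η : ι → H1} {φ₀ η₀ : H1} (hX : Tendsto X l (𝓝 X₀)) (hφ : Tendsto φ l (𝓝 φ₀))
    (hη : Tendsto η l (𝓝 η₀)) :
    Tendsto (fun n => linearized hv hw hj (X n) (φ n) (η n)) l
      (𝓝 (linearized hv hw hj X₀ φ₀ η₀)) := by
  simp only [linearized_eq]
  exact (((tendsto_triple hv hφ hφ hη).add (tendsto_tracerMul hw hX hη)).add
    ((tendsto_triple hv hη hφ hφ).add (tendsto_triple hv hη hφ hφ))).add (tendsto_tracerMul hj hX hφ)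

/-- The linearization on `L²`. -/
def linearizedL2 (v w : R3 → ℝ) (X : Config m) (j : Fin 3) (φ : H1) (e : L2) : L2 :=
  mulR (fun x => pairB v φ.fn φ.fn x + totalTracer w x X) e +
    (mulR (pairB v e φ.fn) φ.fn + mulR (pairB v e φ.fn) φ.fn) + mulR (tracerPartial w X j) φ.fn

theorem IsKernel.isBddBy_pairB (hv : IsKernel v K) (e : L2) (φ : H1) :
    IsBddBy (fun x => (pairB v e φ.fn x : ℂ)) (K * ‖e‖ * ‖φ‖) :=
  isBddBy_ofReal (hv.aestronglyMeasurable_pairB e φ) (hv.abs_pairB_le e φ)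

/-- Here `∂ⱼφ` is known only to be in `L²`, which is why the linearization is also defined for `L²`
directions; a polarized Hartree potential tolerates one such factor. -/
theorem interaction_partialDeriv (hv : IsKernel v K) (hw : IsTame w C) (X : Config m) (φ : H1)
    (j : Fin 3) :
    (interaction hv hw X φ).partialDeriv j = linearizedL2 v w X j φ (φ.partialDeriv j) := by
  have hp := hv.isBddBy_pairB (φ.partialDeriv j) φ
  have ht := (hw.isC1b X j).isBddBy'
  rw [interaction, IsC1b.mulH_partialDeriv, linearizedL2]
  have : mulR (fun x => (pairB v (φ.partialDeriv j) φ.fn x + pairB v (φ.partialDeriv j) φ.fn x)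
        + tracerPartial w X j x) φ.fn =
      mulR (pairB v (φ.partialDeriv j) φ.fn) φ.fn + mulR (pairB v (φ.partialDeriv j) φ.fn) φ.fn +
        mulR (tracerPartial w X j) φ.fn := by
    simp only [mulR]
    rw [← hp.add_mulL2 hp, ← (hp.add hp).add_mulL2 ht]
    exact mulL2_congr (fun x => by push_cast; rfl) _
  rw [this]; abel

theorem norm_linearizedL2_sub_le (hv : IsKernel v K) (hw : IsTame w C) (X : Config m) (j : Fin 3)
    {φ : H1} {R : ℝ} (hφ : ‖φ‖ ≤ R) (e e' : L2) :
    ‖linearizedL2 v w X j φ e - linearizedL2 v w X j φ e'‖ ≤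
      (4 * K * R ^ 2 + m * C) * ‖e - e'‖ := by
  have hK := hv.nonneg
  have hb := (isC1b_potential hv hw X φ 0).isBddBy
  have h1 : mulR (pairB v e φ.fn) φ.fn = mulR (pairB v e' φ.fn) φ.fn + mulR (pairB v (e - e') φ.fn) φ.fn := by
    simp only [mulR]
    rw [← (hv.isBddBy_pairB e' φ).add_mulL2 (hv.isBddBy_pairB (e - e') φ)]
    refine mulL2_congr (fun x => ?_) _
    rw [pairB_sub_left]; push_cast; ring
  have e1 : linearizedL2 v w X j φ e - linearizedL2 v w X j φ e' =
      mulR (fun x => pairB v φ.fn φ.fn x + totalTracer w x X) (e - e') +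
        mulR (pairB v (e - e') φ.fn) φ.fn + mulR (pairB v (e - e') φ.fn) φ.fn := by
    have h2 : mulR (fun x => pairB v φ.fn φ.fn x + totalTracer w x X) (e - e') =
        mulR (fun x => pairB v φ.fn φ.fn x + totalTracer w x X) e -
          mulR (fun x => pairB v φ.fn φ.fn x + totalTracer w x X) e' := hb.mulL2_sub e e'
    rw [linearizedL2, linearizedL2, h1, h2]; abel
  have h2 := hb.norm_mulL2_le (e - e')
  have h3 := (hv.isBddBy_pairB (e - e') φ).norm_mulL2_le φ.fn
  have h4 : ‖φ‖ * ‖φ‖ ≤ R ^ 2 := by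
    rw [← sq]; exact pow_le_pow_left₀ (norm_nonneg _) hφ 2
  have h5 := mul_le_mul_of_nonneg_left (mul_le_mul_of_nonneg_right h4 (norm_nonneg (e - e'))) hK
  have h6 : K * ‖e - e'‖ * ‖φ‖ * ‖φ.fn‖ ≤ K * ‖e - e'‖ * ‖φ‖ * ‖φ‖ :=
    mul_le_mul_of_nonneg_left φ.norm_fn_le (by positivity)
  rw [e1]
  refine (norm_add₃_le).trans ?_
  simp only [mulR]
  linarith

end Linearized

/-- Affine equations with bounded coefficients have global solutions. -/
theorem exists_global_of_lipschitz {E : Type*} [NormedAddCommGroup E] [NormedSpace ℝ E] [CompleteSpace E]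
    {f : ℝ → E → E} {A ε : ℝ} (hA : 0 ≤ A) (hε : 0 ≤ ε) (hf : ∀ t x y, ‖f t x - f t y‖ ≤ A * ‖x - y‖)
    (h0 : ∀ t, ‖f t 0‖ ≤ ε) (hc : ∀ x, Continuous fun t => f t x) (y₀ : E) :
    ∃ y : ℝ → E, y 0 = y₀ ∧ ∀ t, HasDerivAt y (f t (y t)) t := by
  refine IsLocLip.exists_global (fun T R => ⟨A.toNNReal, fun t _ => ?_⟩) hc y₀ fun T =>
    ⟨gronwallBound ‖y₀‖ A ε T, fun S hS hST y hy0 hy t ht => ?_⟩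
  · refine (LipschitzWith.of_dist_le_mul fun x y => ?_).lipschitzOnWith
    rw [dist_eq_norm, dist_eq_norm, Real.coe_toNNReal _ hA]; exact hf t x y
  · have := norm_le_of_norm_deriv_le hA hε hy (fun s _ => by
      have h1 := hf s (y s) 0
      have h2 := norm_add_le (f s (y s) - f s 0) (f s 0)
      rw [sub_add_cancel] at h2
      rw [sub_zero] at h1
      linarith [h0 s]) t ht
    rw [hy0] at this
    exact this.trans (gronwallBound_mono (norm_nonneg _) hε hA hST)

/-! ### Strong solutions -/

theorem norm_neg_I_smul (u : H1) : ‖-(Complex.I • u)‖ = ‖u‖ := by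
  rw [norm_neg, norm_smul, Complex.norm_I, one_mul]

theorem continuous_schH_comp {a : ℝ → ℝ} {ψ : ℝ → H1} (ha : Continuous a) (hψ : Continuous ψ) :
    Continuous fun t => schH (a t) (ψ t) :=
  continuous_iff_continuousAt.2 fun t =>
    tendsto_uncurry_of_lipschitzWith (T := fun t u => schH t u) (fun t => (schH t).lipschitz)
      continuous_schH (ha.tendsto t) (hψ.tendsto t)

section Strong
variable {v w : R3 → ℝ} {K C : ℝ} {m : ℕ} {y : ℝ → Phase m}

theorem exists_norm_boson_le (hv : IsKernel v K) (hw : IsTame w C)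
    (hy : ∀ t, HasDerivAt y (fieldI hv hw t (y t)) t) : ∃ R, ∀ t, ‖(y t).2.2‖ ≤ R := by
  refine ⟨√(2 * energy v w (y 0) +
      (K ^ 2 + 2 * m * C + 1) * (‖(y 0).2.2.fn‖ ^ 2 + ‖(y 0).2.2.fn‖ ^ 6)), fun t => ?_⟩
  have := bound_of_isSolutionOn hv hw (S := |t| + 1) (by positivity) (isSolutionOn_of_hasDerivAt hy _)
    (⟨by linarith [neg_abs_le t], by linarith [le_abs_self t]⟩ : t ∈ Set.Ioo (-(|t| + 1)) (|t| + 1))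
  exact Real.le_sqrt_of_sq_le (by nlinarith [sq_nonneg ‖(y t).2.1‖])

theorem eq_zero_of_norm_deriv_le {E : Type*} [NormedAddCommGroup E] [NormedSpace ℝ E] {δ δ' : ℝ → E}
    {A : ℝ} (hA : 0 ≤ A) (h : ∀ t, HasDerivAt δ (δ' t) t) (hb : ∀ t, ‖δ' t‖ ≤ A * ‖δ t‖)
    (h0 : δ 0 = 0) (t : ℝ) : δ t = 0 := by
  have := norm_le_of_norm_deriv_le (S := |t| + 1) hA le_rfl (fun s _ => h s)
    (fun s _ => (hb s).trans_eq (add_zero _).symm) t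
    ⟨by linarith [neg_abs_le t], by linarith [le_abs_self t]⟩
  rw [h0, norm_zero, gronwallBound_ε0, zero_mul] at this
  exact norm_le_zero_iff.1 this

/-- The vector field of the linearized equation in the interaction picture. -/
def linearizedField (hv : IsKernel v K) (hw : IsTame w C) {j : Fin 3}
    (hj : IsTame (fun x => fderiv ℝ w x (basisVec j)) C) (y : ℝ → Phase m) (t : ℝ) (ζ : H1) : H1 :=
  schH (-t) (-(Complex.I • linearized hv hw hj (y t).1 (schH t (y t).2.2) (schH t ζ)))

/-- The equation is affine, and the bound on `‖φ_t‖_{H¹}` holds for all times, so its coefficients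
are bounded globally and Grönwall's inequality excludes blow-up. -/
theorem exists_linearized_solution (hv : IsKernel v K) (hw : IsTame w C) {j : Fin 3}
    (hj : IsTame (fun x => fderiv ℝ w x (basisVec j)) C) (hy : Continuous y) {R : ℝ}
    (hR : ∀ t, ‖(y t).2.2‖ ≤ R) (ζ₀ : H1) :
    ∃ ζ : ℝ → H1, ζ 0 = ζ₀ ∧ ∀ t, HasDerivAt ζ (linearizedField hv hw hj y t (ζ t)) t := by
  have hK := hv.nonneg
  have hC := hw.nonneg
  have hR0 : 0 ≤ R := (norm_nonneg _).trans (hR 0)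
  have hφ : ∀ t, ‖schH t (y t).2.2‖ ≤ R := fun t => by rw [LinearIsometry.norm_map]; exact hR t
  refine exists_global_of_lipschitz (A := 24 * K * R ^ 2 + 4 * (m * C)) (ε := 4 * (m * C) * R)
    (by positivity) (by positivity) (fun t x x' => ?_) (fun t => ?_) (fun x => ?_) ζ₀
  · have := norm_linearized_sub_le hv hw hj (y t).1 (hφ t) (schH t x) (schH t x')
    rw [← map_sub, LinearIsometry.norm_map] at this
    rwa [linearizedField, linearizedField, ← map_sub, LinearIsometry.norm_map, neg_sub_neg, ← smul_sub,
      ← norm_neg, ← smul_neg, neg_sub, norm_smul, Complex.norm_I, one_mul]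
  · rw [linearizedField, LinearIsometry.norm_map, norm_neg_I_smul, map_zero]
    exact (norm_linearized_zero_le hv hw hj _ _).trans
      (mul_le_mul_of_nonneg_left (hφ t) (by positivity))
  · have h1 := continuous_schH_comp continuous_id hy.snd.snd
    have h2 := continuous_schH x
    have h3 : Continuous fun t => linearized hv hw hj (y t).1 (schH t (y t).2.2) (schH t x) :=
      continuous_iff_continuousAt.2 fun t =>
        tendsto_linearized hv hw hj (hy.fst.tendsto t) (h1.tendsto t) (h2.tendsto t)
    exact continuous_schH_comp continuous_neg (h3.const_smul Complex.I).neg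

theorem hasDerivAt_partialDeriv (hv : IsKernel v K) (hw : IsTame w C)
    (hy : ∀ t, HasDerivAt y (fieldI hv hw t (y t)) t) (j : Fin 3) (t : ℝ) :
    HasDerivAt (fun s => (y s).2.2.partialDeriv j)
      (schU (-t) (-(Complex.I • linearizedL2 v w (y t).1 j (schH t (y t).2.2)
        (schU t ((y t).2.2.partialDeriv j))))) t := by
  have h := hasDerivAt_clm ((partialL j).restrictScalars ℝ) (hasDerivAt_boson (hy t))
  refine h.congr_deriv ?_
  change schU (-t) (-(Complex.I • (interaction hv hw (y t).1 (schH t (y t).2.2)).partialDeriv j)) = _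
  rw [interaction_partialDeriv]; rfl

/-- Both sides solve the same affine equation in `L²` with the same initial value, so Grönwall's
inequality makes their difference vanish. This is the gain of regularity: `∂ⱼψ`, a priori only in
`L²`, is in `H¹` at every time. -/
theorem linearized_solution_fn (hv : IsKernel v K) (hw : IsTame w C) {j : Fin 3}
    (hj : IsTame (fun x => fderiv ℝ w x (basisVec j)) C)
    (hy : ∀ t, HasDerivAt y (fieldI hv hw t (y t)) t) {R : ℝ} (hR : ∀ t, ‖(y t).2.2‖ ≤ R) {ζ : ℝ → H1}
    (hζ : ∀ t, HasDerivAt ζ (linearizedField hv hw hj y t (ζ t)) t)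
    (h0 : (ζ 0).fn = (y 0).2.2.partialDeriv j) (t : ℝ) : (ζ t).fn = (y t).2.2.partialDeriv j := by
  have hK := hv.nonneg
  have hC := hw.nonneg
  have hφ : ∀ t, ‖schH t (y t).2.2‖ ≤ R := fun t => by rw [LinearIsometry.norm_map]; exact hR t
  have h1 : ∀ t, HasDerivAt (fun s => (ζ s).fn) (schU (-t) (-(Complex.I •
      linearizedL2 v w (y t).1 j (schH t (y t).2.2) (schU t (ζ t).fn)))) t := fun t =>
    hasDerivAt_clm fnR (hζ t)
  refine sub_eq_zero.1 (eq_zero_of_norm_deriv_le (A := 4 * K * R ^ 2 + m * C) (by positivity)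
    (fun s => (h1 s).sub (hasDerivAt_partialDeriv hv hw hy j s)) (fun s => ?_) (sub_eq_zero.2 h0) t)
  have := norm_linearizedL2_sub_le hv hw (y s).1 j (hφ s) (schU s (ζ s).fn)
    (schU s ((y s).2.2.partialDeriv j))
  rw [← map_sub, LinearIsometry.norm_map] at this
  rwa [← map_sub, LinearIsometry.norm_map, neg_sub_neg, ← smul_sub,
      ← norm_neg, ← smul_neg, neg_sub, norm_smul, Complex.norm_I, one_mul]

/-- The `H²` function with given first partial derivatives. -/
def H2.mk (u : H1) (g : Fin 3 → H1) (h : ∀ i, IsPartial i u.fn (g i).fn) : H2 :=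
  ⟨WithLp.toLp 2 (fun o => o.elim u g), h⟩

theorem continuous_H2_mk {u : ℝ → H1} {g : Fin 3 → ℝ → H1}
    (h : ∀ t i, IsPartial i (u t).fn (g i t).fn) (hu : Continuous u) (hg : ∀ i, Continuous (g i)) :
    Continuous fun t => H2.mk (u t) (fun i => g i t) (h t) := by
  refine Continuous.subtype_mk ?_ _
  refine (PiLp.continuous_toLp 2 _).comp (continuous_pi fun o => ?_)
  rcases o with _ | i
  · exact hu
  · exact hg i

theorem fourier_laplacian (u : H2) : (𝓕 u.laplacian : L2) =ᵐ[volume]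
    fun ξ => ((-(2 * Real.pi * ‖ξ‖) ^ 2 : ℝ) : ℂ) * (𝓕 u.toH1.fn : L2) ξ := by
  have e : (𝓕 u.laplacian : L2) = ∑ i, 𝓕 ((u.1 (some i)).partialDeriv i) :=
    map_sum (Lp.fourierTransformₗᵢ R3 ℂ) _ _
  set g : Fin 3 → L2 := fun i => 𝓕 ((u.1 (some i)).partialDeriv i)
  rw [e, Fin.sum_univ_three]
  filter_upwards [Lp.coeFn_add (g 0 + g 1) (g 2), Lp.coeFn_add (g 0) (g 1),
    ae_all_iff.2 fun i => isPartial_iff.1 ((u.1 (some i)).isPartial i),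
    ae_all_iff.2 fun i => isPartial_iff.1 (u.2 i)] with ξ h0 h1 h2 h3
  rw [h0, Pi.add_apply, h1, Pi.add_apply]
  have h4 : ∀ i, g i ξ =
      -(2 * Real.pi) ^ 2 * ((ξ i : ℝ) : ℂ) ^ 2 * (𝓕 u.toH1.fn : L2) ξ := fun i => by
    refine (h2 i).trans ?_
    rw [h3 i]
    change partialSymbol i ξ * (partialSymbol i ξ * (𝓕 u.toH1.fn : L2) ξ) = _
    rw [partialSymbol]
    linear_combination (4 * Real.pi ^ 2 * ((ξ i : ℝ) : ℂ) ^ 2 * (𝓕 u.toH1.fn : L2) ξ) * Complex.I_sq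
  rw [h4, h4, h4, mul_pow (2 * Real.pi) ‖ξ‖ 2, norm_sq_eq_sum, Fin.sum_univ_three]
  push_cast; ring

/-- On `H²`, the free group is differentiable in `L²`. -/
theorem hasDerivAt_schU (u : H2) :
    HasDerivAt (fun s => schU s u.toH1.fn) (Complex.I • u.laplacian) 0 := by
  refine hasDerivAt_of_multiplier (fourier_schU_exp u.toH1.fn) ?_
  rw [FourierTransform.fourier_smul]
  filter_upwards [fourier_laplacian u, Lp.coeFn_smul Complex.I (𝓕 u.laplacian : L2)] with ξ h1 h2
  rw [h2, Pi.smul_apply, h1, smul_eq_mul]; ring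

/-- Only the value at time `t` has to lie in `H²`: the quotient splits into the free evolution of
that fixed function and the evolved quotient of `ψ`. -/
theorem hasDerivAt_schU_comp {ψ : ℝ → L2} {ψ' : L2} {t : ℝ} (hψ : HasDerivAt ψ ψ' t) (u : H2)
    (hu : u.toH1.fn = schU t (ψ t)) :
    HasDerivAt (fun s => schU s (ψ s)) (schU t ψ' + Complex.I • u.laplacian) t := by
  rw [hasDerivAt_iff_tendsto_slope_zero]
  simp only [slope_schU_comp]
  rw [← hu]
  exact (tendsto_schU_slope hψ).add (hasDerivAt_schU u).tendsto_slope

/-- Solutions with initial field in `H²` are strong solutions. -/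
theorem isStrongSolution (hv : IsKernel v K) (hw : IsTame w C)
    (hj : ∀ j, IsTame (fun x => fderiv ℝ w x (basisVec j)) C)
    (hy : ∀ t, HasDerivAt y (fieldI hv hw t (y t)) t) {u₀ : H2} (hu₀ : u₀.toH1 = (y 0).2.2) :
    IsStrongSolution v w (y 0) (fun t => evolve t (y t)) := by
  have hyc : Continuous y := continuous_iff_continuousAt.2 fun t => (hy t).continuousAt
  obtain ⟨R, hR⟩ := exists_norm_boson_le hv hw hy
  -- The solutions start from the first derivatives of the initial field, which are in `H¹` because
  -- that field is in `H²`.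
  choose ζ hζ0 hζ using fun j => exists_linearized_solution hv hw (hj j) hyc hR (u₀.1 (some j))
  have hfn : ∀ j t, (ζ j t).fn = (y t).2.2.partialDeriv j := fun j =>
    linearized_solution_fn hv hw (hj j) hy hR (hζ j) (by
      rw [hζ0]
      refine isPartial_unique (u₀.2 j) ?_
      have := (y 0).2.2.isPartial j
      rw [← hu₀] at this ⊢
      exact this)
  have hζc : ∀ j, Continuous fun t => schH t (ζ j t) := fun j =>
    continuous_schH_comp continuous_id
      (continuous_iff_continuousAt.2 fun t => (hζ j t).continuousAt)
  have hφc : Continuous fun t => schH t (y t).2.2 := continuous_schH_comp continuous_id hyc.snd.snd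
  have hpart : ∀ t i, IsPartial i (schH t (y t).2.2).fn (schH t (ζ i t)).fn := fun t i => by
    rw [schH_fn t (ζ i t), hfn]; exact (schH t (y t).2.2).isPartial i
  set u : ℝ → H2 := fun t => H2.mk (schH t (y t).2.2) (fun i => schH t (ζ i t)) (hpart t) with hu
  have huc : Continuous u := continuous_H2_mk (g := fun i t => schH t (ζ i t)) hpart hφc hζc
  set F : ℝ → H1 := fun t => interaction hv hw (y t).1 (schH t (y t).2.2) with hF
  have hd : ∀ t, HasDerivAt (fun s => (schH s (y s).2.2).fn)
      (-(Complex.I • (F t).fn) + Complex.I • (u t).laplacian) t := by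
    intro t
    have h1 : HasDerivAt (fun s => (y s).2.2.fn) (schU (-t) (-(Complex.I • (F t).fn))) t :=
      hasDerivAt_clm fnR (hasDerivAt_boson (hy t))
    have h2 := hasDerivAt_schU_comp h1 (u t) rfl
    rwa [← schU_add, add_neg_cancel, schU_zero] at h2
  have hFc : Continuous fun t => -(Complex.I • (F t).fn) := by
    have h1 : Continuous fun t => nonlinearity hv hw (evolve t (y t)) :=
      (continuous_nonlinearity hv hw).comp (continuous_evolve.comp (continuous_id.prodMk hyc))
    exact fnL.continuous.comp h1.snd.snd
  have hLc : Continuous fun t => (u t).laplacian :=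
    continuous_finsetSum _ fun i _ => (partialL i).continuous.comp (hζc i)
  refine ⟨evolve_zero _, fun t => hasDerivAt_position (hy t), fun t => hasDerivAt_velocity (hy t), ?_,
    u, huc, fun t => rfl, fun t => ⟨(F t).fn, (isInteraction_iff hv hw _ _ _).2 rfl, ?_⟩⟩
  · refine contDiff_one_iff_deriv.2 ⟨fun t => (hd t).differentiableAt, ?_⟩
    refine (hFc.add (hLc.const_smul Complex.I)).congr fun t => ((hd t).deriv).symm
  · refine (congrArg (fun f : L2 => Complex.I • f) (hd t).deriv).trans ?_
    rw [smul_add, smul_neg, smul_smul, smul_smul, Complex.I_mul_I, neg_one_smul, neg_one_smul]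
    abel

end Strong

end

end MeanField

/-! ### The theorem on the mean-field system. -/

theorem mainTheorem5 (m : ℕ) (v w : MeanField.R3 → ℝ)
    (hvw : MeanField.PotentialCondition v w) :
    ∃ μ : ℝ, 0 < μ ∧ ∀ z₀ : MeanField.Phase m,
      ∃ z : ℝ → MeanField.Phase m,
        (Continuous z ∧ MeanField.IsMildSolution v w z₀ z) ∧
        (∀ z' : ℝ → MeanField.Phase m,
          Continuous z' → MeanField.IsMildSolution v w z₀ z' → z' = z) ∧
        (∀ t, ‖(z t).2.2.fn‖ = ‖z₀.2.2.fn‖) ∧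
        (∀ t, MeanField.energy v w (z t) = MeanField.energy v w z₀) ∧
        (∀ t, ‖(z t).2.1‖ ^ 2 + ‖(z t).2.2‖ ^ 2 ≤
          2 * MeanField.energy v w z₀ + μ * (‖z₀.2.2.fn‖ ^ 2 + ‖z₀.2.2.fn‖ ^ 6)) ∧
        ((∃ u₀ : MeanField.H2, u₀.toH1 = z₀.2.2) →
          MeanField.IsStrongSolution v w z₀ z) := by
  obtain ⟨K, hv⟩ := hvw.exists_isKernel
  obtain ⟨C, hw, hj⟩ := hvw.exists_isTame
  have hC : 0 ≤ m * C := mul_nonneg (Nat.cast_nonneg _) hw.nonneg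
  -- The constant of `norm_sq_le_energy`. It is fixed before the initial data, as `K` and `C` come
  -- from `v` and `w` alone; the summand 1 makes it positive.
  refine ⟨K ^ 2 + 2 * m * C + 1, by nlinarith [sq_nonneg K], fun z₀ => ?_⟩
  obtain ⟨y, rfl, hy⟩ := MeanField.exists_global_solution hv hw z₀
  obtain ⟨hz, hmild⟩ := MeanField.isMildSolution_of_hasDerivAt hv hw hy
  have hS : ∀ t : ℝ, 0 < |t| + 1 := fun t => by positivity
  have ht : ∀ t : ℝ, t ∈ Set.Ioo (-(|t| + 1)) (|t| + 1) := fun t =>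
    ⟨by linarith [neg_abs_le t], by linarith [le_abs_self t]⟩
  have hsol := fun t : ℝ => MeanField.isSolutionOn_of_hasDerivAt hy (|t| + 1)
  refine ⟨fun t => MeanField.evolve t (y t), ⟨hz, hmild⟩,
    fun z' hz' h' => MeanField.isMildSolution_unique hv hw hz' h' hz hmild,
    fun t => MeanField.norm_fn_eq_of_isSolutionOn hv hw (hS t) (hsol t) (ht t),
    fun t => MeanField.energy_eq_of_isSolutionOn hv hw (hS t) (hsol t) (ht t), fun t => ?_, ?_⟩
  · have := MeanField.bound_of_isSolutionOn hv hw (hS t) (hsol t) (ht t)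
    simpa only [MeanField.evolve, LinearIsometry.norm_map] using this
  · rintro ⟨u₀, hu₀⟩
    exact MeanField.isStrongSolution hv hw hj hy hu₀
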